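/- **Setting.** Let $n\ge 2$, $m\ge 1$, $\alpha\in(1,2)$, let $\Omega\subset\mathbb{R}^n$ be a bounded domain with Lipschitz boundary, $Q=\mathbb{R}^{2n}\setminus\big((\mathbb{R}^n\setminus\Omega)\times(\mathbb{R}^n\setminus\Omega)\big)$, $2^*_\alpha=\frac{2n}{n-\alpha}$ and $$c(n,\alpha)=\frac{\alpha\,\Gamma\left(\frac{n+\alpha}{2}\right)}{\Gamma\left(1-\frac{\alpha}{2}\right)\pi^{n/2}2^{2-\alpha}} .$$ For functions $z_1,z_2$ put $\langle z_1,z_2\rangle_Q=\int_Q\frac{(z_1(x)-z_1(y))(z_2(x)-z_2(y))}{|x-y|^{n+\alpha}}\,dx\,dy$. Let $X^{\alpha/2}$ be the space of (classes of) functions $z:\mathbb{R}^n\to\mathbb{R}$ with $z|_\Omega\in L^2(\Omega)$ and $\frac{z(x)-z(y)}{|x-y|^{(n+\alpha)/2}}\in L^2(Q)$; let $X_0^{\alpha/2}=\{z\in X^{\alpha/2}: z=0 \text{ a.e. in }\mathbb{R}^n\setminus\Omega\}$ with the norm $\|z\|_{X_0^{\alpha/2}}=\langle z,z\rangle_Q^{1/2}$,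 and $Y^{\alpha/2}=X^{\alpha/2}\cap L^2(\mathbb{R}^n)$ with the norm $\|z\|_{Y^{\alpha/2}}=\|z\|_{L^2(\mathbb{R}^n)}+\langle z,z\rangle_Q^{1/2}$. Orthogonality in $Y^{\alpha/2}$ refers to the inner product $(z_1,z_2)_{L^2(\mathbb{R}^n)}+\langle z_1,z_2\rangle_Q$. Let $U\subset\mathbb{R}^m$, $l_1,l_2>0$, $v_0\in Y^{\alpha/2}$, and $$\mathcal V=\{v\in Y^{\alpha/2}:\ \|v-v_0\|_{Y^{\alpha/2}}\le l_1,\ v\perp X_0^{\alpha/2}\},$$ $$\mathcal U=\{u\in L^\infty(\Omega,\mathbb{R}^m):\ u(x)\in U\text{ for a.e. }x\in\Omega,\ \|u\|_{L^\infty}\le l_2\}.$$ Let $G:\Omega\times\mathbb{R}\times\mathbb{R}^m\to\mathbb{R}$ have the partial derivative $G_z$ with respect to its second variable (for a.e. $x\in\Omega$), and assume: * (C1) $G$ and $G_z$ are Carathéodory functions: measurable in $x\in\Omega$ for all $(z,u)$, continuous in $(z,u)\in\mathbb{R}\times\mathbb{R}^m$ for a.e. $x\in\Omega$. * (C2) There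 is $s\in(2,2^*_\alpha)$ such that for every bounded $U_0\subset U$ there is $c>0$ with $|G(x,z,u)|\le c(1+|z|^s)$ and $|G_z(x,z,u)|\le c(1+|z|^{s-1})$ for a.e. $x\in\Omega$, all $z\in\mathbb{R}$, $u\in U_0$. * (C3) There are $p>2$, $a>0$, $R>0$ such that $a<pG(x,z,u)\le zG_z(x,z,u)$ for a.e. $x\in\Omega$, all $u\in U$ and $|z|\ge R$. * (C4) There are $\zeta>0$ and $0<b<\frac{c(n,\alpha)}{2}$ such that $\operatorname{ess\,sup}_\Omega|v_0|<\zeta$ and $\left|G(x,z,u)+\frac{c(n,\alpha)}{2}z^2\right|\le\frac b2|z-v_0(x)|^2$ for a.e. $x\in\Omega$, all $|z|\le\zeta$, $u\in U$. * (C5) For all $\bar u\in U$ and $\varepsilon>0$ there is $c>0$ such that $|G(x,z,u_1)-G(x,z,u_2)|\le c(1+|z|^2)|u_1-u_2|$ and $|G_z(x,z,u_1)-G_z(x,z,u_2)|\le c(1+|z|)|u_1-u_2|$ for a.e. $x\in\Omega$, all $z\in\mathbb{R}$ and all $u_1,u_2\in U$ with $|u_1-\bar u|<\varepsilon$, $|u_2-\bar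 u|<\varepsilon$. For $u\in\mathcal U$, $v\in\mathcal V$ define on $X_0^{\alpha/2}$ the shifted action functional $$\mathcal F_{u,v}(w)=c(n,\alpha)\left(\tfrac12\langle w,w\rangle_Q+\langle v,w\rangle_Q\right)-\int_\Omega G(x,w(x)+v(x),u(x))\,dx+\int_\Omega G(x,v(x),u(x))\,dx .$$ Let $v_k\in\mathcal V$ and $u_k\in\mathcal U$ for $k\ge0$ (in particular $v_0\in\mathcal V$), with $v_k\to v_0$ in $Y^{\alpha/2}$ and $u_k\to u_0$ in $L^\infty$. Write $\mathcal F_k=\mathcal F_{u_k,v_k}$. For $\omega_1\in X_0^{\alpha/2}$ and $k\ge 0$ put $$c_k=\inf_{g}\max_{t\in[0,1]}\mathcal F_k(g(t)),\qquad W_k=\{w\in X_0^{\alpha/2}:\ \mathcal F_k(w)=c_k,\ \mathcal F_k'(w)=0\},$$ the infimum being over all continuous $g:[0,1]\to X_0^{\alpha/2}$ with $g(0)=0$, $g(1)=\omega_1$. **Theorem.** There is $\omega_1\in X_0^{\alpha/2}$ with $\mathcal F_{u,v}(\omega_1)<0$ for all $u\in\mathcal U$, $v\in\mathcal V$. Moreover,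 for every $\omega_1\in X_0^{\alpha/2}$ with $\mathcal F_0(\omega_1)<0$: 1. for all sufficiently large $k$ the set $W_k$ is nonempty, and it contains neither $0$ nor any point $w$ with $\mathcal F_k(w)=0$; 2. every sequence $(w_k)$ with $w_k\in W_k$ for all sufficiently large $k$ is relatively compact in $X_0^{\alpha/2}$, and $\operatorname{Lim\,sup}W_k\subset W_0$, where the Painlevé–Kuratowski upper limit $\operatorname{Lim\,sup}W_k$ is the set of all cluster points in $X_0^{\alpha/2}$ of sequences $(s_k)$ with $s_k\in W_k$ for all sufficiently large $k$. -/

import Mathlib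

open MeasureTheory Filter Set
open scoped Topology ENNReal

noncomputable section

namespace FracLap

/-- `ℝⁿ` with the Euclidean norm. -/
abbrev E (n : ℕ) : Type := EuclideanSpace ℝ (Fin n)

/-- Near each of its boundary points, `Ω` is, in suitable orthogonal coordinates, the region above
the graph of a Lipschitz function: `e` is the vertical direction and `x - ⟪e, x⟫ e` is the
horizontal part of `x`. -/
def HasLipschitzBoundary {n : ℕ} (Ω : Set (E n)) : Prop :=
  ∀ x₀ ∈ frontier Ω, ∃ (e : E n) (r : ℝ) (K : NNReal) (γ : E n → ℝ),
    ‖e‖ = 1 ∧ 0 < r ∧ LipschitzWith K γ ∧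
      ∀ x ∈ Metric.ball x₀ r,
        (x ∈ Ω ↔ γ (x - (inner ℝ e x : ℝ) • e) < (inner ℝ e x : ℝ))

/-- Bounded domains (nonempty connected open sets) of `ℝⁿ` with a Lipschitz boundary. -/
structure BoundedLipschitzDomain (n : ℕ) where
  carrier : Set (E n)
  isOpen : IsOpen carrier
  isConnected : IsConnected carrier
  isBounded : Bornology.IsBounded carrier
  lipschitz : HasLipschitzBoundary carrier

variable {n m : ℕ}

/-- Lebesgue measure on `Ω`. -/
abbrev BoundedLipschitzDomain.vol (Ω : BoundedLipschitzDomain n) : Measure (E n) :=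
  volume.restrict Ω.carrier

/-- The set `Q = ℝ²ⁿ \ ((ℝⁿ \ Ω) × (ℝⁿ \ Ω))`. -/
def BoundedLipschitzDomain.Q (Ω : BoundedLipschitzDomain n) : Set (E n × E n) :=
  (Ω.carrierᶜ ×ˢ Ω.carrierᶜ)ᶜ

/-- The normalizing constant of the fractional Laplacian,
`c(n,α) = α Γ((n+α)/2) / (Γ(1-α/2) π^(n/2) 2^(2-α))`. -/
def normConst (n : ℕ) (α : ℝ) : ℝ :=
  α * Real.Gamma ((n + α) / 2) /
    (Real.Gamma (1 - α / 2) * Real.pi ^ ((n : ℝ) / 2) * (2 : ℝ) ^ (2 - α))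

/-- The difference quotient `(z(x) - z(y)) / |x - y|^((n+α)/2)`. -/
def diffQuot (α : ℝ) (z : E n → ℝ) (p : E n × E n) : ℝ :=
  (z p.1 - z p.2) / ‖p.1 - p.2‖ ^ (((n : ℝ) + α) / 2)

/-- Membership in `X^{α/2}`. -/
def MemX (Ω : BoundedLipschitzDomain n) (α : ℝ) (z : E n → ℝ) : Prop :=
  MemLp z 2 Ω.vol ∧ MemLp (diffQuot α z) 2 (volume.restrict Ω.Q)

/-- The form `∫_Q (z₁(x) - z₁(y)) (z₂(x) - z₂(y)) / |x - y|^(n+α) dx dy`. -/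
def gagliardoForm (Ω : BoundedLipschitzDomain n) (α : ℝ) (z₁ z₂ : E n → ℝ) : ℝ :=
  ∫ p in Ω.Q, (z₁ p.1 - z₁ p.2) * (z₂ p.1 - z₂ p.2) / ‖p.1 - p.2‖ ^ ((n : ℝ) + α)

theorem ae_fst_restrict {μ : Measure (E n × E n)} (hμ : μ ≤ volume) {P : E n → Prop}
    (h : ∀ᵐ x, P x) : ∀ᵐ p ∂μ, P p.1 :=
  (Measure.absolutelyContinuous_of_le hμ).ae_le
    ((Measure.quasiMeasurePreserving_fst (μ := (volume : Measure (E n)))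
      (ν := (volume : Measure (E n)))).ae h)

theorem ae_snd_restrict {μ : Measure (E n × E n)} (hμ : μ ≤ volume) {P : E n → Prop}
    (h : ∀ᵐ x, P x) : ∀ᵐ p ∂μ, P p.2 :=
  (Measure.absolutelyContinuous_of_le hμ).ae_le
    ((Measure.quasiMeasurePreserving_snd (μ := (volume : Measure (E n)))
      (ν := (volume : Measure (E n)))).ae h)

theorem diffQuot_congr (Ω : BoundedLipschitzDomain n) (α : ℝ) {z₁ z₂ : E n → ℝ}
    (h : z₁ =ᵐ[volume] z₂) : diffQuot α z₁ =ᵐ[volume.restrict Ω.Q] diffQuot α z₂ := by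
  filter_upwards [ae_fst_restrict Measure.restrict_le_self h,
    ae_snd_restrict Measure.restrict_le_self h] with p h1 h2
  simp only [diffQuot, h1, h2]

theorem diffQuot_add (α : ℝ) (z₁ z₂ : E n → ℝ) :
    diffQuot α (z₁ + z₂) = diffQuot α z₁ + diffQuot α z₂ := by
  ext p; simp only [diffQuot, Pi.add_apply]; ring

theorem diffQuot_smul (α c : ℝ) (z : E n → ℝ) :
    diffQuot α (c • z) = c • diffQuot α z := by
  ext p; simp only [diffQuot, Pi.smul_apply, smul_eq_mul]; ring

/-- `Y^{α/2} = X^{α/2} ∩ L²(ℝⁿ)` as a linear subspace of `L²(ℝⁿ)`. -/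
def ySubmodule (Ω : BoundedLipschitzDomain n) (α : ℝ) :
    Submodule ℝ (Lp ℝ 2 (volume : Measure (E n))) where
  carrier := {z | MemX Ω α z}
  zero_mem' := by
    refine ⟨(Lp.memLp _).restrict _, ?_⟩
    rw [memLp_congr_ae (diffQuot_congr Ω α (Lp.coeFn_zero ℝ 2 volume))]
    have : diffQuot α (0 : E n → ℝ) = 0 := by ext p; simp [diffQuot]
    rw [this]
    exact MemLp.zero
  add_mem' := by
    intro a b ha hb
    refine ⟨(Lp.memLp _).restrict _, ?_⟩
    rw [memLp_congr_ae (diffQuot_congr Ω α (Lp.coeFn_add a b)), diffQuot_add]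
    exact ha.2.add hb.2
  smul_mem' := by
    intro c a ha
    refine ⟨(Lp.memLp _).restrict _, ?_⟩
    rw [memLp_congr_ae (diffQuot_congr Ω α (Lp.coeFn_smul c a)), diffQuot_smul]
    exact ha.2.const_smul c

/-- The space `Y^{α/2}`; its norm is introduced below. -/
def Y (Ω : BoundedLipschitzDomain n) (α : ℝ) : Type := ↥(ySubmodule Ω α)

section Y

variable {Ω : BoundedLipschitzDomain n} {α : ℝ}

instance : AddCommGroup (Y Ω α) := inferInstanceAs (AddCommGroup ↥(ySubmodule Ω α))

instance : Module ℝ (Y Ω α) := inferInstanceAs (Module ℝ ↥(ySubmodule Ω α))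

/-- The inclusion `Y^{α/2} → L²(ℝⁿ)`. -/
def Y.toL2 : Y Ω α →ₗ[ℝ] Lp ℝ 2 (volume : Measure (E n)) := (ySubmodule Ω α).subtype

theorem Y.toL2_injective : Function.Injective (Y.toL2 : Y Ω α → _) := Subtype.val_injective

instance : CoeFun (Y Ω α) fun _ => E n → ℝ := ⟨fun z => (Y.toL2 z : E n → ℝ)⟩

theorem Y.memX (z : Y Ω α) : MemX Ω α z := Subtype.property (p := (· ∈ ySubmodule Ω α)) z

/-- The difference quotient as a linear map `Y^{α/2} → L²(Q)`. -/
def Y.quot : Y Ω α →ₗ[ℝ] Lp ℝ 2 (volume.restrict Ω.Q) where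
  toFun z := z.memX.2.toLp _
  map_add' a b := by
    rw [← MemLp.toLp_add, MemLp.toLp_eq_toLp_iff, ← diffQuot_add]
    exact diffQuot_congr Ω α (by rw [map_add]; exact Lp.coeFn_add _ _)
  map_smul' c a := by
    rw [RingHom.id_apply, ← MemLp.toLp_const_smul, MemLp.toLp_eq_toLp_iff, ← diffQuot_smul]
    exact diffQuot_congr Ω α (by rw [map_smul]; exact Lp.coeFn_smul _ _)

/-- `‖z‖_Y = ‖z‖_{L²(ℝⁿ)} + (∫_Q |z(x) - z(y)|² / |x - y|^(n+α) dx dy)^(1/2)`. -/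
instance : NormedAddCommGroup (Y Ω α) :=
  AddGroupNorm.toNormedAddCommGroup
    { toFun := fun z => ‖Y.toL2 z‖ + ‖Y.quot z‖
      map_zero' := by simp
      add_le' := fun a b => by
        rw [map_add, map_add]
        linarith [norm_add_le (Y.toL2 a) (Y.toL2 b), norm_add_le (Y.quot a) (Y.quot b)]
      neg' := fun a => by rw [map_neg, map_neg, norm_neg, norm_neg]
      eq_zero_of_map_eq_zero' := fun a h => by
        have h1 := norm_nonneg (Y.toL2 a)
        have h2 := norm_nonneg (Y.quot a)
        have h3 : Y.toL2 a = 0 := norm_eq_zero.1 (by linarith)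
        exact Y.toL2_injective (by rw [h3, map_zero]) }

theorem Y.norm_def (z : Y Ω α) : ‖z‖ = ‖Y.toL2 z‖ + ‖Y.quot z‖ := rfl

instance : NormedSpace ℝ (Y Ω α) where
  norm_smul_le c z := by
    rw [Y.norm_def, Y.norm_def, map_smul, map_smul, norm_smul, norm_smul, mul_add]

/-- The inner product of `Y^{α/2}`, which is the sum of the inner product of `L²(ℝⁿ)` and of the
form above; orthogonality in `Y^{α/2}` refers to it. (Its norm is equivalent to `‖·‖_Y`.) -/
def Y.form (z₁ z₂ : Y Ω α) : ℝ := (∫ x, z₁ x * z₂ x) + gagliardoForm Ω α z₁ z₂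

theorem diffQuot_mul_diffQuot (α : ℝ) (z₁ z₂ : E n → ℝ) (p : E n × E n) :
    diffQuot α z₁ p * diffQuot α z₂ p =
      (z₁ p.1 - z₁ p.2) * (z₂ p.1 - z₂ p.2) / ‖p.1 - p.2‖ ^ ((n : ℝ) + α) := by
  have h : ‖p.1 - p.2‖ ^ (((n : ℝ) + α) / 2) * ‖p.1 - p.2‖ ^ (((n : ℝ) + α) / 2) =
      ‖p.1 - p.2‖ ^ ((n : ℝ) + α) := by
    rw [← pow_two, ← Real.rpow_natCast, ← Real.rpow_mul (norm_nonneg _)]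
    congr 1
    push_cast
    ring
  rw [diffQuot, diffQuot, div_mul_div_comm, h]

theorem Y.inner_quot (z₁ z₂ : Y Ω α) :
    inner ℝ (Y.quot z₁) (Y.quot z₂) = gagliardoForm Ω α z₁ z₂ := by
  rw [L2.inner_def, gagliardoForm]
  refine integral_congr_ae ?_
  filter_upwards [z₁.memX.2.coeFn_toLp, z₂.memX.2.coeFn_toLp] with p h1 h2
  have h1' : (Y.quot z₁) p = diffQuot α z₁ p := h1
  have h2' : (Y.quot z₂) p = diffQuot α z₂ p := h2
  rw [h1', h2', ← diffQuot_mul_diffQuot, real_inner_eq_re_inner, RCLike.inner_apply]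
  simp [mul_comm]

theorem Y.norm_quot (z : Y Ω α) : ‖Y.quot z‖ = Real.sqrt (gagliardoForm Ω α z z) := by
  rw [← Y.inner_quot, real_inner_self_eq_norm_sq, Real.sqrt_sq (norm_nonneg _)]

end Y

/-- `X₀^{α/2}`, the functions of `X^{α/2}` that vanish a.e. outside `Ω`, as a linear subspace of
`Y^{α/2}` (such functions are automatically in `L²(ℝⁿ)`). -/
def x0Submodule (Ω : BoundedLipschitzDomain n) (α : ℝ) : Submodule ℝ (Y Ω α) where
  carrier := {z | ∀ᵐ x ∂(volume.restrict Ω.carrierᶜ), z x = 0}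
  zero_mem' := by
    have h : (Y.toL2 (0 : Y Ω α) : E n → ℝ) =ᵐ[volume] 0 := by
      rw [map_zero]; exact Lp.coeFn_zero ℝ 2 volume
    exact ae_restrict_of_ae h
  add_mem' := by
    intro a b ha hb
    have h : (Y.toL2 (a + b) : E n → ℝ) =ᵐ[volume] Y.toL2 a + Y.toL2 b := by
      rw [map_add]; exact Lp.coeFn_add _ _
    filter_upwards [ha, hb, ae_restrict_of_ae h] with x h1 h2 h3
    rw [h3, Pi.add_apply, h1, h2, add_zero]
  smul_mem' := by
    intro c a ha
    have h : (Y.toL2 (c • a) : E n → ℝ) =ᵐ[volume] c • Y.toL2 a := by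
      rw [map_smul]; exact Lp.coeFn_smul _ _
    filter_upwards [ha, ae_restrict_of_ae h] with x h1 h3
    rw [h3, Pi.smul_apply, h1, smul_zero]

/-- The space `X₀^{α/2}`; its norm is introduced below. -/
def X0 (Ω : BoundedLipschitzDomain n) (α : ℝ) : Type := ↥(x0Submodule Ω α)

section X0

variable {Ω : BoundedLipschitzDomain n} {α : ℝ}

instance : AddCommGroup (X0 Ω α) := inferInstanceAs (AddCommGroup ↥(x0Submodule Ω α))

instance : Module ℝ (X0 Ω α) := inferInstanceAs (Module ℝ ↥(x0Submodule Ω α))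

/-- The inclusion `X₀^{α/2} → Y^{α/2}`. -/
def X0.toY : X0 Ω α →ₗ[ℝ] Y Ω α := (x0Submodule Ω α).subtype

theorem X0.toY_injective : Function.Injective (X0.toY : X0 Ω α → _) := Subtype.val_injective

instance : CoeFun (X0 Ω α) fun _ => E n → ℝ := ⟨fun w => (X0.toY w : E n → ℝ)⟩

theorem X0.ae_eq_zero (w : X0 Ω α) : ∀ᵐ x ∂(volume.restrict Ω.carrierᶜ), w x = 0 :=
  Subtype.property (p := (· ∈ x0Submodule Ω α)) w

theorem restrict_compl_ne_zero [NeZero n] (Ω : BoundedLipschitzDomain n) :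
    (volume.restrict Ω.carrierᶜ : Measure (E n)) ≠ 0 := by
  intro h
  rw [Measure.restrict_eq_zero] at h
  have h1 : volume Ω.carrier < ⊤ := Ω.isBounded.measure_lt_top
  have h2 : (volume : Measure (E n)) univ ≤ volume Ω.carrier + volume Ω.carrierᶜ := by
    rw [← union_compl_self Ω.carrier]; exact measure_union_le _ _
  have : Nonempty (Fin n) := ⟨⟨0, Nat.pos_of_ne_zero (NeZero.ne n)⟩⟩
  have h3 : (volume : Measure (E n)) univ = ⊤ := measure_univ_of_isAddLeftInvariant _
  rw [h, add_zero, h3] at h2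
  exact absurd h1 (not_lt.2 h2)

theorem X0.quot_injective [NeZero n] :
    Function.Injective (Y.quot ∘ₗ (X0.toY : X0 Ω α →ₗ[ℝ] Y Ω α)) := by
  rw [← LinearMap.ker_eq_bot, LinearMap.ker_eq_bot']
  intro w hw
  have h0 : diffQuot α w =ᵐ[volume.restrict Ω.Q] 0 :=
    (X0.toY w).memX.2.coeFn_toLp.symm.trans (by
      have : (X0.toY w).memX.2.toLp _ = 0 := hw
      rw [this]; exact Lp.coeFn_zero _ _ _)
  have hsub : Ω.carrier ×ˢ Ω.carrierᶜ ⊆ Ω.Q := fun p hp hp' => hp'.1 hp.1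
  have h1 : ∀ᵐ p ∂((volume.restrict Ω.carrier).prod (volume.restrict Ω.carrierᶜ)),
      diffQuot α w p = 0 := by
    rw [Measure.prod_restrict]
    exact ae_mono (Measure.restrict_mono hsub le_rfl) h0
  have h2 := Measure.ae_ae_of_ae_prod h1
  have h3 : ∀ᵐ x ∂(volume.restrict Ω.carrier), w x = 0 := by
    filter_upwards [h2, ae_restrict_mem Ω.isOpen.measurableSet] with x hx hxΩ
    have : (ae (volume.restrict Ω.carrierᶜ : Measure (E n))).NeBot :=
      ae_neBot.2 (restrict_compl_ne_zero Ω)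
    obtain ⟨y, hy1, hy2, hy3⟩ := (hx.and (w.ae_eq_zero.and
      (ae_restrict_mem Ω.isOpen.measurableSet.compl))).exists
    have hne : x - y ≠ 0 := fun h => hy3 (sub_eq_zero.1 h ▸ hxΩ)
    have hpos : (0 : ℝ) < ‖x - y‖ ^ (((n : ℝ) + α) / 2) :=
      Real.rpow_pos_of_pos (norm_pos_iff.2 hne) _
    simp only [diffQuot] at hy1
    rw [div_eq_zero_iff, or_iff_left hpos.ne', hy2, sub_zero] at hy1
    exact hy1
  have h4 : (Y.toL2 (X0.toY w) : E n → ℝ) =ᵐ[volume] 0 := by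
    have := ae_restrict_union_iff Ω.carrier Ω.carrierᶜ (fun x => w x = 0) (μ := volume)
    rw [union_compl_self, Measure.restrict_univ] at this
    exact this.2 ⟨h3, w.ae_eq_zero⟩
  have h5 : Y.toL2 (X0.toY w) = 0 := (Lp.eq_zero_iff_ae_eq_zero).2 h4
  exact X0.toY_injective (Y.toL2_injective (by rw [h5, map_zero, map_zero]))

/-- `‖w‖_{X₀} = (∫_Q |w(x) - w(y)|² / |x - y|^(n+α) dx dy)^(1/2)`. -/
instance [NeZero n] : NormedAddCommGroup (X0 Ω α) :=
  NormedAddCommGroup.induced (X0 Ω α) (Lp ℝ 2 (volume.restrict Ω.Q))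
    (Y.quot ∘ₗ X0.toY) X0.quot_injective

theorem X0.norm_def [NeZero n] (w : X0 Ω α) : ‖w‖ = ‖Y.quot (X0.toY w)‖ := rfl

theorem X0.norm_eq [NeZero n] (w : X0 Ω α) : ‖w‖ = Real.sqrt (gagliardoForm Ω α w w) := by
  rw [X0.norm_def, Y.norm_quot]

instance [NeZero n] : InnerProductSpace ℝ (X0 Ω α) where
  norm_smul_le c w := by
    rw [X0.norm_def, X0.norm_def, map_smul, map_smul, norm_smul]
  inner w₁ w₂ := inner ℝ (Y.quot (X0.toY w₁)) (Y.quot (X0.toY w₂))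
  norm_sq_eq_re_inner w := by
    rw [X0.norm_def]; exact norm_sq_eq_re_inner (𝕜 := ℝ) _
  conj_inner_symm w₁ w₂ := inner_conj_symm _ _
  add_left a b c := by rw [map_add, map_add, inner_add_left]
  smul_left a b c := by rw [map_smul, map_smul, inner_smul_left]

theorem X0.inner_eq [NeZero n] (w₁ w₂ : X0 Ω α) :
    inner ℝ w₁ w₂ = gagliardoForm Ω α w₁ w₂ := Y.inner_quot _ _

end X0

/-! ## The nonlinearity

`G` is a function of `x`, `z` and `u`; only its values at `x ∈ Ω` matter. -/

/-- `Gz` is the partial derivative of `G` in `z`. -/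
def IsPartialDeriv (Ω : BoundedLipschitzDomain n) (G Gz : E n → ℝ → E m → ℝ) : Prop :=
  ∀ᵐ x ∂Ω.vol, ∀ (z : ℝ) (u : E m), HasDerivAt (fun t => G x t u) (Gz x z u) z

/-- Carathéodory functions on `Ω × (ℝ × ℝᵐ)`. -/
def IsCaratheodory (Ω : BoundedLipschitzDomain n) (g : E n → ℝ → E m → ℝ) : Prop :=
  (∀ (z : ℝ) (u : E m), AEMeasurable (fun x => g x z u) Ω.vol) ∧
    ∀ᵐ x ∂Ω.vol, Continuous fun q : ℝ × E m => g x q.1 q.2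

/-- Subcritical growth of `G` and `Gz`, uniformly for `u` in bounded subsets of `U`. -/
def SubcriticalGrowth (Ω : BoundedLipschitzDomain n) (α : ℝ) (U : Set (E m))
    (G Gz : E n → ℝ → E m → ℝ) : Prop :=
  ∃ s : ℝ, 2 < s ∧ s < 2 * n / (n - α) ∧
    ∀ U₀ ⊆ U, Bornology.IsBounded U₀ → ∃ c : ℝ, 0 < c ∧
      ∀ᵐ x ∂Ω.vol, ∀ z : ℝ, ∀ u ∈ U₀,
        |G x z u| ≤ c * (1 + |z| ^ s) ∧ |Gz x z u| ≤ c * (1 + |z| ^ (s - 1))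

/-- Superlinearity: `a < p G ≤ z Gz` for large `|z|`. -/
def Superlinear (Ω : BoundedLipschitzDomain n) (U : Set (E m))
    (G Gz : E n → ℝ → E m → ℝ) : Prop :=
  ∃ p a R : ℝ, 2 < p ∧ 0 < a ∧ 0 < R ∧
    ∀ᵐ x ∂Ω.vol, ∀ u ∈ U, ∀ z : ℝ, R ≤ |z| →
      a < p * G x z u ∧ p * G x z u ≤ z * Gz x z u

/-- Behaviour of `G` near the limit boundary datum `v₀`, together with the bound
`ess sup_Ω |v₀| < ζ`. -/
def NearDatum (Ω : BoundedLipschitzDomain n) (α : ℝ) (U : Set (E m))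
    (G : E n → ℝ → E m → ℝ) (v₀ : E n → ℝ) : Prop :=
  ∃ ζ b : ℝ, 0 < ζ ∧ 0 < b ∧ b < normConst n α / 2 ∧
    essSup (fun x => ENNReal.ofReal |v₀ x|) Ω.vol < ENNReal.ofReal ζ ∧
    ∀ᵐ x ∂Ω.vol, ∀ z : ℝ, |z| ≤ ζ → ∀ u ∈ U,
      |G x z u + normConst n α / 2 * z ^ 2| ≤ b / 2 * |z - v₀ x| ^ 2

/-- Lipschitz dependence on `u`, locally in `u`. -/
def LipschitzInParameter (Ω : BoundedLipschitzDomain n) (U : Set (E m))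
    (G Gz : E n → ℝ → E m → ℝ) : Prop :=
  ∀ u₀ ∈ U, ∀ ε : ℝ, 0 < ε → ∃ c : ℝ, 0 < c ∧
    ∀ᵐ x ∂Ω.vol, ∀ z : ℝ, ∀ u₁ ∈ U, ∀ u₂ ∈ U, ‖u₁ - u₀‖ < ε → ‖u₂ - u₀‖ < ε →
      |G x z u₁ - G x z u₂| ≤ c * (1 + |z| ^ 2) * ‖u₁ - u₂‖ ∧
      |Gz x z u₁ - Gz x z u₂| ≤ c * (1 + |z|) * ‖u₁ - u₂‖

/-! ## Data, functionals, mountain pass critical points -/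

/-- The boundary data: the `v ∈ Y^{α/2}` with `‖v - v₀‖_Y ≤ l₁` that are orthogonal to `X₀^{α/2}`
in `Y^{α/2}`. -/
def boundaryData (Ω : BoundedLipschitzDomain n) (α : ℝ) (v₀ : Y Ω α) (l₁ : ℝ) : Set (Y Ω α) :=
  {v | ‖v - v₀‖ ≤ l₁ ∧ ∀ w : X0 Ω α, Y.form v (X0.toY w) = 0}

/-- The parameters: the `u ∈ L^∞(Ω, ℝᵐ)` with values in `U` and `‖u‖_{L^∞} ≤ l₂`. -/
def parameters (Ω : BoundedLipschitzDomain n) (U : Set (E m)) (l₂ : ℝ) :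
    Set (Lp (E m) ∞ Ω.vol) :=
  {u | (∀ᵐ x ∂Ω.vol, u x ∈ U) ∧ ‖u‖ ≤ l₂}

/-- The shifted functional of action on `X₀^{α/2}` for the parameter `u` and the datum `v`. -/
def shiftedAction (Ω : BoundedLipschitzDomain n) (α : ℝ) (G : E n → ℝ → E m → ℝ)
    (u : Lp (E m) ∞ Ω.vol) (v : Y Ω α) (w : X0 Ω α) : ℝ :=
  normConst n α *
      ((∫ p in Ω.Q, |w p.1 - w p.2| ^ 2 / (2 * ‖p.1 - p.2‖ ^ ((n : ℝ) + α))) +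
        ∫ p in Ω.Q, (v p.1 - v p.2) * (w p.1 - w p.2) / ‖p.1 - p.2‖ ^ ((n : ℝ) + α))
    - (∫ x in Ω.carrier, G x (w x + v x) (u x)) + ∫ x in Ω.carrier, G x (v x) (u x)

/-- `inf_g max_t F(g(t))` over the continuous paths `g : [0,1] → X` from `ω₀` to `ω₁`. -/
def mountainPassLevel {X : Type*} [TopologicalSpace X] (F : X → ℝ) (ω₀ ω₁ : X) : ℝ :=
  ⨅ g : Path ω₀ ω₁, ⨆ t : unitInterval, F (g t)

/-- The critical points of `F` whose value is the mountain pass level. -/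
def mountainPassSet {X : Type*} [NormedAddCommGroup X] [NormedSpace ℝ X]
    (F : X → ℝ) (ω₀ ω₁ : X) : Set X :=
  {w | F w = mountainPassLevel F ω₀ ω₁ ∧ HasFDerivAt F (0 : X →L[ℝ] ℝ) w}

/-- The Painlevé–Kuratowski upper limit of a sequence of (eventually nonempty) sets: the cluster
points of the sequences `s` with `s k ∈ S k` for all large `k`. -/
def upperLimit {X : Type*} [TopologicalSpace X] (S : ℕ → Set X) : Set X :=
  {x | ∃ s : ℕ → X, (∀ᶠ k in atTop, s k ∈ S k) ∧ MapClusterPt x atTop s}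

end FracLap

end

/-! Write κ for `normConst n α`. Each functional is a quadratic form plus a linear term minus a
superlinear, subcritical potential, so critical points come from the mountain pass theorem of
Ambrosetti and Rabinowitz. Stability in k requires the same estimates uniformly in the data.

Mountain range. Condition (C4) at z = v₀(x) forces G(x, v₀, u) = -κ v₀²/2, and near v₀ it bounds the
potential difference below by κ w v₀, up to C|w|^s. The integral of κ w v₀ cancels against the
linear term κ⟨v₀, w⟩_Q, because v₀ is orthogonal to X₀ in the inner product of Y. What remains is
F₀(w) ≥ κ‖w‖²/2 - C‖w‖^s (`exists_lower_bound_action`), hence a sphere on which F₀ is bounded below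
by a positive number. Since (C4) speaks of v₀ only, F_k inherits this for large k, from the uniform
convergence F_k → F₀ on bounded sets.

Dilation. The central estimate is `exists_action_dilation_le`: for some q > 2 and all w,
F_{u',v'}((1+δ)w) ≤ (1+qδ) F_{u,v}(w) - κ'δ‖w‖² + Cδ, as soon as the two data differ by O(δ). It is
an integrated form of the Ambrosetti-Rabinowitz condition (C3): with q strictly between 2 and p, the
potential loses nothing under the dilation beyond O(δ), while the quadratic part gains a multiple of
δ‖w‖² that absorbs the change of data. With equal data and δ → 0 it bounds Palais-Smale sequences.
With the data k and 0 it compares levels: a fixed path gives limsup c_k ≤ c₀, but almost optimal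
paths of F_k need not stay in a common bounded set, and it is the dilated path that yields c₀ ≤
liminf c_k (`MountainPassFamily.eventually_le_level`).

Compactness. Functions of Y restrict to L^s(Ω) for every subcritical s (`sobolev`, by a bootstrap on
the exponent that uses only the measure density of Ω), and on X₀ the restriction is compact
(`X0.tendsto_restrict`, by averaging over small balls). Hence bounded almost critical sequences
converge along subsequences, also when the data vary with the index
(`SuperlinearFamily.exists_convergent_subseq`).

Conclusion. Almost critical points at the level c_k come from Ekeland's principle on the space of
paths (`exists_almost_critical`). Points of W_k are bounded, hence relatively compact, and their
cluster points are critical for F₀ with value lim c_k = c₀. The abstract argument is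
`MountainPassFamily`; its hypotheses are supplied by `SuperlinearFamily.exists_mountainPassFamily`.
-/

theorem tendsto_clm_apply {ι V W : Type*} [NormedAddCommGroup V] [NormedSpace ℝ V]
    [NormedAddCommGroup W] [NormedSpace ℝ W] {l : Filter ι} {L : ι → V →L[ℝ] W} {L₀ : V →L[ℝ] W}
    {x : ι → V} {x₀ : V} (hL : Tendsto L l (𝓝 L₀)) (hx : Tendsto x l (𝓝 x₀)) :
    Tendsto (fun i => L i (x i)) l (𝓝 (L₀ x₀)) :=
  (isBoundedBilinearMap_apply.continuous.tendsto (L₀, x₀)).comp (hL.prodMk_nhds hx)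

/-! ### Ekeland's variational principle -/

/-- The sets `S x` are closed, and they decrease along a sequence in which each next point minimizes
`f` on the current set up to `(1/2)^k`. This forces their diameters to zero, so the sequence
converges to a point `y` of all of them. A point of `S y` lies in all of them too and is therefore
`y` itself, which is the claimed inequality. -/
theorem exists_almost_minimizer_dist {X : Type*} [MetricSpace X] [CompleteSpace X]
    (f : X → ℝ) (hf : LowerSemicontinuous f) (hb : BddBelow (range f)) {ε : ℝ} (hε : 0 < ε)
    (x₀ : X) : ∃ y, f y ≤ f x₀ ∧ ∀ z, f y ≤ f z + ε * dist y z := by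
  let S : X → Set X := fun x => {z | f z + ε * dist x z ≤ f x}
  have hSself : ∀ x, x ∈ S x := fun x => by simp [S]
  have hStrans : ∀ x, ∀ z ∈ S x, S z ⊆ S x := by
    intro x z hz y hy
    simp only [S, mem_ofPred_eq] at *
    nlinarith [dist_triangle x z y]
  have hSclosed : ∀ x, IsClosed (S x) := by
    intro x
    have h : LowerSemicontinuous fun z => f z + ε * dist x z :=
      hf.add (Continuous.lowerSemicontinuous (by fun_prop))
    exact h.isClosed_preimage (f x)
  have hbS : ∀ x, BddBelow (f '' S x) := fun x => hb.mono (image_subset_range _ _)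
  have hstep : ∀ (x : X) (k : ℕ), ∃ y ∈ S x, ∀ z ∈ S x, f y ≤ f z + (1 / 2 : ℝ) ^ k := by
    intro x k
    have hpos : (0 : ℝ) < (1 / 2) ^ k := by positivity
    obtain ⟨_, ⟨y, hy, rfl⟩, hlt⟩ := exists_lt_of_csInf_lt (s := f '' S x)
      ⟨f x, x, hSself x, rfl⟩ (lt_add_of_pos_right (sInf (f '' S x)) hpos)
    exact ⟨y, hy, fun z hz => hlt.le.trans
      (add_le_add_left (csInf_le (hbS x) ⟨z, hz, rfl⟩) _)⟩
  choose next hnext₁ hnext₂ using hstep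
  let x : ℕ → X := fun k => Nat.rec x₀ (fun k y => next y k) k
  have hx : ∀ k, x (k + 1) = next (x k) k := fun k => rfl
  have hmem : ∀ k, x (k + 1) ∈ S (x k) := fun k => hx k ▸ hnext₁ _ _
  have hmono : ∀ k j, k ≤ j → S (x j) ⊆ S (x k) := by
    intro k j hkj
    induction j, hkj using Nat.le_induction with
    | base => exact le_rfl
    | succ j _ ih => exact (hStrans _ _ (hmem j)).trans ih
  have hdist : ∀ k, ∀ z ∈ S (x (k + 1)), ε * dist (x (k + 1)) z ≤ (1 / 2 : ℝ) ^ k := by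
    intro k z hz
    have h1 := hnext₂ (x k) k z (hmono k (k + 1) k.le_succ hz)
    rw [← hx] at h1
    simp only [S, mem_ofPred_eq] at hz
    linarith
  have hlim0 : Tendsto (fun k : ℕ => (1 / 2 : ℝ) ^ k / ε) atTop (𝓝 0) := by
    simpa using (tendsto_pow_atTop_nhds_zero_of_lt_one (by norm_num : (0 : ℝ) ≤ 1 / 2)
      (by norm_num)).div_const ε
  have hdist' : ∀ k, ∀ z ∈ S (x (k + 1)), dist (x (k + 1)) z ≤ (1 / 2 : ℝ) ^ k / ε := by
    intro k z hz
    rw [le_div_iff₀ hε, mul_comm]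
    exact hdist k z hz
  have hcauchy : CauchySeq fun k => x (k + 1) :=
    cauchySeq_of_le_tendsto_0' (fun k => (1 / 2 : ℝ) ^ k / ε)
      (fun k j hkj => hdist' k _ (hmono (k + 1) (j + 1) (by omega) (hSself _))) hlim0
  obtain ⟨y, hy⟩ := cauchySeq_tendsto_of_complete hcauchy
  have hyS : ∀ k, y ∈ S (x k) := fun k =>
    (hSclosed (x k)).mem_of_tendsto hy (by
      filter_upwards [eventually_ge_atTop k] with j hj
      exact hmono k (j + 1) (by omega) (hSself _))
  refine ⟨y, ?_, fun z => ?_⟩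
  · have := hyS 0
    simp only [S, mem_ofPred_eq] at this
    have h0 : x 0 = x₀ := rfl
    rw [h0] at this
    nlinarith [dist_nonneg (x := x₀) (y := y)]
  · by_contra! hlt
    have hz : z ∈ S y := hlt.le
    have hlz : Tendsto (fun k => x (k + 1)) atTop (𝓝 z) := by
      rw [tendsto_iff_dist_tendsto_zero]
      exact squeeze_zero (fun _ => dist_nonneg)
        (fun k => hdist' k z (hStrans _ _ (hyS (k + 1)) hz)) hlim0
    rw [tendsto_nhds_unique hlz hy, dist_self] at hlt
    linarith

/-! ### The mountain pass theorem -/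

section MountainPass

variable {H : Type*} [NormedAddCommGroup H]

theorem bddAbove_range_comp_unitInterval {F : H → ℝ} (hF : Continuous F)
    {g : unitInterval → H} (hg : Continuous g) : BddAbove (range fun t => F (g t)) :=
  (isCompact_range (hF.comp hg)).bddAbove

theorem bddBelow_range_mountainPass {F : H → ℝ} (hF : Continuous F) (a b : H) :
    BddBelow (range fun g : Path a b => ⨆ t : unitInterval, F (g t)) := by
  refine ⟨F a, ?_⟩
  rintro _ ⟨g, rfl⟩
  have := le_ciSup (bddAbove_range_comp_unitInterval hF g.continuous) 0
  simpa using this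

theorem mountainPassLevel_le {F : H → ℝ} (hF : Continuous F) {a b : H} (g : Path a b) {M : ℝ}
    (hM : ∀ t, F (g t) ≤ M) : FracLap.mountainPassLevel F a b ≤ M :=
  (ciInf_le (bddBelow_range_mountainPass hF a b) g).trans (ciSup_le hM)

variable [InnerProductSpace ℝ H]

theorem exists_path_lt_of_mountainPassLevel_lt {F : H → ℝ} (hF : Continuous F) {a b : H} {M : ℝ}
    (h : FracLap.mountainPassLevel F a b < M) : ∃ g : Path a b, ∀ t, F (g t) < M := by
  have : Nonempty (Path a b) := ⟨(PathConnectedSpace.somePath a b)⟩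
  obtain ⟨g, hg⟩ := exists_lt_of_ciInf_lt h
  exact ⟨g, fun t => (le_ciSup (bddAbove_range_comp_unitInterval hF g.continuous) t).trans_lt hg⟩

variable [CompleteSpace H]

/-- Ekeland's principle applied to the maximum of `F` along a path gives a path that cannot be
lowered at a rate better than `ε`. If the gradient exceeded `2 * ε` at every maximum point of this
path, pushing the path down along the normalized gradient would lower it faster. No descent flow is
needed, so continuity of `dF` suffices. -/
theorem exists_almost_critical {F : H → ℝ} {dF : H → H →L[ℝ] ℝ}
    (hF : ∀ w, HasFDerivAt F (dF w) w) (hdF : Continuous dF) {a b : H}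
    (ha : F a < FracLap.mountainPassLevel F a b) (hb : F b < FracLap.mountainPassLevel F a b)
    {ε : ℝ} (hε : 0 < ε) :
    ∃ w, |F w - FracLap.mountainPassLevel F a b| ≤ ε ∧ ‖dF w‖ ≤ 2 * ε := by
  set c := FracLap.mountainPassLevel F a b with hc
  have hFc : Continuous F := continuous_iff_continuousAt.2 fun w => (hF w).continuousAt
  let P := {g : C(unitInterval, H) // g 0 = a ∧ g 1 = b}
  have hclosed : IsClosed {g : C(unitInterval, H) | g 0 = a ∧ g 1 = b} :=
    (isClosed_eq (continuous_eval_const 0) continuous_const).inter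
      (isClosed_eq (continuous_eval_const 1) continuous_const)
  have : CompleteSpace P := hclosed.completeSpace_coe
  let toPath : P → Path a b := fun g => ⟨g.1, g.2.1, g.2.2⟩
  let Ψ : P → ℝ := fun g => ⨆ t, F (g.1 t)
  have hbdd : ∀ g : C(unitInterval, H), BddAbove (range fun t => F (g t)) :=
    fun g => bddAbove_range_comp_unitInterval hFc g.continuous
  have hcΨ : ∀ g, c ≤ Ψ g := fun g => ciInf_le (bddBelow_range_mountainPass hFc a b) (toPath g)
  have hlsc : LowerSemicontinuous Ψ :=
    lowerSemicontinuous_ciSup (fun g => hbdd g.1) fun t =>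
      (hFc.comp ((continuous_eval_const t).comp
        continuous_subtype_val)).lowerSemicontinuous
  obtain ⟨p₀, hp₀⟩ := exists_path_lt_of_mountainPassLevel_lt hFc
    (lt_add_of_pos_right c hε)
  obtain ⟨g, hg₁, hg₂⟩ := exists_almost_minimizer_dist Ψ hlsc
    ⟨c, by rintro _ ⟨g, rfl⟩; exact hcΨ g⟩ hε ⟨p₀.toContinuousMap, p₀.source, p₀.target⟩
  have hgε : Ψ g ≤ c + ε := hg₁.trans (ciSup_le fun t => (hp₀ t).le)
  by_contra! hcon
  obtain ⟨γ, hγ⟩ : ∃ γ : C(unitInterval, H), γ = g.1 := ⟨_, rfl⟩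
  have hγ0 : γ 0 = a := hγ ▸ g.2.1
  have hγ1 : γ 1 = b := hγ ▸ g.2.2
  have hgrad : ∀ t, F (γ t) = Ψ g → 2 * ε < ‖dF (γ t)‖ := by
    intro t ht
    refine hcon _ ?_
    rw [ht, abs_of_nonneg (by linarith [hcΨ g])]
    linarith
  have hleΨ : ∀ t, F (γ t) ≤ Ψ g := fun t => by
    rw [hγ]; exact le_ciSup (hbdd g.1) t
  -- the field of descent directions along `g`
  let grad : H → H := fun w => (InnerProductSpace.toDual ℝ H).symm (dF w)
  have hgradc : Continuous grad := (LinearIsometryEquiv.continuous _).comp hdF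
  have hgradn : ∀ w, ‖grad w‖ = ‖dF w‖ := fun w => LinearIsometryEquiv.norm_map _ _
  have hgraddF : ∀ w, dF w (grad w) = ‖grad w‖ ^ 2 := by
    intro w
    rw [← real_inner_self_eq_norm_sq]
    exact InnerProductSpace.toDual_symm_apply.symm
  set m := max (F a) (F b) with hm
  have hmΨ : m < Ψ g := (max_lt ha hb).trans_le (hcΨ g)
  -- A cut-off equal to one at the maximum points of `F` along the path and to zero where `F ≤ m`,
  -- so the deformation keeps both endpoints fixed.
  let φ : unitInterval → ℝ := fun t => max 0 ((F (γ t) - m) / (Ψ g - m))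
  have hφc : Continuous φ := by
    have : Continuous fun t => F (γ t) := hFc.comp γ.continuous
    fun_prop
  have hφ0 : ∀ t, 0 ≤ φ t := fun t => le_max_left _ _
  have hφ1 : ∀ t, φ t ≤ 1 := by
    intro t
    refine max_le zero_le_one ?_
    rw [div_le_one (by linarith)]
    linarith [hleΨ t]
  have hmax : ∀ w, 0 < max ‖grad w‖ ε := fun w => lt_max_of_lt_right hε
  -- Dividing by `max ‖grad‖ ε` instead of `‖grad‖` keeps the field continuous at zeros of the
  -- gradient and of norm at most one; where the gradient is larger than `ε` and `φ = 1` it is a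
  -- unit vector.
  let ξ : C(unitInterval, H) :=
    ⟨fun t => -(φ t / max ‖grad (γ t)‖ ε) • grad (γ t), by
      have h1 : Continuous fun t => grad (γ t) := hgradc.comp γ.continuous
      exact ((hφc.div (by fun_prop) fun t => (hmax _).ne').neg).smul h1⟩
  have hξ : ∀ t, ξ t = -(φ t / max ‖grad (γ t)‖ ε) • grad (γ t) := fun t => rfl
  have hξn : ∀ t, ‖ξ t‖ ≤ 1 := by
    intro t
    rw [hξ, norm_smul, norm_neg, Real.norm_eq_abs, abs_of_nonneg (div_nonneg (hφ0 t) (hmax _).le),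
      div_mul_eq_mul_div, div_le_one (hmax _)]
    calc φ t * ‖grad (γ t)‖ ≤ 1 * ‖grad (γ t)‖ := by gcongr; exact hφ1 t
      _ ≤ _ := by rw [one_mul]; exact le_max_left _ _
  have hφend : ∀ t, F (γ t) ≤ m → ξ t = 0 := by
    intro t ht
    have : φ t = 0 := max_eq_left (div_nonpos_of_nonpos_of_nonneg (by linarith) (by linarith))
    rw [hξ, this]; simp
  let lam : ℕ → ℝ := fun k => 1 / ((k : ℝ) + 1)
  have hlam : ∀ k, 0 < lam k := fun k => by positivity
  have hlam0 : Tendsto lam atTop (𝓝 0) := tendsto_one_div_add_atTop_nhds_zero_nat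
  -- The perturbed path lies within `lam k` of the original one, so its maximum is at least `Ψ g - ε
  -- * lam k`. At a maximum point the mean value theorem turns this bound into one on the derivative
  -- along `ξ`.
  have hpert : ∀ k, ∃ t, ∃ r ∈ Ioo (0 : ℝ) (lam k),
      Ψ g - ε * lam k ≤ F (γ t + lam k • ξ t) ∧ -ε ≤ dF (γ t + r • ξ t) (ξ t) := by
    intro k
    let h : P := ⟨γ + lam k • ξ, by
      constructor
      · have := hφend 0 (by rw [hγ0]; exact le_max_left _ _)
        simp [hγ0, this]
      · have := hφend 1 (by rw [hγ1]; exact le_max_right _ _)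
        simp [hγ1, this]⟩
    have hdist : dist g h ≤ lam k := by
      rw [Subtype.dist_eq, ← hγ, ContinuousMap.dist_le (hlam k).le]
      intro t
      simp only [h, ContinuousMap.add_apply, ContinuousMap.smul_apply, dist_self_add_right,
        norm_smul, Real.norm_eq_abs, abs_of_pos (hlam k)]
      nlinarith [hξn t, hlam k]
    obtain ⟨t, -, ht⟩ := isCompact_univ.exists_isMaxOn (univ_nonempty (α := unitInterval))
      (hFc.comp h.1.continuous).continuousOn
    have htΨ : Ψ h ≤ F (h.1 t) := ciSup_le fun t' => ht (mem_univ t')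
    have h1 : Ψ g - ε * lam k ≤ F (γ t + lam k • ξ t) := by
      have := hg₂ h
      have h2 : F (h.1 t) = F (γ t + lam k • ξ t) := rfl
      nlinarith
    have hder : ∀ r : ℝ, HasDerivAt (fun r : ℝ => F (γ t + r • ξ t))
        (dF (γ t + r • ξ t) (ξ t)) r := by
      intro r
      have h3 : HasDerivAt (fun r : ℝ => γ t + r • ξ t) (ξ t) r := by
        simpa using ((hasDerivAt_id r).smul_const (ξ t)).const_add (γ t)
      exact (hF _).comp_hasDerivAt r h3
    obtain ⟨r, hr, hr'⟩ := exists_hasDerivAt_eq_slope (fun r : ℝ => F (γ t + r • ξ t))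
      (fun r => dF (γ t + r • ξ t) (ξ t)) (hlam k)
      (fun r _ => (hder r).continuousAt.continuousWithinAt) (fun r _ => hder r)
    refine ⟨t, r, hr, h1, ?_⟩
    rw [hr', le_div_iff₀ (by linarith [hlam k])]
    simp only [zero_smul, add_zero, sub_zero]
    linarith [hleΨ t]
  choose t r hr ht₁ ht₂ using hpert
  -- A limit of the maximum points of the perturbed paths is a maximum point of the original path,
  -- and there the derivative along `ξ` is at once at least `-ε` and equal to minus the norm of the
  -- gradient.
  obtain ⟨t', -, ψ, hψ, htlim⟩ := isCompact_univ.tendsto_subseq (fun k => mem_univ (t k))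
  have hlamψ : Tendsto (fun k => lam (ψ k)) atTop (𝓝 0) := hlam0.comp hψ.tendsto_atTop
  have hrψ : Tendsto (fun k => r (ψ k)) atTop (𝓝 0) :=
    squeeze_zero (fun k => (hr _).1.le) (fun k => (hr _).2.le) hlamψ
  have hgt : Tendsto (fun k => γ (t (ψ k))) atTop (𝓝 (γ t')) :=
    (γ.continuous.tendsto t').comp htlim
  have hξt : Tendsto (fun k => ξ (t (ψ k))) atTop (𝓝 (ξ t')) :=
    (ξ.continuous.tendsto t').comp htlim
  have hy : ∀ {ρ : ℕ → ℝ}, Tendsto ρ atTop (𝓝 0) →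
      Tendsto (fun k => γ (t (ψ k)) + ρ k • ξ (t (ψ k))) atTop (𝓝 (γ t')) := by
    intro ρ hρ
    simpa using hgt.add (hρ.smul hξt)
  have hmaxt : F (γ t') = Ψ g := by
    refine le_antisymm (hleΨ t') ?_
    have h1 : Tendsto (fun k => Ψ g - ε * lam (ψ k)) atTop (𝓝 (Ψ g)) := by
      simpa using tendsto_const_nhds.sub (hlamψ.const_mul ε)
    exact le_of_tendsto_of_tendsto' h1 ((hFc.tendsto _).comp (hy hlamψ)) fun k => ht₁ _
  have hlow : -ε ≤ dF (γ t') (ξ t') := by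
    have h1 : Tendsto (fun k => dF (γ (t (ψ k)) + r (ψ k) • ξ (t (ψ k))) (ξ (t (ψ k)))) atTop
        (𝓝 (dF (γ t') (ξ t'))) := tendsto_clm_apply ((hdF.tendsto _).comp (hy hrψ)) hξt
    exact ge_of_tendsto' h1 fun k => ht₂ _
  have h2 := hgrad t' hmaxt
  have hφt : φ t' = 1 := by
    simp only [φ, hmaxt]
    rw [div_self (by linarith)]
    exact max_eq_right zero_le_one
  rw [← hgradn] at h2
  rw [hξ, hφt, map_smul, hgraddF, smul_eq_mul, max_eq_left (by linarith)] at hlow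
  have h3 : -(1 / ‖grad (γ t')‖) * ‖grad (γ t')‖ ^ 2 = -‖grad (γ t')‖ := by
    have : ‖grad (γ t')‖ ≠ 0 := by linarith
    field_simp
  linarith

theorem mountainPassSet_nonempty {F : H → ℝ} {dF : H → H →L[ℝ] ℝ}
    (hF : ∀ w, HasFDerivAt F (dF w) w) (hdF : Continuous dF) {a b : H}
    (ha : F a < FracLap.mountainPassLevel F a b) (hb : F b < FracLap.mountainPassLevel F a b)
    (ps : ∀ w : ℕ → H,
      Tendsto (fun j => F (w j)) atTop (𝓝 (FracLap.mountainPassLevel F a b)) →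
      Tendsto (fun j => dF (w j)) atTop (𝓝 0) →
      ∃ (x : H) (φ : ℕ → ℕ), StrictMono φ ∧ Tendsto (w ∘ φ) atTop (𝓝 x)) :
    (FracLap.mountainPassSet F a b).Nonempty := by
  have hlam : ∀ k : ℕ, (0 : ℝ) < 1 / ((k : ℝ) + 1) := fun k => by positivity
  have hlam0 : Tendsto (fun k : ℕ => 1 / ((k : ℝ) + 1)) atTop (𝓝 0) :=
    tendsto_one_div_add_atTop_nhds_zero_nat
  choose w hw₁ hw₂ using fun k : ℕ => exists_almost_critical hF hdF ha hb (hlam k)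
  have h1 : Tendsto (fun j => F (w j)) atTop (𝓝 (FracLap.mountainPassLevel F a b)) := by
    rw [tendsto_iff_dist_tendsto_zero]
    exact squeeze_zero (fun _ => dist_nonneg) hw₁ hlam0
  have h2 : Tendsto (fun j => dF (w j)) atTop (𝓝 0) := by
    rw [tendsto_zero_iff_norm_tendsto_zero]
    exact squeeze_zero (fun _ => norm_nonneg _) hw₂ (by simpa using hlam0.const_mul 2)
  obtain ⟨x, φ, hφ, hx⟩ := ps w h1 h2
  have e1 : F x = FracLap.mountainPassLevel F a b :=
    tendsto_nhds_unique (((hF x).continuousAt.tendsto).comp hx) (h1.comp hφ.tendsto_atTop)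
  have e2 : dF x = 0 := tendsto_nhds_unique ((hdF.tendsto x).comp hx) (h2.comp hφ.tendsto_atTop)
  exact ⟨x, e1, e2 ▸ hF x⟩

end MountainPass

/-! ### Interior balls and measure density of Lipschitz domains -/

namespace FracLap

variable {n m : ℕ}

/-- Moving from `x` by `t / 2` in the vertical direction gains that much height above the graph. A
further displacement `h` costs at most `‖h‖` in height and raises the graph by at most `2 * K *
‖h‖`, so `(1 + 2 * K) * ‖h‖ < t / 2` is enough. -/
theorem interior_ball_of_lipschitz_graph {Ω : Set (E n)} {x₀ e : E n} {r : ℝ} {K : NNReal}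
    {γ : E n → ℝ} (he : ‖e‖ = 1) (hγ : LipschitzWith K γ)
    (hΩ : ∀ x ∈ Metric.ball x₀ r,
      (x ∈ Ω ↔ γ (x - (inner ℝ e x : ℝ) • e) < (inner ℝ e x : ℝ)))
    {x : E n} (hx : x ∈ Ω) (hx₀ : x ∈ Metric.ball x₀ (r / 2)) {t : ℝ} (ht : 0 < t)
    (htr : t ≤ r / 2) :
    Metric.ball (x + (t / 2) • e) (1 / (2 * (1 + 2 * K)) * t) ⊆ Ω ∩ Metric.ball x t := by
  intro z hz
  have hK : (0 : ℝ) ≤ K := K.2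
  obtain ⟨h, rfl⟩ : ∃ h, z = x + (t / 2) • e + h := ⟨z - (x + (t / 2) • e), by abel⟩
  have hh : (1 + 2 * K) * ‖h‖ < t / 2 := by
    rw [mem_ball_iff_norm, add_sub_cancel_left, div_mul_eq_mul_div, one_mul,
      lt_div_iff₀ (by positivity)] at hz
    linarith
  have hKh : 0 ≤ K * ‖h‖ := by positivity
  have hball : x + (t / 2) • e + h ∈ Metric.ball x t := by
    rw [mem_ball_iff_norm, add_assoc, add_sub_cancel_left]
    refine (norm_add_le _ _).trans_lt ?_
    rw [norm_smul, he, Real.norm_eq_abs, abs_of_pos (by linarith)]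
    linarith
  refine ⟨?_, hball⟩
  have hb₀ : x ∈ Metric.ball x₀ r := Metric.ball_subset_ball (by linarith) hx₀
  have hb₁ : x + (t / 2) • e + h ∈ Metric.ball x₀ r := by
    rw [Metric.mem_ball] at *
    linarith [dist_triangle (x + (t / 2) • e + h) x x₀]
  rw [hΩ _ hb₁]
  have h1 := (hΩ _ hb₀).1 hx
  have hee : (inner ℝ e e : ℝ) = 1 := by rw [real_inner_self_eq_norm_sq, he, one_pow]
  have hin : (inner ℝ e (x + (t / 2) • e + h) : ℝ) = inner ℝ e x + t / 2 + inner ℝ e h := by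
    rw [inner_add_right, inner_add_right, inner_smul_right, hee, mul_one]
  have hcs : |(inner ℝ e h : ℝ)| ≤ ‖h‖ := by
    simpa [he] using abs_real_inner_le_norm e h
  have hlip := hγ.dist_le_mul (x + (t / 2) • e + h - (inner ℝ e (x + (t / 2) • e + h) : ℝ) • e)
    (x - (inner ℝ e x : ℝ) • e)
  have hdiff : x + (t / 2) • e + h - (inner ℝ e (x + (t / 2) • e + h) : ℝ) • e -
      (x - (inner ℝ e x : ℝ) • e) = h - (inner ℝ e h : ℝ) • e := by
    rw [hin]; module
  rw [dist_eq_norm, dist_eq_norm, hdiff, Real.norm_eq_abs] at hlip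
  have hn : ‖h - (inner ℝ e h : ℝ) • e‖ ≤ 2 * ‖h‖ := by
    refine (norm_sub_le _ _).trans ?_
    rw [norm_smul, he, Real.norm_eq_abs]
    linarith
  have h2 : K * ‖h - (inner ℝ e h : ℝ) • e‖ ≤ K * (2 * ‖h‖) := by gcongr
  rw [hin] at hlip ⊢
  have h3 := (abs_le.1 hlip).2
  have h4 := (abs_le.1 hcs).1
  nlinarith

/-- Compactness of the closure makes the local constants uniform: near interior points the ball
around `x` itself works, near frontier points the graph description does. -/
theorem BoundedLipschitzDomain.exists_interior_ball (Ω : BoundedLipschitzDomain n) :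
    ∃ c r₀ : ℝ, 0 < c ∧ 0 < r₀ ∧ ∀ x ∈ Ω.carrier, ∀ r, 0 < r → r ≤ r₀ →
      ∃ y, Metric.ball y (c * r) ⊆ Ω.carrier ∩ Metric.ball x r := by
  let p : Set (E n) → Prop := fun S => ∃ c r₀ : ℝ, 0 < c ∧ 0 < r₀ ∧ ∀ x ∈ Ω.carrier ∩ S, ∀ r,
    0 < r → r ≤ r₀ → ∃ y, Metric.ball y (c * r) ⊆ Ω.carrier ∩ Metric.ball x r
  have hp : p (closure Ω.carrier) := by
    refine (Ω.isBounded.isCompact_closure).induction_on (p := p) ⟨1, 1, one_pos, one_pos, by simp⟩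
      ?_ ?_ ?_
    · rintro S T hST ⟨c, r₀, hc, hr, h⟩
      exact ⟨c, r₀, hc, hr, fun x hx => h x ⟨hx.1, hST hx.2⟩⟩
    · rintro S T ⟨c, r₀, hc, hr, h⟩ ⟨c', r₀', hc', hr', h'⟩
      refine ⟨min c c', min r₀ r₀', lt_min hc hc', lt_min hr hr', ?_⟩
      rintro x ⟨hx, hxS | hxT⟩ r hr0 hr1
      · obtain ⟨y, hy⟩ := h x ⟨hx, hxS⟩ r hr0 (hr1.trans (min_le_left _ _))
        exact ⟨y, (Metric.ball_subset_ball (by gcongr; exact min_le_left _ _)).trans hy⟩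
      · obtain ⟨y, hy⟩ := h' x ⟨hx, hxT⟩ r hr0 (hr1.trans (min_le_right _ _))
        exact ⟨y, (Metric.ball_subset_ball (by gcongr; exact min_le_right _ _)).trans hy⟩
    · intro x₀ hx₀
      by_cases hxΩ : x₀ ∈ Ω.carrier
      · obtain ⟨ρ, hρ, hb⟩ := Metric.isOpen_iff.1 Ω.isOpen x₀ hxΩ
        refine ⟨Metric.ball x₀ (ρ / 2),
          mem_nhdsWithin_of_mem_nhds (Metric.ball_mem_nhds _ (by linarith)),
          1, ρ / 2, one_pos, by linarith, ?_⟩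
        rintro x ⟨hx, hxb⟩ r hr0 hr1
        refine ⟨x, ?_⟩
        rw [one_mul]
        refine subset_inter (Subset.trans ?_ hb) le_rfl
        refine Metric.ball_subset_ball' ?_
        rw [Metric.mem_ball] at hxb
        linarith
      · have hfr : x₀ ∈ frontier Ω.carrier := by
          rw [frontier, Ω.isOpen.interior_eq]
          exact ⟨hx₀, hxΩ⟩
        obtain ⟨e, r, K, γ, he, hr, hγ, h⟩ := Ω.lipschitz x₀ hfr
        have hK : (0 : ℝ) ≤ K := K.2
        refine ⟨Metric.ball x₀ (r / 2),
          mem_nhdsWithin_of_mem_nhds (Metric.ball_mem_nhds _ (by linarith)),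
          1 / (2 * (1 + 2 * K)), r / 2, by positivity, by linarith, ?_⟩
        rintro x ⟨hx, hxb⟩ t ht0 ht1
        exact ⟨_, interior_ball_of_lipschitz_graph he hγ h hx hxb ht0 ht1⟩
  obtain ⟨c, r₀, hc, hr, h⟩ := hp
  exact ⟨c, r₀, hc, hr, fun x hx => h x ⟨hx, subset_closure hx⟩⟩

/-- This lower density bound is all that the Sobolev inequality below needs from the regularity of
the boundary; no extension operator enters. -/
theorem BoundedLipschitzDomain.exists_le_volume_inter_ball [NeZero n]
    (Ω : BoundedLipschitzDomain n) :
    ∃ κ r₀ : ℝ, 0 < κ ∧ 0 < r₀ ∧ ∀ x ∈ Ω.carrier, ∀ r, 0 < r → r ≤ r₀ →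
      ENNReal.ofReal (κ * r ^ n) ≤ volume (Ω.carrier ∩ Metric.ball x r) := by
  obtain ⟨c, r₀, hc, hr₀, h⟩ := Ω.exists_interior_ball
  have hv : volume (Metric.ball (0 : E n) 1) ≠ ⊤ := measure_ball_lt_top.ne
  have hv0 : 0 < (volume (Metric.ball (0 : E n) 1)).toReal :=
    ENNReal.toReal_pos (Metric.measure_ball_pos _ _ one_pos).ne' hv
  refine ⟨c ^ n * (volume (Metric.ball (0 : E n) 1)).toReal, r₀, by positivity, hr₀, ?_⟩
  intro x hx r hr0 hr1
  obtain ⟨y, hy⟩ := h x hx r hr0 hr1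
  refine le_trans (le_of_eq ?_) (measure_mono hy)
  rw [Measure.addHaar_ball volume y (by positivity : 0 ≤ c * r), finrank_euclideanSpace_fin, mul_right_comm,
    ← mul_pow, ENNReal.ofReal_mul (by positivity), ENNReal.ofReal_toReal hv]

/-! ### Integrals of the difference quotient -/

section quot

variable {Ω : BoundedLipschitzDomain n} {α : ℝ}

theorem measurable_diffQuot {z : E n → ℝ} (hz : Measurable z) : Measurable (diffQuot α z) := by
  unfold diffQuot
  fun_prop

theorem Y.measurable (z : Y Ω α) : Measurable z := (Lp.stronglyMeasurable _).measurable

theorem enorm_diffQuot_sq (z : E n → ℝ) (p : E n × E n) :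
    ‖diffQuot α z p‖ₑ ^ 2 =
      ENNReal.ofReal ((z p.1 - z p.2) ^ 2 / ‖p.1 - p.2‖ ^ ((n : ℝ) + α)) := by
  rw [pow_two (z p.1 - z p.2), ← diffQuot_mul_diffQuot, ← pow_two, ← sq_abs,
    ENNReal.ofReal_pow (abs_nonneg _), ← Real.norm_eq_abs, ofReal_norm]

theorem lintegral_enorm_sq_eq {X : Type*} [MeasurableSpace X] {μ : Measure X} {f : X → ℝ}
    (hf : MemLp f 2 μ) : ∫⁻ x, ‖f x‖ₑ ^ 2 ∂μ = ENNReal.ofReal (‖hf.toLp f‖ ^ 2) := by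
  have h := eLpNorm_nnreal_pow_eq_lintegral (f := f) (μ := μ) (p := 2) two_ne_zero
  rw [Lp.norm_toLp, ENNReal.ofReal_pow ENNReal.toReal_nonneg, ENNReal.ofReal_toReal hf.2.ne]
  simpa using h.symm

theorem Y.lintegral_diffQuot (z : Y Ω α) :
    ∫⁻ p in Ω.Q, ‖diffQuot α z p‖ₑ ^ 2 = ENNReal.ofReal (‖Y.quot z‖ ^ 2) :=
  lintegral_enorm_sq_eq z.memX.2

theorem Y.lintegral_lintegral_diffQuot_le (z : Y Ω α) (B : Set (E n)) :
    ∫⁻ x in Ω.carrier, ∫⁻ y in B, ‖diffQuot α z (x, y)‖ₑ ^ 2 ≤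
      ENNReal.ofReal (‖Y.quot z‖ ^ 2) := by
  have hm : Measurable fun p : E n × E n => ‖diffQuot α z p‖ₑ ^ 2 :=
    (measurable_diffQuot z.measurable).enorm.pow_const 2
  have h1 : ∫⁻ x in Ω.carrier, ∫⁻ y in B, ‖diffQuot α z (x, y)‖ₑ ^ 2 ≤
      ∫⁻ x in Ω.carrier, ∫⁻ y, ‖diffQuot α z (x, y)‖ₑ ^ 2 :=
    lintegral_mono fun x => setLIntegral_le_lintegral _ _
  refine h1.trans ?_
  rw [← Y.lintegral_diffQuot, ← lintegral_prod _ hm.aemeasurable]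
  have h2 : (volume.restrict Ω.carrier).prod (volume : Measure (E n)) =
      (volume : Measure (E n × E n)).restrict (Ω.carrier ×ˢ univ) := by
    rw [Measure.volume_eq_prod, ← Measure.prod_restrict, Measure.restrict_univ]
  rw [h2]
  exact lintegral_mono_set fun p hp hp' => hp'.1 hp.1

end quot

end FracLap

/-! ### The subcritical Sobolev inequality on the domain -/

namespace FracLap

variable {n m : ℕ}

/-- The radius is chosen so that the term with `C` is exactly half of `κ * r ^ n`. It is then
absorbed, leaving `a ^ 2 ≲ r ^ α * D` with `r` proportional to `a ^ (-q / n)`. If this radius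
exceeds `r₀`, then `a` is bounded by a constant. -/
theorem exists_rpow_le_of_forall_radius {n : ℕ} (hn : 0 < n) {α q κ C r₀ : ℝ} (hα : 0 < α)
    (hq : 0 < q) (hκ : 0 < κ) (hC : 0 < C) (hr₀ : 0 < r₀) :
    ∃ K : ℝ, 0 < K ∧ ∀ a D : ℝ, 0 < a → 0 ≤ D →
      (∀ r, 0 < r → r ≤ r₀ →
        κ * r ^ n ≤ (2 / a) ^ q * C + 4 / a ^ 2 * r ^ ((n : ℝ) + α) * D) →
      a ^ (2 + α * q / n) ≤ K * (1 + D) := by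
  have hn' : (0 : ℝ) < n := by exact_mod_cast hn
  -- With this value, `r = L / a ^ (q / n)` solves `κ * r ^ n = 2 * (2 / a) ^ q * C`.
  set L : ℝ := (2 * 2 ^ q * C / κ) ^ (1 / (n : ℝ)) with hL
  have hL0 : 0 < L := by positivity
  have hLn : L ^ n = 2 * 2 ^ q * C / κ := by
    rw [hL, ← Real.rpow_natCast, ← Real.rpow_mul (by positivity), one_div,
      inv_mul_cancel₀ hn'.ne', Real.rpow_one]
  refine ⟨((L / r₀) ^ ((n : ℝ) / q)) ^ (2 + α * q / n) + 8 * L ^ α / κ, by positivity, ?_⟩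
  intro a D ha hD h
  have hK1 : 0 ≤ ((L / r₀) ^ ((n : ℝ) / q)) ^ (2 + α * q / n) := by positivity
  have hK2 : 0 ≤ 8 * L ^ α / κ := by positivity
  have haq : 0 < a ^ (q / n) := by positivity
  rcases le_or_gt (L / a ^ (q / n)) r₀ with hr | hr
  · set r := L / a ^ (q / n) with hrdef
    have hr0 : 0 < r := by positivity
    have h1 := h r hr0 hr
    have haqn : (a ^ (q / n)) ^ n = a ^ q := by
      rw [← Real.rpow_natCast, ← Real.rpow_mul ha.le, div_mul_cancel₀ _ hn'.ne']
    have hrn : κ * r ^ n = 2 * ((2 / a) ^ q * C) := by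
      rw [hrdef, div_pow, hLn, haqn, Real.div_rpow two_pos.le ha.le]
      field_simp
    have hrα : r ^ α = L ^ α / a ^ (α * q / n) := by
      rw [hrdef, Real.div_rpow hL0.le haq.le, ← Real.rpow_mul ha.le]
      congr 2
      ring
    have h2 : κ * r ^ n / 2 ≤ 4 / a ^ 2 * (r ^ n * r ^ α) * D := by
      rw [Real.rpow_add hr0, Real.rpow_natCast] at h1
      linarith
    have h3 : κ * a ^ 2 ≤ 8 * r ^ α * D := by
      have hrn0 : 0 < r ^ n := by positivity
      have ha2 : 0 < a ^ 2 := by positivity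
      have h4 : 4 / a ^ 2 * (r ^ n * r ^ α) * D = r ^ n / a ^ 2 * (4 * r ^ α * D) := by ring
      have h5 : κ * r ^ n / 2 = r ^ n / a ^ 2 * (κ * a ^ 2 / 2) := by field_simp
      rw [h4, h5] at h2
      have := le_of_mul_le_mul_left h2 (by positivity)
      linarith
    rw [hrα] at h3
    have h6 : a ^ (2 + α * q / n) ≤ 8 * L ^ α / κ * D := by
      rw [Real.rpow_add ha, Real.rpow_two]
      have : 0 < a ^ (α * q / n) := by positivity
      have h7 : 8 * (L ^ α / a ^ (α * q / n)) * D = 8 * L ^ α * D / a ^ (α * q / n) := by ring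
      rw [h7, le_div_iff₀ this] at h3
      rw [div_mul_eq_mul_div, le_div_iff₀ hκ]
      linarith
    nlinarith [mul_nonneg hK1 hD]
  · have h1 : a ^ (q / n) ≤ L / r₀ := by
      rw [lt_div_iff₀ haq] at hr
      rw [le_div_iff₀ hr₀]
      linarith
    have h2 : a ≤ (L / r₀) ^ ((n : ℝ) / q) := by
      have := Real.rpow_le_rpow haq.le h1 (by positivity : 0 ≤ (n : ℝ) / q)
      rwa [← Real.rpow_mul ha.le, div_mul_div_cancel₀ hn'.ne', div_self hq.ne',
        Real.rpow_one] at this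
    have h3 := Real.rpow_le_rpow ha.le h2 (by positivity : 0 ≤ 2 + α * q / n)
    nlinarith [mul_nonneg hK1 hD, mul_nonneg hK2 hD]

variable {Ω : BoundedLipschitzDomain n} {α : ℝ}

/-- A dichotomy: either `|z y|` is at least half of `|z x|`, and the first term is at least one, or
`z` drops by at least `|z x| / 2` between `x` and `y`, and the second one is. Integrated over the
part of a ball in the domain it bounds the measure of that part. -/
theorem one_le_rpow_add_diffQuot {z : E n → ℝ} {x y : E n} {q r : ℝ} (hq : 0 < q)
    (hα : 0 ≤ α) (hx : 0 < |z x|) (hy : y ∈ Metric.ball x r) :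
    1 ≤ ENNReal.ofReal ((2 / |z x|) ^ q) * ENNReal.ofReal (|z y| ^ q) +
      ENNReal.ofReal (4 / |z x| ^ 2 * r ^ ((n : ℝ) + α)) * ‖diffQuot α z (x, y)‖ₑ ^ 2 := by
  have hr : 0 < r := Metric.pos_of_mem_ball hy
  rw [enorm_diffQuot_sq, ← ENNReal.ofReal_mul (by positivity), ← ENNReal.ofReal_mul (by positivity),
    ← ENNReal.ofReal_add (by positivity) (by positivity), ← ENNReal.ofReal_one]
  refine ENNReal.ofReal_le_ofReal ?_
  rcases le_or_gt |z x| (2 * |z y|) with h | h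
  · have h1 : 1 ≤ (2 / |z x|) ^ q * |z y| ^ q := by
      rw [← Real.mul_rpow (by positivity) (by positivity)]
      refine Real.one_le_rpow ?_ hq.le
      rw [div_mul_eq_mul_div, one_le_div hx]
      exact h
    have h2 : 0 ≤ 4 / |z x| ^ 2 * r ^ ((n : ℝ) + α) *
      ((z x - z y) ^ 2 / ‖x - y‖ ^ ((n : ℝ) + α)) := by positivity
    linarith
  · have hne : x ≠ y := by
      rintro rfl
      linarith
    have hxy : 0 < ‖x - y‖ := norm_pos_iff.2 (sub_ne_zero.2 hne)
    have h0 : 0 ≤ (2 / |z x|) ^ q * |z y| ^ q := by positivity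
    have h1 : |z x| / 2 ≤ |z x - z y| := by
      linarith [abs_sub_abs_le_abs_sub (z x) (z y)]
    have h2 : |z x| ^ 2 / 4 ≤ (z x - z y) ^ 2 := by
      rw [← sq_abs (z x - z y)]
      nlinarith [abs_nonneg (z x)]
    have h3 : ‖x - y‖ ^ ((n : ℝ) + α) ≤ r ^ ((n : ℝ) + α) := by
      refine Real.rpow_le_rpow hxy.le ?_ (by positivity)
      rw [← dist_eq_norm, dist_comm]
      exact (Metric.mem_ball.1 hy).le
    have h4 : 0 < ‖x - y‖ ^ ((n : ℝ) + α) := by positivity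
    have h5 : 1 ≤ 4 / |z x| ^ 2 * r ^ ((n : ℝ) + α) *
        ((z x - z y) ^ 2 / ‖x - y‖ ^ ((n : ℝ) + α)) := by
      have : 4 / |z x| ^ 2 * r ^ ((n : ℝ) + α) * ((z x - z y) ^ 2 / ‖x - y‖ ^ ((n : ℝ) + α)) =
          (4 * (z x - z y) ^ 2 / |z x| ^ 2) * (r ^ ((n : ℝ) + α) / ‖x - y‖ ^ ((n : ℝ) + α)) := by
        ring
      rw [this]
      refine one_le_mul_of_one_le_of_one_le ?_ ?_
      · rw [one_le_div (by positivity)]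
        linarith
      · rw [one_le_div h4]
        exact h3
    linarith

/-- One turn of the bootstrap: integrating the dichotomy over `Ω ∩ ball x r`, with the density bound
on the left, gives a pointwise bound of a power of `|z x|` by the integral of the squared difference
quotient in `y`, which is integrable in `x`. -/
theorem sobolev_step [NeZero n] (hα : 0 < α) {q : ℝ} (hq : 0 < q)
    (h : ∃ C : ℝ, 0 < C ∧ ∀ z : Y Ω α, ‖z‖ ≤ 1 →
      ∫⁻ x in Ω.carrier, ENNReal.ofReal (|z x| ^ q) ≤ ENNReal.ofReal C) :
    ∃ C : ℝ, 0 < C ∧ ∀ z : Y Ω α, ‖z‖ ≤ 1 →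
      ∫⁻ x in Ω.carrier, ENNReal.ofReal (|z x| ^ (2 + α * q / n)) ≤ ENNReal.ofReal C := by
  obtain ⟨C, hC, h⟩ := h
  obtain ⟨κ, r₀, hκ, hr₀, hden⟩ := Ω.exists_le_volume_inter_ball
  obtain ⟨K, hK, hscal⟩ := exists_rpow_le_of_forall_radius
    (Nat.pos_of_ne_zero (NeZero.ne n)) hα hq hκ hC hr₀
  have hfin : volume Ω.carrier ≠ ⊤ := Ω.isBounded.measure_lt_top.ne
  refine ⟨K * ((volume Ω.carrier).toReal + 1), by positivity, fun z hz => ?_⟩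
  set D : E n → ℝ≥0∞ := fun x => ∫⁻ y in Ω.carrier, ‖diffQuot α z (x, y)‖ₑ ^ 2 with hD
  have hquot : ‖Y.quot z‖ ≤ 1 := by
    rw [Y.norm_def] at hz
    linarith [norm_nonneg (Y.toL2 z)]
  have hDint : ∫⁻ x in Ω.carrier, D x ≤ 1 := by
    refine (z.lintegral_lintegral_diffQuot_le Ω.carrier).trans ?_
    rw [← ENNReal.ofReal_one]
    exact ENNReal.ofReal_le_ofReal (pow_le_one₀ (norm_nonneg _) hquot)
  have hzm := z.measurable
  have hpt : ∀ x ∈ Ω.carrier,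
      ENNReal.ofReal (|z x| ^ (2 + α * q / n)) ≤ ENNReal.ofReal K * (1 + D x) := by
    intro x hx
    rcases eq_or_ne (D x) ⊤ with hDx | hDx
    · rw [hDx, add_top, ENNReal.mul_top (ENNReal.ofReal_pos.2 hK).ne']
      exact le_top
    rcases eq_or_lt_of_le (abs_nonneg (z x)) with h0 | h0
    · rw [← h0, Real.zero_rpow (by positivity), ENNReal.ofReal_zero]
      exact zero_le
    have hmain := hscal |z x| (D x).toReal h0 ENNReal.toReal_nonneg ?_
    · have : ENNReal.ofReal K * (1 + D x) = ENNReal.ofReal (K * (1 + (D x).toReal)) := by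
        rw [ENNReal.ofReal_mul hK.le, ENNReal.ofReal_add zero_le_one ENNReal.toReal_nonneg,
          ENNReal.ofReal_toReal hDx, ENNReal.ofReal_one]
      rw [this]
      exact ENNReal.ofReal_le_ofReal hmain
    · intro r hr0 hr1
      have hAm : MeasurableSet (Ω.carrier ∩ Metric.ball x r) :=
        Ω.isOpen.measurableSet.inter measurableSet_ball
      have h1 : volume (Ω.carrier ∩ Metric.ball x r) ≤
          ENNReal.ofReal ((2 / |z x|) ^ q) * ENNReal.ofReal C +
            ENNReal.ofReal (4 / |z x| ^ 2 * r ^ ((n : ℝ) + α)) * D x := by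
        calc volume (Ω.carrier ∩ Metric.ball x r)
            = ∫⁻ _ in Ω.carrier ∩ Metric.ball x r, 1 := by simp
          _ ≤ ∫⁻ y in Ω.carrier ∩ Metric.ball x r,
              (ENNReal.ofReal ((2 / |z x|) ^ q) * ENNReal.ofReal (|z y| ^ q) +
              ENNReal.ofReal (4 / |z x| ^ 2 * r ^ ((n : ℝ) + α)) * ‖diffQuot α z (x, y)‖ₑ ^ 2) :=
            setLIntegral_mono' hAm fun y hy => one_le_rpow_add_diffQuot hq hα.le h0 hy.2
          _ ≤ ∫⁻ y in Ω.carrier,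
              (ENNReal.ofReal ((2 / |z x|) ^ q) * ENNReal.ofReal (|z y| ^ q) +
              ENNReal.ofReal (4 / |z x| ^ 2 * r ^ ((n : ℝ) + α)) * ‖diffQuot α z (x, y)‖ₑ ^ 2) :=
            lintegral_mono_set inter_subset_left
          _ ≤ _ := by
            rw [lintegral_add_left (by fun_prop), lintegral_const_mul' _ _ ENNReal.ofReal_ne_top,
              lintegral_const_mul' _ _ ENNReal.ofReal_ne_top]
            gcongr
            exact h z hz
      have h2 := (hden x hx r hr0 hr1).trans h1
      rw [← ENNReal.ofReal_toReal hDx, ← ENNReal.ofReal_mul (by positivity),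
        ← ENNReal.ofReal_mul (by positivity),
        ← ENNReal.ofReal_add (by positivity) (by positivity)] at h2
      exact (ENNReal.ofReal_le_ofReal_iff (by positivity)).1 h2
  calc ∫⁻ x in Ω.carrier, ENNReal.ofReal (|z x| ^ (2 + α * q / n))
      ≤ ∫⁻ x in Ω.carrier, ENNReal.ofReal K * (1 + D x) :=
        setLIntegral_mono' Ω.isOpen.measurableSet hpt
    _ = ENNReal.ofReal K * (volume Ω.carrier + ∫⁻ x in Ω.carrier, D x) := by
        rw [lintegral_const_mul' _ _ ENNReal.ofReal_ne_top, lintegral_add_left measurable_const]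
        simp
    _ ≤ ENNReal.ofReal K * (volume Ω.carrier + 1) := by gcongr
    _ = _ := by
        rw [ENNReal.ofReal_mul hK.le, ENNReal.ofReal_add ENNReal.toReal_nonneg zero_le_one,
          ENNReal.ofReal_toReal hfin, ENNReal.ofReal_one]

theorem sobolev_two : ∃ C : ℝ, 0 < C ∧ ∀ z : Y Ω α, ‖z‖ ≤ 1 →
    ∫⁻ x in Ω.carrier, ENNReal.ofReal (|z x| ^ (2 : ℝ)) ≤ ENNReal.ofReal C := by
  refine ⟨1, one_pos, fun z hz => ?_⟩
  have h2 : ‖Y.toL2 z‖ ≤ 1 := by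
    rw [Y.norm_def] at hz
    linarith [norm_nonneg (Y.quot z)]
  refine (setLIntegral_le_lintegral _ _).trans ?_
  have h3 := lintegral_enorm_sq_eq (Lp.memLp (Y.toL2 z))
  rw [Lp.toLp_coeFn] at h3
  calc ∫⁻ x, ENNReal.ofReal (|z x| ^ (2 : ℝ)) = ∫⁻ x, ‖z x‖ₑ ^ 2 := by
        refine lintegral_congr fun x => ?_
        rw [Real.rpow_two, ENNReal.ofReal_pow (abs_nonneg _), ← Real.norm_eq_abs, ofReal_norm]
    _ ≤ _ := by
        rw [h3]
        exact ENNReal.ofReal_le_ofReal (pow_le_one₀ (norm_nonneg _) h2)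

theorem sobolev_mono [NeZero n] {q q' : ℝ} (hq : 0 ≤ q) (hqq' : q ≤ q')
    (h : ∃ C : ℝ, 0 < C ∧ ∀ z : Y Ω α, ‖z‖ ≤ 1 →
      ∫⁻ x in Ω.carrier, ENNReal.ofReal (|z x| ^ q') ≤ ENNReal.ofReal C) :
    ∃ C : ℝ, 0 < C ∧ ∀ z : Y Ω α, ‖z‖ ≤ 1 →
      ∫⁻ x in Ω.carrier, ENNReal.ofReal (|z x| ^ q) ≤ ENNReal.ofReal C := by
  obtain ⟨C, hC, h⟩ := h
  have hfin : volume Ω.carrier ≠ ⊤ := Ω.isBounded.measure_lt_top.ne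
  refine ⟨(volume Ω.carrier).toReal + C, by positivity, fun z hz => ?_⟩
  calc ∫⁻ x in Ω.carrier, ENNReal.ofReal (|z x| ^ q)
      ≤ ∫⁻ x in Ω.carrier, (1 + ENNReal.ofReal (|z x| ^ q')) := by
        refine lintegral_mono fun x => ?_
        rw [← ENNReal.ofReal_one, ← ENNReal.ofReal_add zero_le_one (by positivity)]
        refine ENNReal.ofReal_le_ofReal ?_
        rcases le_total |z x| 1 with h1 | h1
        · have := Real.rpow_le_one (abs_nonneg (z x)) h1 hq
          have h2 : 0 ≤ |z x| ^ q' := by positivity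
          linarith
        · linarith [Real.rpow_le_rpow_of_exponent_le h1 hqq']
    _ = volume Ω.carrier + ∫⁻ x in Ω.carrier, ENNReal.ofReal (|z x| ^ q') := by
        rw [lintegral_add_left measurable_const]
        simp
    _ ≤ volume Ω.carrier + ENNReal.ofReal C := by gcongr; exact h z hz
    _ = _ := by
        rw [ENNReal.ofReal_add ENNReal.toReal_nonneg hC.le, ENNReal.ofReal_toReal hfin]

/-- The affine map has slope `α / ν < 1` and fixed point `2 * ν / (ν - α)`, the critical exponent.
The iterates converge to it, so they exceed every subcritical exponent after finitely many steps. -/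
theorem exists_iterate_gt {α ν s : ℝ} (hα : 0 < α) (hαν : α < ν) (hs : s < 2 * ν / (ν - α)) :
    ∃ k : ℕ, s < (fun q => 2 + α * q / ν)^[k] 2 := by
  have hν : 0 < ν := hα.trans hαν
  set L := 2 * ν / (ν - α) with hL
  have hne : ν - α ≠ 0 := by linarith
  have hfix : 2 + α * L / ν = L := by rw [hL]; field_simp; ring
  have hform : ∀ k : ℕ, (fun q => 2 + α * q / ν)^[k] 2 = L - (α / ν) ^ k * (L - 2) := by
    intro k
    induction k with
    | zero => simp
    | succ k ih =>
      rw [Function.iterate_succ_apply', ih]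
      have : 2 + α * (L - (α / ν) ^ k * (L - 2)) / ν =
          (2 + α * L / ν) - (α / ν) ^ (k + 1) * (L - 2) := by rw [pow_succ]; ring
      rw [this, hfix]
  have hlim : Tendsto (fun k : ℕ => L - (α / ν) ^ k * (L - 2)) atTop (𝓝 (L - 0 * (L - 2))) :=
    tendsto_const_nhds.sub ((tendsto_pow_atTop_nhds_zero_of_lt_one (by positivity)
      ((div_lt_one hν).2 hαν)).mul_const _)
  rw [zero_mul, sub_zero] at hlim
  obtain ⟨k, hk⟩ := (hlim.eventually_const_lt hs).exists
  exact ⟨k, by rw [hform]; exact hk⟩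

theorem sobolev [NeZero n] (hα : 0 < α) (hαn : α < n) {s : ℝ} (hs0 : 0 ≤ s)
    (hs : s < 2 * n / (n - α)) :
    ∃ C : ℝ, 0 < C ∧ ∀ z : Y Ω α, ‖z‖ ≤ 1 →
      ∫⁻ x in Ω.carrier, ENNReal.ofReal (|z x| ^ s) ≤ ENNReal.ofReal C := by
  obtain ⟨k, hk⟩ := exists_iterate_gt hα hαn hs
  refine sobolev_mono hs0 hk.le ?_
  have hpos : ∀ k : ℕ, 0 < (fun q => 2 + α * q / (n : ℝ))^[k] 2 := by
    intro k
    induction k with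
    | zero => simp
    | succ k ih =>
      rw [Function.iterate_succ_apply']
      positivity
  clear hk
  induction k with
  | zero => exact sobolev_two
  | succ k ih =>
    rw [Function.iterate_succ_apply']
    exact sobolev_step hα (hpos k) ih

end FracLap

namespace FracLap

variable {n m : ℕ} {Ω : BoundedLipschitzDomain n} {α : ℝ}

/-! ### The restriction `Y^{α/2} → L^s(Ω)` -/

theorem eLpNorm_ofReal_rpow {X : Type*} [MeasurableSpace X] {μ : Measure X} {f : X → ℝ} {s : ℝ}
    (hs : 0 < s) : eLpNorm f (ENNReal.ofReal s) μ ^ s = ∫⁻ x, ENNReal.ofReal (|f x| ^ s) ∂μ := by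
  rw [eLpNorm_eq_lintegral_rpow_enorm_toReal (ENNReal.ofReal_pos.2 hs).ne' ENNReal.ofReal_ne_top,
    ENNReal.toReal_ofReal hs.le, ← ENNReal.rpow_mul, one_div_mul_cancel hs.ne', ENNReal.rpow_one]
  refine lintegral_congr fun x => ?_
  rw [← ENNReal.ofReal_rpow_of_nonneg (abs_nonneg _) hs.le, ← Real.norm_eq_abs, ofReal_norm]

theorem memLp_ofReal_of_lintegral_le {X : Type*} [MeasurableSpace X] {μ : Measure X} {f : X → ℝ}
    {s : ℝ} (hs : 0 < s) (hf : AEStronglyMeasurable f μ) {C : ℝ} (hC : 0 ≤ C)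
    (h : ∫⁻ x, ENNReal.ofReal (|f x| ^ s) ∂μ ≤ ENNReal.ofReal C) :
    MemLp f (ENNReal.ofReal s) μ ∧
      (eLpNorm f (ENNReal.ofReal s) μ).toReal ≤ C ^ (1 / s) := by
  rw [← eLpNorm_ofReal_rpow hs] at h
  have h1 : eLpNorm f (ENNReal.ofReal s) μ ≤ ENNReal.ofReal (C ^ (1 / s)) := by
    have := ENNReal.rpow_le_rpow h (by positivity : 0 ≤ 1 / s)
    rwa [← ENNReal.rpow_mul, mul_one_div_cancel hs.ne', ENNReal.rpow_one,
      ENNReal.ofReal_rpow_of_nonneg hC (by positivity)] at this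
  exact ⟨⟨hf, h1.trans_lt ENNReal.ofReal_lt_top⟩,
    ENNReal.toReal_le_of_le_ofReal (by positivity) h1⟩

theorem Y.coeFn_add (a b : Y Ω α) : (a + b : Y Ω α) =ᵐ[volume] fun x => a x + b x := by
  have := Lp.coeFn_add (Y.toL2 a) (Y.toL2 b)
  rwa [← map_add] at this

theorem Y.coeFn_smul (c : ℝ) (a : Y Ω α) : (c • a : Y Ω α) =ᵐ[volume] fun x => c * a x := by
  have := Lp.coeFn_smul c (Y.toL2 a)
  rwa [← map_smul] at this

theorem X0.ae_zero_compl (w : X0 Ω α) : ∀ᵐ x, x ∉ Ω.carrier → w x = 0 := by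
  have := w.ae_eq_zero
  rwa [ae_restrict_iff' Ω.isOpen.measurableSet.compl] at this

theorem X0.lintegral_sq_le (w : X0 Ω α) :
    ∫⁻ x, ‖w x‖ₑ ^ 2 = ∫⁻ x in Ω.carrier, ‖w x‖ₑ ^ 2 := by
  rw [← lintegral_indicator Ω.isOpen.measurableSet]
  refine lintegral_congr_ae ?_
  filter_upwards [w.ae_zero_compl] with x hx
  by_cases h : x ∈ Ω.carrier
  · rw [indicator_of_mem h]
  · rw [indicator_of_notMem h, hx h]
    simp

/-- The graph of the difference quotient is closed: along a common subsequence both limits hold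
almost everywhere, so the quotient of the limit function is the limit of the quotients, and
vanishing outside the domain is preserved. -/
theorem X0.exists_of_tendsto {w : ℕ → X0 Ω α} {f : Lp ℝ 2 (volume : Measure (E n))}
    {g : Lp ℝ 2 (volume.restrict Ω.Q)}
    (hf : Tendsto (fun k => Y.toL2 (X0.toY (w k))) atTop (𝓝 f))
    (hg : Tendsto (fun k => Y.quot (X0.toY (w k))) atTop (𝓝 g)) :
    ∃ x : X0 Ω α, Y.quot (X0.toY x) = g := by
  obtain ⟨φ, hφ, hφf⟩ := (tendstoInMeasure_of_tendsto_Lp hf).exists_seq_tendsto_ae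
  have hg' := hg.comp hφ.tendsto_atTop
  obtain ⟨ψ, hψ, hψg⟩ := (tendstoInMeasure_of_tendsto_Lp hg').exists_seq_tendsto_ae
  have hfψ : ∀ᵐ x, Tendsto (fun k => w (φ (ψ k)) x) atTop (𝓝 (f x)) := by
    filter_upwards [hφf] with x hx
    exact hx.comp hψ.tendsto_atTop
  have hdq : diffQuot α f =ᵐ[volume.restrict Ω.Q] g := by
    have h1 : ∀ᵐ p ∂(volume.restrict Ω.Q), ∀ k, Y.quot (X0.toY (w (φ (ψ k)))) p =
        diffQuot α (w (φ (ψ k))) p :=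
      ae_all_iff.2 fun k => (X0.toY (w (φ (ψ k)))).memX.2.coeFn_toLp
    filter_upwards [h1, hψg, ae_fst_restrict Measure.restrict_le_self hfψ,
      ae_snd_restrict Measure.restrict_le_self hfψ] with p hp1 hp2 hp3 hp4
    refine tendsto_nhds_unique ?_ hp2
    have : Tendsto (fun k => diffQuot α (w (φ (ψ k))) p) atTop (𝓝 (diffQuot α f p)) :=
      (hp3.sub hp4).div_const _
    exact this.congr fun k => (hp1 k).symm
  have hfX : MemX Ω α f :=
    ⟨(Lp.memLp f).restrict _, (memLp_congr_ae hdq).2 (Lp.memLp g)⟩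
  have hf0 : ∀ᵐ x ∂(volume.restrict Ω.carrierᶜ), f x = 0 := by
    have h1 : ∀ᵐ x ∂(volume.restrict Ω.carrierᶜ), ∀ k, w (φ (ψ k)) x = 0 :=
      ae_all_iff.2 fun k => (w (φ (ψ k))).ae_eq_zero
    filter_upwards [h1, ae_restrict_of_ae hfψ] with x h2 h3
    refine tendsto_nhds_unique h3 ?_
    simp only [h2]
    exact tendsto_const_nhds
  refine ⟨⟨⟨f, hfX⟩, hf0⟩, ?_⟩
  exact Lp.ext (hfX.2.coeFn_toLp.trans hdq)

variable [NeZero n]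

/-- The bound on the unit ball gives a bounded operator into `L^s(Ω)`. -/
theorem exists_restrict_clm (hα : 0 < α) (hαn : α < n) {s : ℝ} (hs1 : 1 ≤ s)
    (hs : s < 2 * n / (n - α)) [Fact (1 ≤ ENNReal.ofReal s)] :
    ∃ S : Y Ω α →L[ℝ] Lp ℝ (ENNReal.ofReal s) Ω.vol, ∀ z, S z =ᵐ[Ω.vol] z := by
  have hs0 : 0 < s := by linarith
  obtain ⟨C, hC, h⟩ := sobolev (Ω := Ω) hα hαn hs0.le hs
  have hmeas : ∀ z : Y Ω α, AEStronglyMeasurable z Ω.vol := fun z =>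
    z.measurable.aestronglyMeasurable
  have hball : ∀ z : Y Ω α, ‖z‖ ≤ 1 → MemLp z (ENNReal.ofReal s) Ω.vol ∧
      (eLpNorm z (ENNReal.ofReal s) Ω.vol).toReal ≤ C ^ (1 / s) := fun z hz =>
    memLp_ofReal_of_lintegral_le hs0 (hmeas z) hC.le (h z hz)
  have hunit : ∀ z : Y Ω α, z ≠ 0 → ‖(‖z‖⁻¹ • z)‖ ≤ 1 := fun z hz => by
    rw [norm_smul, norm_inv, norm_norm, inv_mul_cancel₀ (norm_ne_zero_iff.2 hz)]
  have hscale : ∀ z : Y Ω α, z ≠ 0 → z =ᵐ[Ω.vol] ‖z‖ • (‖z‖⁻¹ • z : Y Ω α) := by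
    intro z hz
    filter_upwards [ae_restrict_of_ae (Y.coeFn_smul ‖z‖⁻¹ z)] with x hx
    rw [Pi.smul_apply, hx, smul_eq_mul, mul_inv_cancel_left₀ (norm_ne_zero_iff.2 hz)]
  have hmem : ∀ z : Y Ω α, MemLp z (ENNReal.ofReal s) Ω.vol := by
    intro z
    rcases eq_or_ne z 0 with rfl | hz
    · exact (hball 0 (by simp)).1
    · rw [memLp_congr_ae (hscale z hz)]
      exact (hball _ (hunit z hz)).1.const_smul _
  let S₀ : Y Ω α →ₗ[ℝ] Lp ℝ (ENNReal.ofReal s) Ω.vol :=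
    { toFun := fun z => (hmem z).toLp _
      map_add' := fun a b => by
        rw [← MemLp.toLp_add, MemLp.toLp_eq_toLp_iff]
        exact ae_restrict_of_ae (Y.coeFn_add a b)
      map_smul' := fun c a => by
        rw [RingHom.id_apply, ← MemLp.toLp_const_smul, MemLp.toLp_eq_toLp_iff]
        exact ae_restrict_of_ae (Y.coeFn_smul c a) }
  refine ⟨S₀.mkContinuous (C ^ (1 / s)) fun z => ?_, fun z => (hmem z).coeFn_toLp⟩
  rcases eq_or_ne z 0 with rfl | hz
  · simp
  · have h1 : S₀ z = ‖z‖ • S₀ (‖z‖⁻¹ • z) := by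
      rw [← map_smul, smul_inv_smul₀ (norm_ne_zero_iff.2 hz)]
    have h2 : ‖S₀ (‖z‖⁻¹ • z)‖ ≤ C ^ (1 / s) := by
      change ‖(hmem _).toLp _‖ ≤ _
      rw [Lp.norm_toLp]
      exact (hball _ (hunit z hz)).2
    rw [h1, norm_smul, norm_norm, mul_comm]
    gcongr

/-! ### The Poincaré inequality and completeness of `X₀^{α/2}` -/

theorem exists_bounded_compl_pos (Ω : BoundedLipschitzDomain n) :
    ∃ R : ℝ, 0 < R ∧ volume (Ω.carrierᶜ ∩ Metric.ball 0 R) ≠ 0 := by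
  by_contra! hcon
  refine restrict_compl_ne_zero Ω ?_
  rw [Measure.restrict_eq_zero]
  have : Ω.carrierᶜ ⊆ ⋃ N : ℕ, Ω.carrierᶜ ∩ Metric.ball 0 ((N : ℝ) + 1) := by
    intro x hx
    obtain ⟨N, hN⟩ := exists_nat_gt ‖x‖
    refine mem_iUnion.2 ⟨N, hx, ?_⟩
    rw [mem_ball_zero_iff]
    linarith
  exact measure_mono_null this (measure_iUnion_null fun N => hcon _ (by positivity))

/-- A function of `X0` vanishes on a bounded set `B` of positive measure outside the domain, and
points of the domain lie within `d` of `B`. Hence the part of the form over `Ω × B` already controls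
`∫ |w|²`. -/
theorem X0.poincare (hα : 0 < α) :
    ∃ C : ℝ, 0 < C ∧ ∀ w : X0 Ω α, ‖Y.toL2 (X0.toY w)‖ ≤ C * ‖w‖ := by
  obtain ⟨R, hR, hB⟩ := exists_bounded_compl_pos Ω
  set B := Ω.carrierᶜ ∩ Metric.ball 0 R with hBdef
  have hBm : MeasurableSet B := Ω.isOpen.measurableSet.compl.inter measurableSet_ball
  have hBfin : volume B ≠ ⊤ :=
    ((measure_mono inter_subset_right).trans_lt measure_ball_lt_top).ne
  obtain ⟨R', hR'⟩ := Ω.isBounded.exists_norm_le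
  set d := |R'| + R with hd
  have hd0 : 0 < d := by positivity
  have hdist : ∀ x ∈ Ω.carrier, ∀ y ∈ B, ‖x - y‖ ≤ d := by
    intro x hx y hy
    have h1 := mem_ball_zero_iff.1 hy.2
    linarith [norm_sub_le x y, hR' x hx, le_abs_self R']
  have hβ : 0 < (volume B).toReal := ENNReal.toReal_pos hB hBfin
  set A : ℝ := (volume B).toReal / d ^ ((n : ℝ) + α) with hA
  have hA0 : 0 < A := by positivity
  refine ⟨Real.sqrt (1 / A), by positivity, fun w => ?_⟩
  have hkey : ENNReal.ofReal A * ∫⁻ x in Ω.carrier, ‖w x‖ₑ ^ 2 ≤ ENNReal.ofReal (‖w‖ ^ 2) := by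
    refine le_trans ?_ ((X0.toY w).lintegral_lintegral_diffQuot_le B)
    rw [← lintegral_const_mul' _ _ ENNReal.ofReal_ne_top]
    refine setLIntegral_mono' Ω.isOpen.measurableSet fun x hx => ?_
    calc ENNReal.ofReal A * ‖w x‖ₑ ^ 2
        = ∫⁻ _ in B, ENNReal.ofReal (1 / d ^ ((n : ℝ) + α)) * ‖w x‖ₑ ^ 2 := by
          rw [setLIntegral_const, hA, mul_right_comm, div_eq_mul_one_div,
            mul_comm (volume B).toReal, ENNReal.ofReal_mul (by positivity),
            ENNReal.ofReal_toReal hBfin]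
      _ ≤ _ := by
          refine setLIntegral_mono_ae' hBm ?_
          filter_upwards [w.ae_zero_compl] with y hy hyB
          have hne : x ≠ y := by
            rintro rfl
            exact hyB.1 hx
          have hxy : 0 < ‖x - y‖ := norm_pos_iff.2 (sub_ne_zero.2 hne)
          rw [enorm_diffQuot_sq]
          dsimp only
          rw [hy hyB.1, sub_zero, ← ofReal_norm,
            ← ENNReal.ofReal_pow (norm_nonneg _), ← ENNReal.ofReal_mul (by positivity)]
          refine ENNReal.ofReal_le_ofReal ?_
          rw [Real.norm_eq_abs, sq_abs, one_div_mul_eq_div]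
          gcongr
          exact hdist x hx y hyB
  have h3 := lintegral_enorm_sq_eq (Lp.memLp (Y.toL2 (X0.toY w)))
  rw [Lp.toLp_coeFn, X0.lintegral_sq_le] at h3
  rw [h3, ← ENNReal.ofReal_mul hA0.le, ENNReal.ofReal_le_ofReal_iff (by positivity)] at hkey
  refine abs_le_of_sq_le_sq' ?_ (by positivity) |>.2
  rw [mul_pow, Real.sq_sqrt (by positivity), one_div_mul_eq_div, le_div_iff₀ hA0]
  linarith

theorem X0.exists_norm_toY_le (hα : 0 < α) :
    ∃ C : ℝ, 0 < C ∧ ∀ w : X0 Ω α, ‖X0.toY w‖ ≤ C * ‖w‖ := by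
  obtain ⟨C, hC, h⟩ := X0.poincare (Ω := Ω) hα
  refine ⟨C + 1, by positivity, fun w => ?_⟩
  rw [Y.norm_def, ← X0.norm_def]
  linarith [h w]

theorem exists_toY_clm (hα : 0 < α) :
    ∃ J : X0 Ω α →L[ℝ] Y Ω α, ∀ w, J w = X0.toY w := by
  obtain ⟨C, hC⟩ := X0.exists_norm_toY_le (Ω := Ω) hα
  refine ⟨LinearMap.mkContinuous X0.toY C hC.2, fun w => ?_⟩
  exact LinearMap.mkContinuous_apply ..

/-- By the Poincaré inequality a Cauchy sequence is Cauchy in L² as well, so that the closedness of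
the quotient map identifies the limit. -/
theorem X0.completeSpace (hα : 0 < α) : CompleteSpace (X0 Ω α) := by
  obtain ⟨C, hC, hP⟩ := X0.poincare (Ω := Ω) hα
  refine Metric.complete_of_cauchySeq_tendsto fun w hw => ?_
  have hq : CauchySeq fun k => Y.quot (X0.toY (w k)) := by
    refine Metric.cauchySeq_iff'.2 fun ε hε => ?_
    obtain ⟨N, hN⟩ := Metric.cauchySeq_iff'.1 hw ε hε
    refine ⟨N, fun k hk => ?_⟩
    have := hN k hk
    rwa [dist_eq_norm, X0.norm_def, map_sub, map_sub, ← dist_eq_norm] at this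
  have hl : CauchySeq fun k => Y.toL2 (X0.toY (w k)) := by
    refine Metric.cauchySeq_iff'.2 fun ε hε => ?_
    obtain ⟨N, hN⟩ := Metric.cauchySeq_iff'.1 hw (ε / C) (by positivity)
    refine ⟨N, fun k hk => ?_⟩
    have h1 := hN k hk
    have h2 := hP (w k - w N)
    rw [map_sub, map_sub] at h2
    rw [dist_eq_norm] at h1 ⊢
    refine h2.trans_lt ?_
    rwa [lt_div_iff₀ hC, mul_comm] at h1
  obtain ⟨f, hf⟩ := cauchySeq_tendsto_of_complete hl
  obtain ⟨g, hg⟩ := cauchySeq_tendsto_of_complete hq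
  obtain ⟨x, hxg⟩ := X0.exists_of_tendsto hf hg
  refine ⟨x, ?_⟩
  rw [tendsto_iff_dist_tendsto_zero]
  refine (tendsto_iff_dist_tendsto_zero.1 hg).congr fun k => ?_
  rw [dist_eq_norm, dist_eq_norm, X0.norm_def, map_sub, map_sub, hxg]

end FracLap

/-! ### Weak compactness and interpolation of powers -/

theorem exists_weakly_convergent_subseq {H : Type*} [NormedAddCommGroup H] [InnerProductSpace ℝ H]
    [CompleteSpace H] [TopologicalSpace.SeparableSpace H] {w : ℕ → H} {M : ℝ}
    (hw : ∀ k, ‖w k‖ ≤ M) :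
    ∃ (x : H) (φ : ℕ → ℕ), StrictMono φ ∧
      ∀ L : H →L[ℝ] ℝ, Tendsto (fun k => L (w (φ k))) atTop (𝓝 (L x)) := by
  let f : ℕ → WeakDual ℝ H := fun k =>
    StrongDual.toWeakDual (InnerProductSpace.toDual ℝ H (w k))
  have hf : ∀ k, f k ∈ WeakDual.toStrongDual ⁻¹' Metric.closedBall (0 : StrongDual ℝ H) M := by
    intro k
    rw [mem_preimage, mem_closedBall_zero_iff]
    exact ((InnerProductSpace.toDual ℝ H).norm_map (w k)).trans_le (hw k)
  obtain ⟨g, -, φ, hφ, hlim⟩ := WeakDual.isSeqCompact_closedBall ℝ H 0 M hf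
  refine ⟨(InnerProductSpace.toDual ℝ H).symm (WeakDual.toStrongDual g), φ, hφ, fun L => ?_⟩
  have h1 := ((WeakDual.eval_continuous ((InnerProductSpace.toDual ℝ H).symm L)).tendsto g).comp
    hlim
  have h2 : ∀ x : H, L x = inner ℝ x ((InnerProductSpace.toDual ℝ H).symm L) := by
    intro x
    rw [real_inner_comm, InnerProductSpace.toDual_symm_apply]
  simp only [h2]
  rw [InnerProductSpace.toDual_symm_apply]
  exact h1

/-- The two terms on the right dominate for large and for small `t`, respectively; the split is at
`ε * t ^ (q - s) = 1`. -/
theorem rpow_le_mul_rpow_add_mul_sq {s q ε t : ℝ} (hs : 2 < s) (hsq : s < q) (hε : 0 < ε)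
    (ht : 0 ≤ t) : t ^ s ≤ ε * t ^ q + ε ^ (-(s - 2) / (q - s)) * t ^ (2 : ℝ) := by
  have hqs : 0 < q - s := by linarith
  rcases eq_or_lt_of_le ht with rfl | ht
  · rw [Real.zero_rpow (by linarith), Real.zero_rpow (by linarith), Real.zero_rpow (by norm_num)]
    simp
  have h1 : 0 ≤ ε * t ^ q := by positivity
  have h2 : 0 ≤ ε ^ (-(s - 2) / (q - s)) * t ^ (2 : ℝ) := by positivity
  rcases le_total (ε * t ^ (q - s)) 1 with h | h
  · have h3 : t ^ (q - s) ≤ ε⁻¹ := by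
      rw [← one_div, le_div_iff₀ hε]
      linarith
    have h4 : t ^ (s - 2) ≤ ε ^ (-(s - 2) / (q - s)) := by
      have := Real.rpow_le_rpow (by positivity) h3 (by positivity : 0 ≤ (s - 2) / (q - s))
      rw [← Real.rpow_mul ht.le, mul_div_cancel₀ _ hqs.ne', Real.inv_rpow hε.le,
        ← Real.rpow_neg hε.le] at this
      rwa [neg_div]
    have h5 : t ^ s = t ^ (s - 2) * t ^ (2 : ℝ) := by
      rw [← Real.rpow_add ht]
      congr 1
      ring
    have := mul_le_mul_of_nonneg_right h4 (by positivity : 0 ≤ t ^ (2 : ℝ))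
    linarith
  · have h5 : t ^ q = t ^ (q - s) * t ^ s := by
      rw [← Real.rpow_add ht]
      congr 1
      ring
    have h6 : 0 < t ^ s := by positivity
    nlinarith

/-! ### Compactness of the restriction of `X0` to subcritical Lebesgue spaces -/

namespace FracLap

variable {n m : ℕ} {Ω : BoundedLipschitzDomain n} {α : ℝ}

theorem isSeparable_of_countablyGenerated {X : Type*} [MeasurableSpace X]
    [MeasurableSpace.CountablyGenerated X] (μ : Measure X) [SFinite μ] :
    MeasureTheory.IsSeparable μ := inferInstance

theorem X0.separableSpace [NeZero n] : TopologicalSpace.SeparableSpace (X0 Ω α) := by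
  have hiso : Isometry (Y.quot ∘ₗ (X0.toY : X0 Ω α →ₗ[ℝ] Y Ω α)) :=
    AddMonoidHomClass.isometry_of_norm _ fun w => rfl
  have : Fact ((2 : ℝ≥0∞) ≠ ∞) := ⟨ENNReal.ofNat_ne_top⟩
  have := isSeparable_of_countablyGenerated
    ((volume : Measure (E n × E n)).restrict Ω.Q)
  have : SecondCountableTopology (Lp ℝ 2 ((volume : Measure (E n × E n)).restrict Ω.Q)) :=
    inferInstance
  have := hiso.isUniformInducing.isInducing.secondCountableTopology
  infer_instance

/-- The value at `x` is compared with the mean over a ball. Expanding the square in `∫ (z x - z y)²`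
and completing the square in `a * z x - 2 * I` gives the real inequality; in the ball `‖x - y‖ ≤ r`,
which brings in the difference quotient. -/
theorem sq_le_setLIntegral_add {z : E n → ℝ} (hz : MemLp z 2 volume) (x : E n) {r : ℝ}
    (hr : 0 < r) (hα : 0 < α) :
    ENNReal.ofReal (volume.real (Metric.ball x r) * |z x| ^ (2 : ℝ)) ≤
      ENNReal.ofReal (2 * r ^ ((n : ℝ) + α)) *
        (∫⁻ y, ‖diffQuot α z (x, y)‖ₑ ^ 2) +
      ENNReal.ofReal (4 * (∫ y in Metric.ball x r, z y) ^ 2 /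
        volume.real (Metric.ball x r)) := by
  set B := Metric.ball x r with hB
  set a := volume.real B with ha
  have hafin : volume B ≠ ⊤ := measure_ball_lt_top.ne
  have ha0 : 0 < a := ENNReal.toReal_pos (Metric.measure_ball_pos _ _ hr).ne' hafin
  have : IsFiniteMeasure (volume.restrict B) := ⟨by simpa using measure_ball_lt_top⟩
  have hz1 : Integrable z (volume.restrict B) :=
    (hz.restrict B).integrable (by norm_num)
  have hz2 : Integrable (fun y => z y ^ 2) (volume.restrict B) := (hz.restrict B).integrable_sq
  set I := ∫ y in B, z y with hI
  have hexp : ∫ y in B, (z x - z y) ^ 2 = a * z x ^ 2 - 2 * z x * I + ∫ y in B, z y ^ 2 := by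
    have h1 : ∀ y, (z x - z y) ^ 2 = z x ^ 2 - 2 * z x * z y + z y ^ 2 := fun y => by ring
    simp only [h1]
    have h2 : Integrable (fun y => z x ^ 2 - 2 * z x * z y) (volume.restrict B) :=
      (integrable_const _).sub (hz1.const_mul _)
    rw [integral_add h2 hz2, integral_sub (integrable_const _) (hz1.const_mul _),
      integral_const_mul, integral_const]
    simp [ha, hI]
  have hint : Integrable (fun y => (z x - z y) ^ 2) (volume.restrict B) := by
    have h1 : ∀ y, (z x - z y) ^ 2 = z x ^ 2 - 2 * z x * z y + z y ^ 2 := fun y => by ring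
    simp only [h1]
    exact ((integrable_const _).sub (hz1.const_mul _)).add hz2
  have hsq : 0 ≤ ∫ y in B, z y ^ 2 := integral_nonneg fun y => sq_nonneg _
  have hreal : a * |z x| ^ (2 : ℝ) ≤ 2 * (∫ y in B, (z x - z y) ^ 2) + 4 * I ^ 2 / a := by
    rw [Real.rpow_two, sq_abs, hexp]
    have h1 : 0 ≤ (a * z x - 2 * I) ^ 2 / a := by positivity
    have h2 : (a * z x - 2 * I) ^ 2 / a = a * z x ^ 2 - 4 * z x * I + 4 * I ^ 2 / a := by
      field_simp
      ring
    rw [h2] at h1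
    linarith
  have hle : ENNReal.ofReal (∫ y in B, (z x - z y) ^ 2) ≤
      ENNReal.ofReal (r ^ ((n : ℝ) + α)) * ∫⁻ y, ‖diffQuot α z (x, y)‖ₑ ^ 2 := by
    rw [ofReal_integral_eq_lintegral_ofReal hint (Eventually.of_forall fun y => sq_nonneg _),
      ← lintegral_const_mul' _ _ ENNReal.ofReal_ne_top]
    refine (setLIntegral_mono' measurableSet_ball fun y hy => ?_).trans
      (setLIntegral_le_lintegral _ _)
    rw [enorm_diffQuot_sq, ← ENNReal.ofReal_mul (by positivity)]
    refine ENNReal.ofReal_le_ofReal ?_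
    dsimp only
    rcases eq_or_ne x y with rfl | hne
    · simp
    · have hxy : 0 < ‖x - y‖ := norm_pos_iff.2 (sub_ne_zero.2 hne)
      have h3 : ‖x - y‖ ^ ((n : ℝ) + α) ≤ r ^ ((n : ℝ) + α) := by
        refine Real.rpow_le_rpow hxy.le ?_ (by positivity)
        rw [← dist_eq_norm, dist_comm]
        exact (Metric.mem_ball.1 hy).le
      have h4 : 0 < ‖x - y‖ ^ ((n : ℝ) + α) := by positivity
      rw [mul_div_assoc', le_div_iff₀ h4, mul_comm]
      gcongr
  refine (ENNReal.ofReal_le_ofReal hreal).trans ?_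
  rw [ENNReal.ofReal_add (by positivity) (by positivity), ENNReal.ofReal_mul two_pos.le,
    ENNReal.ofReal_mul two_pos.le, mul_assoc]
  gcongr

theorem measurable_integral_ball {z : E n → ℝ} (hz : Measurable z) (r : ℝ) :
    Measurable fun x => ∫ y in Metric.ball x r, z y := by
  have h1 : ∀ x, ∫ y in Metric.ball x r, z y =
      ∫ y, (if dist y x < r then z y else 0) := by
    intro x
    rw [← integral_indicator measurableSet_ball]
    rfl
  simp only [h1]
  have h2 : Measurable (Function.uncurry fun (x y : E n) => if dist y x < r then z y else 0) :=
    Measurable.ite (measurableSet_lt (by fun_prop) (by fun_prop)) (by fun_prop) (by fun_prop)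
  exact h2.stronglyMeasurable.integral_prod_right.measurable

variable [NeZero n]

theorem X0.exists_abs_setIntegral_le (hα : 0 < α) {r : ℝ} :
    ∃ C : ℝ, 0 < C ∧ ∀ (x : E n) (w : X0 Ω α), |∫ y in Metric.ball x r, w y| ≤ C * ‖w‖ := by
  obtain ⟨P, hP, h⟩ := X0.poincare (Ω := Ω) hα
  refine ⟨√(volume.real (Metric.ball (0 : E n) r)) * P + 1, by positivity, fun x w => ?_⟩
  have hfin : volume (Metric.ball x r) ≠ ⊤ := measure_ball_lt_top.ne
  rw [← L2.inner_indicatorConstLp_one measurableSet_ball hfin (Y.toL2 (X0.toY w))]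
  refine (abs_real_inner_le_norm _ _).trans ?_
  have h1 : ‖indicatorConstLp (2 : ℝ≥0∞) (measurableSet_ball (x := x) (ε := r)) hfin (1 : ℝ)‖ =
      √(volume.real (Metric.ball (0 : E n) r)) := by
    rw [norm_indicatorConstLp two_ne_zero ENNReal.ofNat_ne_top, norm_one, one_mul,
      Real.sqrt_eq_rpow, Measure.real, Measure.real, Measure.addHaar_ball_center]
    norm_num
  rw [h1]
  have h2 := h w
  have h3 := norm_nonneg w
  have h4 := Real.sqrt_nonneg (volume.real (Metric.ball (0 : E n) r))
  nlinarith [mul_le_mul_of_nonneg_left h2 h4]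

theorem X0.exists_setIntegral_clm (hα : 0 < α) (x : E n) (r : ℝ) :
    ∃ L : X0 Ω α →L[ℝ] ℝ, ∀ w, L w = ∫ y in Metric.ball x r, w y := by
  obtain ⟨C, -, h⟩ := X0.exists_abs_setIntegral_le (Ω := Ω) (r := r) hα
  have hfin : volume (Metric.ball x r) ≠ ⊤ := measure_ball_lt_top.ne
  let L₀ : X0 Ω α →ₗ[ℝ] ℝ :=
    ((innerSL ℝ (indicatorConstLp (2 : ℝ≥0∞) (measurableSet_ball (x := x) (ε := r)) hfin
      (1 : ℝ))).toLinearMap ∘ₗ Y.toL2) ∘ₗ X0.toY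
  have hL₀ : ∀ w, L₀ w = ∫ y in Metric.ball x r, w y := fun w =>
    L2.inner_indicatorConstLp_one measurableSet_ball hfin (Y.toL2 (X0.toY w))
  refine ⟨L₀.mkContinuous C fun w => ?_, fun w => ?_⟩
  · rw [hL₀]
    exact h x w
  · rw [LinearMap.mkContinuous_apply, hL₀]

/-- Dividing the previous inequality by the volume of the ball and integrating over the domain
leaves a factor `r ^ α` in front of the norm, which is small with `r`, and local means, which are
continuous linear functionals. -/
theorem X0.lintegral_rpow_two_le (hα : 0 < α) (w : X0 Ω α) {r : ℝ} (hr : 0 < r) :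
    ∫⁻ x in Ω.carrier, ENNReal.ofReal (|w x| ^ (2 : ℝ)) ≤
      ENNReal.ofReal (2 / volume.real (Metric.ball (0 : E n) 1) * r ^ α * ‖w‖ ^ 2) +
      ∫⁻ x in Ω.carrier, ENNReal.ofReal (4 * (∫ y in Metric.ball x r, w y) ^ 2 /
        volume.real (Metric.ball (0 : E n) r) ^ 2) := by
  set a := volume.real (Metric.ball (0 : E n) r) with ha
  set v := volume.real (Metric.ball (0 : E n) 1) with hv
  have hv0 : 0 < v := ENNReal.toReal_pos (Metric.measure_ball_pos _ _ one_pos).ne'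
    measure_ball_lt_top.ne
  have hav : a = r ^ n * v := by
    rw [ha, Measure.real, Measure.addHaar_ball _ _ hr.le, ENNReal.toReal_mul,
      ENNReal.toReal_ofReal (by positivity), finrank_euclideanSpace_fin]
    rfl
  have ha0 : 0 < a := by rw [hav]; positivity
  have hpt : ∀ x, ENNReal.ofReal (|w x| ^ (2 : ℝ)) ≤
      ENNReal.ofReal (2 / v * r ^ α) * (∫⁻ y, ‖diffQuot α w (x, y)‖ₑ ^ 2) +
      ENNReal.ofReal (4 * (∫ y in Metric.ball x r, w y) ^ 2 / a ^ 2) := by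
    intro x
    have h1 := sq_le_setLIntegral_add (Lp.memLp (Y.toL2 (X0.toY w))) x hr hα
    have hax : volume.real (Metric.ball x r) = a := by
      rw [ha, Measure.real, Measure.real, Measure.addHaar_ball_center]
    rw [hax] at h1
    have h2 := mul_le_mul_right h1 (ENNReal.ofReal a⁻¹)
    rw [mul_add, ← mul_assoc, ← ENNReal.ofReal_mul (by positivity),
      ← ENNReal.ofReal_mul (by positivity), ← ENNReal.ofReal_mul (by positivity),
      inv_mul_cancel_left₀ ha0.ne'] at h2
    convert h2 using 4
    · rw [hav, Real.rpow_add hr, Real.rpow_natCast]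
      field_simp
    · field_simp
  refine (lintegral_mono hpt).trans ?_
  rw [lintegral_add_right, lintegral_const_mul' _ _ ENNReal.ofReal_ne_top]
  · rw [ENNReal.ofReal_mul (p := 2 / v * r ^ α) (by positivity), X0.norm_def]
    gcongr
    have := (X0.toY w).lintegral_lintegral_diffQuot_le univ
    simpa only [Measure.restrict_univ] using this
  · have := measurable_integral_ball (X0.toY w).measurable r
    fun_prop

/-- The radius is fixed first, to make the norm term small uniformly in `k`. For that radius the
means tend to zero at every `x` by weak convergence and are bounded uniformly in `x` and `k`, so
dominated convergence applies on the bounded domain. -/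
theorem X0.tendsto_lintegral_sq (hα : 0 < α) {h : ℕ → X0 Ω α} {M : ℝ} (hM : ∀ k, ‖h k‖ ≤ M)
    (hw : ∀ L : X0 Ω α →L[ℝ] ℝ, Tendsto (fun k => L (h k)) atTop (𝓝 0)) :
    Tendsto (fun k => ∫⁻ x in Ω.carrier, ENNReal.ofReal (|h k x| ^ (2 : ℝ))) atTop (𝓝 0) := by
  set v := volume.real (Metric.ball (0 : E n) 1) with hv
  rw [ENNReal.tendsto_nhds_zero]
  intro ε hε
  have hε2 : 0 < ε / 2 := ENNReal.half_pos hε.ne'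
  have hr : ∃ r : ℝ, 0 < r ∧ ENNReal.ofReal (2 / v * r ^ α * M ^ 2) ≤ ε / 2 := by
    have h1 : Tendsto (fun r : ℝ => ENNReal.ofReal (2 / v * r ^ α * M ^ 2)) (𝓝[>] 0) (𝓝 0) := by
      have h2 : Tendsto (fun r : ℝ => 2 / v * r ^ α * M ^ 2) (𝓝[>] 0)
          (𝓝 (2 / v * 0 * M ^ 2)) :=
        by
        have h3 : Tendsto (fun r : ℝ => r ^ α) (𝓝[>] 0) (𝓝 0) := by
          have := (Real.continuousAt_rpow_const 0 α (Or.inr hα.le)).tendsto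
          rw [Real.zero_rpow hα.ne'] at this
          exact this.mono_left nhdsWithin_le_nhds
        exact (h3.const_mul _).mul_const _
      have h3 := ENNReal.tendsto_ofReal h2
      simpa using h3
    obtain ⟨r, hr1, hr2⟩ :=
      ((ENNReal.tendsto_nhds_zero.1 h1 _ hε2).and self_mem_nhdsWithin).exists
    exact ⟨r, hr2, hr1⟩
  obtain ⟨r, hr0, hr⟩ := hr
  set a := volume.real (Metric.ball (0 : E n) r) with ha
  have hfinΩ : volume Ω.carrier ≠ ⊤ := Ω.isBounded.measure_lt_top.ne
  obtain ⟨C, hC, hCb⟩ := X0.exists_abs_setIntegral_le (Ω := Ω) (r := r) hα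
  have hlim : Tendsto (fun k => ∫⁻ x in Ω.carrier,
      ENNReal.ofReal (4 * (∫ y in Metric.ball x r, h k y) ^ 2 / a ^ 2)) atTop
      (𝓝 (∫⁻ x in Ω.carrier, 0)) := by
    refine tendsto_lintegral_of_dominated_convergence
      (fun _ => ENNReal.ofReal (4 * (C * M) ^ 2 / a ^ 2)) ?_ ?_ ?_ ?_
    · intro k
      have := measurable_integral_ball (X0.toY (h k)).measurable r
      fun_prop
    · intro k
      refine Eventually.of_forall fun x => ENNReal.ofReal_le_ofReal ?_
      have h1 : |∫ y in Metric.ball x r, h k y| ≤ C * M :=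
        (hCb x (h k)).trans (by gcongr; exact hM k)
      rw [← sq_abs (∫ y in Metric.ball x r, h k y)]
      gcongr
    · rw [setLIntegral_const]
      exact ENNReal.mul_ne_top ENNReal.ofReal_ne_top hfinΩ
    · refine Eventually.of_forall fun x => ?_
      obtain ⟨L, hL⟩ := X0.exists_setIntegral_clm (Ω := Ω) hα x r
      have h1 := hw L
      simp only [hL] at h1
      have h2 := ENNReal.tendsto_ofReal (((h1.pow 2).const_mul 4).div_const (a ^ 2))
      simpa using h2
  rw [lintegral_zero, ENNReal.tendsto_nhds_zero] at hlim
  filter_upwards [hlim _ hε2] with k hk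
  calc _ ≤ _ := X0.lintegral_rpow_two_le hα (h k) hr0
    _ ≤ ε / 2 + ε / 2 := by
      gcongr
      refine le_trans (ENNReal.ofReal_le_ofReal ?_) hr
      gcongr
      exact hM k
    _ = ε := ENNReal.add_halves ε

/-- Interpolation between convergence to zero in L² and boundedness in L^q, for some `q` strictly
between `s` and the critical exponent. -/
theorem X0.tendsto_restrict (hα : 0 < α) (hαn : α < n) {s : ℝ} (hs2 : 2 < s)
    (hs : s < 2 * n / (n - α)) [Fact (1 ≤ ENNReal.ofReal s)]
    {S : Y Ω α →L[ℝ] Lp ℝ (ENNReal.ofReal s) Ω.vol} (hS : ∀ z, S z =ᵐ[Ω.vol] z)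
    {h : ℕ → X0 Ω α} {M : ℝ} (hM : ∀ k, ‖h k‖ ≤ M)
    (hw : ∀ L : X0 Ω α →L[ℝ] ℝ, Tendsto (fun k => L (h k)) atTop (𝓝 0)) :
    Tendsto (fun k => S (X0.toY (h k))) atTop (𝓝 0) := by
  have hs0 : 0 < s := by linarith
  obtain ⟨q, hsq, hq⟩ := exists_between hs
  have : Fact (1 ≤ ENNReal.ofReal q) := ⟨by
    rw [← ENNReal.ofReal_one]; exact ENNReal.ofReal_le_ofReal (by linarith)⟩
  obtain ⟨Sq, hSq⟩ := exists_restrict_clm (Ω := Ω) hα hαn (by linarith : 1 ≤ q) hq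
  obtain ⟨C, hC, hJ⟩ := X0.exists_norm_toY_le (Ω := Ω) hα
  set A : ℝ := (‖Sq‖ * (C * M)) ^ q with hA
  have hM0 : 0 ≤ M := (norm_nonneg _).trans (hM 0)
  have hA0 : 0 ≤ A := by positivity
  have hqb : ∀ k, ∫⁻ x in Ω.carrier, ENNReal.ofReal (|h k x| ^ q) ≤ ENNReal.ofReal A := by
    intro k
    have hq0 : 0 < q := by linarith
    rw [← eLpNorm_ofReal_rpow hq0, ← eLpNorm_congr_ae (hSq (X0.toY (h k))),
      ← ENNReal.ofReal_rpow_of_nonneg (by positivity) hq0.le]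
    refine ENNReal.rpow_le_rpow ?_ hq0.le
    rw [← ENNReal.ofReal_toReal (Lp.eLpNorm_ne_top _), ← Lp.norm_def]
    refine ENNReal.ofReal_le_ofReal ((Sq.le_opNorm _).trans ?_)
    gcongr
    exact (hJ _).trans (by gcongr; exact hM k)
  have hsq0 : Tendsto (fun k => ∫⁻ x in Ω.carrier, ENNReal.ofReal (|h k x| ^ s)) atTop (𝓝 0) := by
    rw [ENNReal.tendsto_nhds_zero]
    intro ε hε
    have hε2 : 0 < ε / 2 := ENNReal.half_pos hε.ne'
    obtain ⟨δ, hδ0, hδ⟩ : ∃ δ : ℝ, 0 < δ ∧ ENNReal.ofReal δ * ENNReal.ofReal A ≤ ε / 2 := by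
      have h1 : Tendsto (fun δ : ℝ => ENNReal.ofReal δ * ENNReal.ofReal A) (𝓝[>] 0) (𝓝 0) := by
        have h2 : Tendsto (fun δ : ℝ => ENNReal.ofReal (δ * A)) (𝓝[>] 0)
            (𝓝 (ENNReal.ofReal (0 * A))) :=
          ENNReal.tendsto_ofReal ((tendsto_id.mono_left nhdsWithin_le_nhds).mul_const A)
        simpa [ENNReal.ofReal_mul' hA0] using h2
      obtain ⟨δ, hδ1, hδ2⟩ :=
        ((ENNReal.tendsto_nhds_zero.1 h1 _ hε2).and self_mem_nhdsWithin).exists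
      exact ⟨δ, hδ2, hδ1⟩
    set K := δ ^ (-(s - 2) / (q - s)) with hK
    have hK0 : 0 ≤ K := by positivity
    have h2 := ENNReal.Tendsto.const_mul (a := ENNReal.ofReal K)
      (X0.tendsto_lintegral_sq hα hM hw) (Or.inr ENNReal.ofReal_ne_top)
    rw [mul_zero, ENNReal.tendsto_nhds_zero] at h2
    filter_upwards [h2 _ hε2] with k hk
    have hmeas := (X0.toY (h k)).measurable
    calc ∫⁻ x in Ω.carrier, ENNReal.ofReal (|h k x| ^ s)
        ≤ ∫⁻ x in Ω.carrier, (ENNReal.ofReal δ * ENNReal.ofReal (|h k x| ^ q) +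
          ENNReal.ofReal K * ENNReal.ofReal (|h k x| ^ (2 : ℝ))) := by
          refine lintegral_mono fun x => ?_
          rw [← ENNReal.ofReal_mul hδ0.le, ← ENNReal.ofReal_mul hK0,
            ← ENNReal.ofReal_add (by positivity) (by positivity)]
          exact ENNReal.ofReal_le_ofReal
            (rpow_le_mul_rpow_add_mul_sq hs2 hsq hδ0 (abs_nonneg _))
      _ ≤ ENNReal.ofReal δ * ENNReal.ofReal A + ε / 2 := by
          rw [lintegral_add_left (by fun_prop), lintegral_const_mul' _ _ ENNReal.ofReal_ne_top,
            lintegral_const_mul' _ _ ENNReal.ofReal_ne_top]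
          gcongr
          exact hqb k
      _ ≤ ε / 2 + ε / 2 := by gcongr
      _ = ε := ENNReal.add_halves ε
  rw [tendsto_zero_iff_norm_tendsto_zero]
  have h1 : ∀ k, ‖S (X0.toY (h k))‖ =
      ((∫⁻ x in Ω.carrier, ENNReal.ofReal (|h k x| ^ s)) ^ (1 / s)).toReal := by
    intro k
    rw [← eLpNorm_ofReal_rpow hs0, ← ENNReal.rpow_mul, mul_one_div_cancel hs0.ne',
      ENNReal.rpow_one, Lp.norm_def, eLpNorm_congr_ae (hS _)]
  simp only [h1]
  have h2 := (ENNReal.continuous_rpow_const (y := 1 / s)).tendsto 0 |>.comp hsq0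
  rw [ENNReal.zero_rpow_of_pos (by positivity)] at h2
  exact (ENNReal.tendsto_toReal ENNReal.zero_ne_top).comp h2

end FracLap

/-! ### Nontriviality of `X0` -/

namespace FracLap

variable {n m : ℕ} {Ω : BoundedLipschitzDomain n} {α : ℝ}

/-- In polar coordinates the integrand is at most `t ^ (1 - α)` near zero, integrable because `α <
2`, and a multiple of `t ^ (-1 - α)` at infinity, integrable because `0 < α`. -/
theorem lintegral_min_sq_div_rpow_lt_top [NeZero n] (hα₀ : 0 < α) (hα₂ : α < 2) (ρ : ℝ) :
    ∫⁻ h : E n, ENNReal.ofReal (min (‖h‖ ^ 2) (ρ ^ 2) / ‖h‖ ^ ((n : ℝ) + α)) < ⊤ := by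
  have : Nonempty (Fin n) := ⟨⟨0, Nat.pos_of_ne_zero (NeZero.ne n)⟩⟩
  have hn1 : 1 ≤ n := Nat.one_le_iff_ne_zero.2 (NeZero.ne n)
  let f : ℝ → ℝ := fun t => min (t ^ 2) (ρ ^ 2) / t ^ ((n : ℝ) + α)
  have hpow : ∀ t : ℝ, 0 < t → t ^ (n - 1) / t ^ ((n : ℝ) + α) = t ^ (-1 - α) := by
    intro t ht
    rw [← Real.rpow_natCast, ← Real.rpow_sub ht]
    congr 1
    push_cast [Nat.cast_sub hn1]
    ring
  have hmeas : Measurable fun t : ℝ => t ^ (n - 1) • f t := by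
    simp only [f]
    fun_prop
  have hint : IntegrableOn (fun t : ℝ => t ^ (n - 1) • f t) (Ioi 0) := by
    rw [← Ioc_union_Ioi_eq_Ioi zero_le_one]
    refine IntegrableOn.union ?_ ?_
    · have h1 : IntegrableOn (fun t : ℝ => t ^ (1 - α)) (Ioc 0 1) :=
        (intervalIntegrable_iff_integrableOn_Ioc_of_le zero_le_one).1
          (intervalIntegral.intervalIntegrable_rpow' (by linarith))
      refine h1.mono' hmeas.aestronglyMeasurable ?_
      filter_upwards [ae_restrict_mem measurableSet_Ioc] with t ht
      have ht0 : 0 < t := ht.1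
      have h2 : t ^ (n - 1) • f t = t ^ (-1 - α) * min (t ^ 2) (ρ ^ 2) := by
        rw [← hpow t ht0, smul_eq_mul]
        simp only [f]
        ring
      rw [h2, Real.norm_eq_abs, abs_of_nonneg (by positivity)]
      calc t ^ (-1 - α) * min (t ^ 2) (ρ ^ 2) ≤ t ^ (-1 - α) * t ^ 2 := by
            gcongr; exact min_le_left _ _
        _ = t ^ (1 - α) := by
            rw [← Real.rpow_natCast, ← Real.rpow_add ht0]
            congr 1
            push_cast
            ring
    · have h1 : IntegrableOn (fun t : ℝ => t ^ (-1 - α) * ρ ^ 2) (Ioi 1) :=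
        (integrableOn_Ioi_rpow_of_lt (by linarith) one_pos).mul_const _
      refine h1.mono' hmeas.aestronglyMeasurable ?_
      filter_upwards [ae_restrict_mem measurableSet_Ioi] with t ht
      have ht0 : 0 < t := zero_lt_one.trans ht
      have h2 : t ^ (n - 1) • f t = t ^ (-1 - α) * min (t ^ 2) (ρ ^ 2) := by
        rw [← hpow t ht0, smul_eq_mul]
        simp only [f]
        ring
      rw [h2, Real.norm_eq_abs, abs_of_nonneg (by positivity)]
      gcongr
      exact min_le_right _ _
  have hI : Integrable (fun h : E n => f ‖h‖) volume := by
    rw [integrable_fun_norm_addHaar]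
    simpa using hint
  exact hI.lintegral_lt_top

theorem memX_of_lipschitz_of_support [NeZero n] (hα₀ : 0 < α) (hα₂ : α < 2) {f : E n → ℝ}
    (hf : LipschitzWith 1 f) {ρ : ℝ} (hf0 : ∀ x, 0 ≤ f x) (hfρ : ∀ x, f x ≤ ρ) :
    MemX Ω α f := by
  have hfm : Measurable f := hf.continuous.measurable
  have hfin : volume Ω.carrier ≠ ⊤ := Ω.isBounded.measure_lt_top.ne
  have : IsFiniteMeasure Ω.vol := ⟨by simpa using Ω.isBounded.measure_lt_top⟩
  refine ⟨MemLp.of_bound hfm.aestronglyMeasurable ρ (Eventually.of_forall fun x => ?_), ?_⟩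
  · rw [Real.norm_eq_abs, abs_of_nonneg (hf0 x)]
    exact hfρ x
  have hdm : Measurable (diffQuot α f) := measurable_diffQuot hfm
  refine ⟨hdm.aestronglyMeasurable, ?_⟩
  set k : E n → ℝ≥0∞ := fun h =>
    ENNReal.ofReal (min (‖h‖ ^ 2) (ρ ^ 2) / ‖h‖ ^ ((n : ℝ) + α)) with hk
  have hkm : Measurable k := by simp only [hk]; fun_prop
  have hkfin := lintegral_min_sq_div_rpow_lt_top (n := n) hα₀ hα₂ ρ
  have hpt : ∀ p : E n × E n, ‖diffQuot α f p‖ₑ ^ 2 ≤ k (p.1 - p.2) := by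
    intro p
    rw [enorm_diffQuot_sq]
    refine ENNReal.ofReal_le_ofReal ?_
    gcongr
    refine le_min ?_ ?_
    · have := hf.dist_le_mul p.1 p.2
      rw [dist_eq_norm, dist_eq_norm, NNReal.coe_one, one_mul, Real.norm_eq_abs] at this
      rw [← sq_abs]
      gcongr
    · exact sq_le_sq' (by linarith [hf0 p.1, hfρ p.2]) (by linarith [hf0 p.2, hfρ p.1])
  have hswap : ∀ h, k (-h) = k h := fun h => by simp [hk]
  have hone : ∫⁻ p in Ω.carrier ×ˢ (univ : Set (E n)), k (p.1 - p.2) < ⊤ := by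
    rw [Measure.volume_eq_prod, ← Measure.prod_restrict, Measure.restrict_univ,
      lintegral_prod _ (by fun_prop)]
    have h1 : ∀ x : E n, ∫⁻ y, k (x - y) = ∫⁻ y, k y := fun x =>
      lintegral_sub_left_eq_self k x
    simp only [h1, lintegral_const]
    exact ENNReal.mul_lt_top hkfin (by simpa using Ω.isBounded.measure_lt_top)
  have htwo : ∫⁻ p in (univ : Set (E n)) ×ˢ Ω.carrier, k (p.1 - p.2) < ⊤ := by
    rw [Measure.volume_eq_prod, ← Measure.prod_restrict, Measure.restrict_univ,
      lintegral_prod_symm _ (by fun_prop)]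
    have h1 : ∀ y : E n, ∫⁻ x, k (x - y) = ∫⁻ x, k x := fun y =>
      lintegral_sub_right_eq_self k y
    simp only [h1, lintegral_const]
    exact ENNReal.mul_lt_top hkfin (by simpa using Ω.isBounded.measure_lt_top)
  -- One of the two points of a pair in `Q` lies in the bounded domain. Integrating over the other
  -- variable first, by translation invariance, reduces the form to the kernel integral times the
  -- volume of the domain.
  have hQ : Ω.Q ⊆ Ω.carrier ×ˢ univ ∪ univ ×ˢ Ω.carrier := by
    intro p hp
    by_contra hcon
    simp only [mem_union, mem_prod, mem_univ, and_true, true_and, not_or] at hcon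
    exact hp ⟨hcon.1, hcon.2⟩
  have hlt : ∫⁻ p in Ω.Q, ‖diffQuot α f p‖ₑ ^ 2 < ⊤ :=
    calc ∫⁻ p in Ω.Q, ‖diffQuot α f p‖ₑ ^ 2
        ≤ ∫⁻ p in Ω.carrier ×ˢ univ ∪ univ ×ˢ Ω.carrier, k (p.1 - p.2) :=
          (lintegral_mono hpt).trans (lintegral_mono_set hQ)
      _ ≤ _ := lintegral_union_le _ _ _
      _ < ⊤ := ENNReal.add_lt_top.2 ⟨hone, htwo⟩
  have h := eLpNorm_nnreal_pow_eq_lintegral (f := diffQuot α f)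
    (μ := volume.restrict Ω.Q) (p := 2) two_ne_zero
  by_contra hcon
  rw [not_lt, top_le_iff] at hcon
  simp only [ENNReal.coe_ofNat, NNReal.coe_ofNat, ENNReal.rpow_ofNat] at h
  rw [hcon] at h
  rw [← h] at hlt
  simp at hlt

theorem X0.exists_ne_zero [NeZero n] (hα₀ : 0 < α) (hα₂ : α < 2) : ∃ w : X0 Ω α, w ≠ 0 := by
  obtain ⟨x₀, hx₀⟩ := Ω.isConnected.nonempty
  obtain ⟨ρ, hρ, hb⟩ := Metric.isOpen_iff.1 Ω.isOpen x₀ hx₀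
  -- A cone supported in a ball inside the domain: Lipschitz, bounded and nonzero at the centre.
  let f : E n → ℝ := fun x => max 0 (ρ - dist x x₀)
  have hf : LipschitzWith 1 f := by
    refine (LipschitzWith.of_dist_le_mul fun x y => ?_).const_max 0
    rw [Real.dist_eq, NNReal.coe_one, one_mul, sub_sub_sub_cancel_left, abs_sub_comm]
    exact abs_dist_sub_le x y x₀
  have hf0 : ∀ x, 0 ≤ f x := fun x => le_max_left _ _
  have hfρ : ∀ x, f x ≤ ρ := fun x => max_le hρ.le (by linarith [dist_nonneg (x := x) (y := x₀)])
  have hfX : MemX Ω α f := memX_of_lipschitz_of_support hα₀ hα₂ hf hf0 hfρ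
  have hsupp : ∀ x, x ∉ Ω.carrier → f x = 0 := by
    intro x hx
    refine max_eq_left ?_
    by_contra! hcon
    exact hx (hb (by rw [Metric.mem_ball]; linarith))
  have hcs : HasCompactSupport f := HasCompactSupport.of_support_subset_isCompact
    Ω.isBounded.isCompact_closure fun x hx => subset_closure (by_contra fun h => hx (hsupp x h))
  have hfL : MemLp f 2 volume := hf.continuous.memLp_of_hasCompactSupport hcs
  have hco : (hfL.toLp f : E n → ℝ) =ᵐ[volume] f := hfL.coeFn_toLp
  have hY : MemX Ω α (hfL.toLp f) :=
    ⟨(memLp_congr_ae (ae_restrict_of_ae hco)).2 hfX.1,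
      (memLp_congr_ae (diffQuot_congr Ω α hco)).2 hfX.2⟩
  have hX : ∀ᵐ x ∂(volume.restrict Ω.carrierᶜ), (hfL.toLp f) x = 0 := by
    filter_upwards [ae_restrict_of_ae hco, ae_restrict_mem Ω.isOpen.measurableSet.compl]
      with x h1 h2
    rw [h1, hsupp x h2]
  refine ⟨⟨⟨hfL.toLp f, hY⟩, hX⟩, fun h0 => ?_⟩
  have h1 : hfL.toLp f = 0 := congrArg (fun w : X0 Ω α => Y.toL2 (X0.toY w)) h0
  rw [Lp.eq_zero_iff_ae_eq_zero] at h1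
  have h2 : f =ᵐ[volume] fun _ => (0 : ℝ) := hco.symm.trans h1
  have h3 := (hf.continuous.ae_eq_iff_eq volume continuous_const).1 h2
  have h4 := congrFun h3 x₀
  simp only [f, dist_self, sub_zero] at h4
  rw [max_eq_right hρ.le] at h4
  exact hρ.ne' h4

end FracLap

/-! ### Superposition operators of subcritical growth on `L^s` of a finite measure space -/

theorem rpow_add_le_two_rpow_mul {a b s : ℝ} (ha : 0 ≤ a) (hb : 0 ≤ b) (hs : 0 ≤ s) :
    (a + b) ^ s ≤ 2 ^ s * (a ^ s + b ^ s) := by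
  have h1 : (a + b) ^ s ≤ (2 * max a b) ^ s :=
    Real.rpow_le_rpow (by positivity) (by linarith [le_max_left a b, le_max_right a b]) hs
  have h2 : (max a b) ^ s ≤ a ^ s + b ^ s := by
    have ha' : 0 ≤ a ^ s := by positivity
    have hb' : 0 ≤ b ^ s := by positivity
    rcases le_total a b with h | h
    · rw [max_eq_right h]; linarith
    · rw [max_eq_left h]; linarith
  rw [Real.mul_rpow two_pos.le (le_max_of_le_left ha)] at h1
  exact h1.trans (by gcongr)

theorem rpow_conj_le_of_growth {s s' c a t : ℝ} (hs : s.HolderConjugate s') (hc : 0 ≤ c)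
    (ha : 0 ≤ a) (ht : 0 ≤ t) (h : a ≤ c * (1 + t ^ (s - 1))) :
    a ^ s' ≤ (2 * c) ^ s' * (1 + t ^ s) := by
  have h0 : 0 < s' := hs.symm.pos
  have h1 : a ≤ 2 * c * max 1 (t ^ (s - 1)) := by
    nlinarith [le_max_left 1 (t ^ (s - 1)), le_max_right 1 (t ^ (s - 1))]
  have h2 := Real.rpow_le_rpow ha h1 h0.le
  rw [Real.mul_rpow (by positivity) (by positivity)] at h2
  refine h2.trans ?_
  gcongr
  have hts : 0 ≤ t ^ s := by positivity
  rcases le_total 1 (t ^ (s - 1)) with h3 | h3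
  · rw [max_eq_right h3, ← Real.rpow_mul ht, hs.sub_one_mul_conj]
    linarith
  · rw [max_eq_left h3, Real.one_rpow]
    linarith

section

variable {X : Type*} [MeasurableSpace X] {μ : Measure X}

theorem ofReal_rpow_conj_le_of_growth {s s' c a t : ℝ} (hs : s.HolderConjugate s') (hc : 0 ≤ c)
    (h : |a| ≤ c * (1 + |t| ^ (s - 1))) :
    ENNReal.ofReal (|a| ^ s') ≤
      ENNReal.ofReal ((2 * c) ^ s') * (1 + ENNReal.ofReal (|t| ^ s)) := by
  rw [← ENNReal.ofReal_one, ← ENNReal.ofReal_add zero_le_one (by positivity),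
    ← ENNReal.ofReal_mul (by positivity)]
  exact ENNReal.ofReal_le_ofReal (rpow_conj_le_of_growth hs hc (abs_nonneg _) (abs_nonneg _) h)

theorem lintegral_ofReal_rpow_Lp {s : ℝ} (hs : 0 < s) [Fact (1 ≤ ENNReal.ofReal s)]
    (z : Lp ℝ (ENNReal.ofReal s) μ) :
    ∫⁻ x, ENNReal.ofReal (|z x| ^ s) ∂μ = ENNReal.ofReal (‖z‖ ^ s) := by
  rw [← FracLap.eLpNorm_ofReal_rpow hs, ← ENNReal.ofReal_rpow_of_nonneg (norm_nonneg _) hs.le,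
    Lp.norm_def, ENNReal.ofReal_toReal (Lp.eLpNorm_ne_top _)]

/-- Vanishing of `ρ x` at zero is assumed only as a limit, with no continuity elsewhere, so the same
statement serves for increments of the derivative and for remainder quotients. It is dominated
convergence along almost everywhere convergent subsequences. -/
theorem tendsto_eLpNorm_superposition [IsFiniteMeasure μ] {s s' : ℝ} (hs : s.HolderConjugate s')
    [Fact (1 ≤ ENNReal.ofReal s)] {ρ : X → ℝ → ℝ} {y : Lp ℝ (ENNReal.ofReal s) μ} {c : ℝ}
    (hc : 0 ≤ c) (hρ : ∀ᵐ x ∂μ, ∀ t, |ρ x t| ≤ c * (1 + (|y x| + |t|) ^ (s - 1)))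
    (hρ0 : ∀ᵐ x ∂μ, Tendsto (ρ x) (𝓝 0) (𝓝 0)) {h : ℕ → Lp ℝ (ENNReal.ofReal s) μ}
    (hm : ∀ k, AEMeasurable (fun x => ρ x (h k x)) μ) (hh : Tendsto h atTop (𝓝 0)) :
    Tendsto (fun k => eLpNorm (fun x => ρ x (h k x)) (ENNReal.ofReal s') μ) atTop (𝓝 0) := by
  have hs0 : 0 < s := hs.pos
  have hs'0 : 0 < s' := hs.symm.pos
  refine tendsto_of_subseq_tendsto fun ns hns => ?_
  have hh1 := hh.comp hns
  obtain ⟨φ, hφ, hφ0⟩ := (tendstoInMeasure_of_tendsto_Lp hh1).exists_seq_tendsto_ae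
  refine ⟨φ, ?_⟩
  have hh2 : Tendsto (fun k => h (ns (φ k))) atTop (𝓝 0) := hh1.comp hφ.tendsto_atTop
  set K : ℝ := (2 * c) ^ s' with hK
  have hK0 : 0 ≤ K := by positivity
  set f : ℕ → X → ℝ≥0∞ := fun k x => ENNReal.ofReal (|ρ x (h (ns (φ k)) x)| ^ s') with hf
  -- The majorant has a fixed integrable part `B` and a moving part `b k` whose integral tends to
  -- zero. Dominated convergence is applied to the truncated difference `f k - b k`, which is at
  -- most `B`.
  set b : ℕ → X → ℝ≥0∞ := fun k x =>
    ENNReal.ofReal (K * 2 ^ s) * ENNReal.ofReal (|h (ns (φ k)) x| ^ s) with hb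
  set B : X → ℝ≥0∞ := fun x =>
    ENNReal.ofReal K + ENNReal.ofReal (K * 2 ^ s) * ENNReal.ofReal (|y x| ^ s) with hB
  have hfm : ∀ k, AEMeasurable (f k) μ := fun k => by
    have h1 : AEMeasurable (fun x => |ρ x (h (ns (φ k)) x)|) μ := (hm (ns (φ k))).abs
    exact (h1.pow_const s').ennreal_ofReal
  have hbm : ∀ k, AEMeasurable (b k) μ := fun k => by
    have := (Lp.stronglyMeasurable (h (ns (φ k)))).measurable
    simp only [hb]
    fun_prop
  have hfb : ∀ k, ∀ᵐ x ∂μ, f k x ≤ B x + b k x := by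
    intro k
    filter_upwards [hρ] with x hx
    have h1 := rpow_conj_le_of_growth hs hc (abs_nonneg _) (by positivity) (hx (h (ns (φ k)) x))
    have h2 := rpow_add_le_two_rpow_mul (abs_nonneg (y x)) (abs_nonneg (h (ns (φ k)) x)) hs0.le
    simp only [hf, hB, hb]
    rw [← ENNReal.ofReal_mul (by positivity), ← ENNReal.ofReal_mul (by positivity),
      ← ENNReal.ofReal_add (by positivity) (by positivity),
      ← ENNReal.ofReal_add (by positivity) (by positivity)]
    refine ENNReal.ofReal_le_ofReal (h1.trans ?_)
    nlinarith [mul_le_mul_of_nonneg_left h2 hK0]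
  have hlim1 : Tendsto (fun k => ∫⁻ x, (f k x - b k x) ∂μ) atTop (𝓝 (∫⁻ _, 0 ∂μ)) := by
    refine tendsto_lintegral_of_dominated_convergence' B (fun k => (hfm k).sub (hbm k)) ?_ ?_ ?_
    · intro k
      filter_upwards [hfb k] with x hx
      exact tsub_le_iff_right.2 hx
    · simp only [hB]
      rw [lintegral_add_left measurable_const, lintegral_const_mul' _ _ ENNReal.ofReal_ne_top,
        lintegral_ofReal_rpow_Lp hs0, lintegral_const]
      exact ENNReal.add_ne_top.2 ⟨ENNReal.mul_ne_top ENNReal.ofReal_ne_top (measure_ne_top _ _),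
        ENNReal.mul_ne_top ENNReal.ofReal_ne_top ENNReal.ofReal_ne_top⟩
    · filter_upwards [hφ0, hρ0, Lp.coeFn_zero ℝ (ENNReal.ofReal s) μ] with x hx1 hx2 hx3
      rw [hx3] at hx1
      have h1 : Tendsto (fun k => ρ x (h (ns (φ k)) x)) atTop (𝓝 0) := hx2.comp hx1
      have h2 : Tendsto (fun k => f k x) atTop (𝓝 0) := by
        have h3 := ENNReal.tendsto_ofReal
          ((Real.continuousAt_rpow_const 0 s' (Or.inr hs'0.le)).tendsto.comp (by simpa using h1.abs))
        rw [Real.zero_rpow hs'0.ne', ENNReal.ofReal_zero] at h3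
        exact h3
      exact tendsto_of_tendsto_of_tendsto_of_le_of_le tendsto_const_nhds h2 (fun _ => zero_le)
        (fun _ => tsub_le_self)
  have hlim2 : Tendsto (fun k => ∫⁻ x, b k x ∂μ) atTop (𝓝 0) := by
    have h1 : ∀ k, ∫⁻ x, b k x ∂μ =
        ENNReal.ofReal (K * 2 ^ s) * ENNReal.ofReal (‖h (ns (φ k))‖ ^ s) := by
      intro k
      simp only [hb]
      rw [lintegral_const_mul' _ _ ENNReal.ofReal_ne_top, lintegral_ofReal_rpow_Lp hs0]
    simp only [h1]
    have h2 : Tendsto (fun k => ‖h (ns (φ k))‖ ^ s) atTop (𝓝 0) := by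
      have h3 := (Real.continuousAt_rpow_const 0 s (Or.inr hs0.le)).tendsto.comp
        (by simpa using hh2.norm)
      rwa [Real.zero_rpow hs0.ne'] at h3
    simpa using ENNReal.Tendsto.const_mul (a := ENNReal.ofReal (K * 2 ^ s))
      (ENNReal.tendsto_ofReal h2) (Or.inr ENNReal.ofReal_ne_top)
  have hlim3 : Tendsto (fun k => ∫⁻ x, f k x ∂μ) atTop (𝓝 0) := by
    rw [lintegral_zero] at hlim1
    have h1 := hlim1.add hlim2
    rw [add_zero] at h1
    refine tendsto_of_tendsto_of_tendsto_of_le_of_le tendsto_const_nhds h1 (fun _ => zero_le)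
      fun k => ?_
    dsimp only
    rw [← lintegral_add_right' _ (hbm k)]
    exact lintegral_mono fun x => le_tsub_add
  have h1 : ∀ k, eLpNorm (fun x => ρ x (h (ns (φ k)) x)) (ENNReal.ofReal s') μ =
      (∫⁻ x, f k x ∂μ) ^ (1 / s') := by
    intro k
    simp only [hf]
    rw [← FracLap.eLpNorm_ofReal_rpow hs'0, ← ENNReal.rpow_mul, mul_one_div_cancel hs'0.ne',
      ENNReal.rpow_one]
  simp only [h1]
  have h2 := (ENNReal.continuous_rpow_const (y := 1 / s')).tendsto 0 |>.comp hlim3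
  rwa [ENNReal.zero_rpow_of_pos (by positivity)] at h2

/-- `g` and its derivative `gz` in the second variable define superposition operators of growth
`s` and `s - 1`. -/
structure SubcriticalPair (μ : Measure X) (s c : ℝ) (g gz : X → ℝ → ℝ) : Prop where
  nonneg : 0 ≤ c
  meas : ∀ z : X → ℝ, Measurable z → AEMeasurable (fun x => g x (z x)) μ
  meas_deriv : ∀ z : X → ℝ, Measurable z → AEMeasurable (fun x => gz x (z x)) μ
  hasDerivAt : ∀ᵐ x ∂μ, ∀ t, HasDerivAt (g x) (gz x t) t
  continuous_deriv : ∀ᵐ x ∂μ, Continuous (gz x)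
  growth : ∀ᵐ x ∂μ, ∀ t, |g x t| ≤ c * (1 + |t| ^ s)
  growth_deriv : ∀ᵐ x ∂μ, ∀ t, |gz x t| ≤ c * (1 + |t| ^ (s - 1))

variable {s s' c : ℝ} {g gz : X → ℝ → ℝ}

theorem SubcriticalPair.abs_sub_le (h : SubcriticalPair μ s c g gz) (hs : 1 ≤ s) :
    ∀ᵐ x ∂μ, ∀ y t : ℝ, |g x (y + t) - g x y| ≤ c * (1 + (|y| + |t|) ^ (s - 1)) * |t| := by
  have hc := h.nonneg
  filter_upwards [h.hasDerivAt, h.growth_deriv] with x hx1 hx2 y t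
  have h1 := (convex_closedBall (0 : ℝ) (|y| + |t|)).norm_image_sub_le_of_norm_hasDerivWithin_le
    (f := g x) (f' := gz x) (C := c * (1 + (|y| + |t|) ^ (s - 1))) (x := y) (y := y + t)
    (fun τ _ => (hx1 τ).hasDerivWithinAt) (fun τ hτ => ?_) ?_ ?_
  · simpa [add_sub_cancel_left] using h1
  · rw [mem_closedBall_zero_iff, Real.norm_eq_abs] at hτ
    rw [Real.norm_eq_abs]
    refine (hx2 τ).trans ?_
    have := Real.rpow_le_rpow (abs_nonneg τ) hτ (by linarith : 0 ≤ s - 1)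
    gcongr
  · rw [mem_closedBall_zero_iff, Real.norm_eq_abs]
    linarith [abs_nonneg t]
  · rw [mem_closedBall_zero_iff, Real.norm_eq_abs]
    exact abs_add_le y t

variable [IsFiniteMeasure μ] [Fact (1 ≤ ENNReal.ofReal s)]

theorem SubcriticalPair.lintegral_deriv_le (hs : s.HolderConjugate s')
    (h : SubcriticalPair μ s c g gz) (z : Lp ℝ (ENNReal.ofReal s) μ) :
    ∫⁻ x, ENNReal.ofReal (|gz x (z x)| ^ s') ∂μ ≤
      ENNReal.ofReal ((2 * c) ^ s' * (μ.real univ + ‖z‖ ^ s)) := by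
  have hc := h.nonneg
  calc ∫⁻ x, ENNReal.ofReal (|gz x (z x)| ^ s') ∂μ
      ≤ ∫⁻ x, ENNReal.ofReal ((2 * c) ^ s') * (1 + ENNReal.ofReal (|z x| ^ s)) ∂μ := by
        refine lintegral_mono_ae ?_
        filter_upwards [h.growth_deriv] with x hx
        exact ofReal_rpow_conj_le_of_growth hs hc (hx _)
    _ = _ := by
        rw [lintegral_const_mul' _ _ ENNReal.ofReal_ne_top, lintegral_add_left measurable_const,
          lintegral_ofReal_rpow_Lp hs.pos, lintegral_const, one_mul,
          ENNReal.ofReal_mul (by positivity), ENNReal.ofReal_add (by positivity) (by positivity),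
          ofReal_measureReal]

theorem SubcriticalPair.memLp_deriv (hs : s.HolderConjugate s')
    (h : SubcriticalPair μ s c g gz) (z : Lp ℝ (ENNReal.ofReal s) μ) :
    MemLp (fun x => gz x (z x)) (ENNReal.ofReal s') μ ∧
      (eLpNorm (fun x => gz x (z x)) (ENNReal.ofReal s') μ).toReal ≤
        ((2 * c) ^ s' * (μ.real univ + ‖z‖ ^ s)) ^ (1 / s') := by
  have hc := h.nonneg
  exact FracLap.memLp_ofReal_of_lintegral_le hs.symm.pos
    (h.meas_deriv _ (Lp.stronglyMeasurable z).measurable).aestronglyMeasurable (by positivity)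
    (h.lintegral_deriv_le hs z)

theorem SubcriticalPair.integrable (hs : s.HolderConjugate s')
    (h : SubcriticalPair μ s c g gz) (z : Lp ℝ (ENNReal.ofReal s) μ) :
    Integrable (fun x => g x (z x)) μ := by
  refine ⟨(h.meas _ (Lp.stronglyMeasurable z).measurable).aestronglyMeasurable, ?_⟩
  have hc := h.nonneg
  calc ∫⁻ x, ‖g x (z x)‖ₑ ∂μ
      ≤ ∫⁻ x, ENNReal.ofReal c * (1 + ENNReal.ofReal (|z x| ^ s)) ∂μ := by
        refine lintegral_mono_ae ?_
        filter_upwards [h.growth] with x hx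
        rw [← ofReal_norm, Real.norm_eq_abs, ← ENNReal.ofReal_one,
          ← ENNReal.ofReal_add zero_le_one (by positivity), ← ENNReal.ofReal_mul hc]
        exact ENNReal.ofReal_le_ofReal (hx _)
    _ < ⊤ := by
        rw [lintegral_const_mul' _ _ ENNReal.ofReal_ne_top, lintegral_add_left measurable_const,
          lintegral_ofReal_rpow_Lp hs.pos, lintegral_const, one_mul]
        exact ENNReal.mul_lt_top ENNReal.ofReal_lt_top
          (ENNReal.add_lt_top.2 ⟨measure_lt_top _ _, ENNReal.ofReal_lt_top⟩)

theorem SubcriticalPair.tendsto_deriv (hs : s.HolderConjugate s')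
    (h : SubcriticalPair μ s c g gz) (y : Lp ℝ (ENNReal.ofReal s) μ)
    {k : ℕ → Lp ℝ (ENNReal.ofReal s) μ} (hk : Tendsto k atTop (𝓝 0)) :
    Tendsto (fun j => eLpNorm (fun x => gz x (y x + k j x) - gz x (y x)) (ENNReal.ofReal s') μ)
      atTop (𝓝 0) := by
  have hs1 : 0 ≤ s - 1 := hs.sub_one_pos.le
  have hc := h.nonneg
  have hym := (Lp.stronglyMeasurable y).measurable
  refine tendsto_eLpNorm_superposition hs (ρ := fun x t => gz x (y x + t) - gz x (y x))
    (c := 2 * c) (y := y) (by positivity) ?_ ?_ (fun j => ?_) hk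
  · filter_upwards [h.growth_deriv] with x hx t
    have h1 : |y x + t| ^ (s - 1) ≤ (|y x| + |t|) ^ (s - 1) :=
      Real.rpow_le_rpow (abs_nonneg _) (abs_add_le _ _) hs1
    have h2 : |y x| ^ (s - 1) ≤ (|y x| + |t|) ^ (s - 1) :=
      Real.rpow_le_rpow (abs_nonneg _) (by linarith [abs_nonneg t]) hs1
    have h3 := _root_.abs_sub (gz x (y x + t)) (gz x (y x))
    have h4 := hx (y x + t)
    have h5 := hx (y x)
    nlinarith
  · filter_upwards [h.continuous_deriv] with x hx
    have h1 : Continuous fun t => gz x (y x + t) - gz x (y x) := by fun_prop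
    simpa using h1.tendsto 0
  · have hkm := (Lp.stronglyMeasurable (k j)).measurable
    exact (h.meas_deriv _ (hym.add hkm)).sub (h.meas_deriv _ hym)

/-- The Taylor remainder divided by the increment is itself a superposition operator in the
increment, with growth `s - 1` by the mean value bound `abs_sub_le`. At a zero increment the
quotient is zero by the convention on division, which is harmless since the remainder vanishes there
too. -/
theorem SubcriticalPair.tendsto_slope (hs : s.HolderConjugate s')
    (h : SubcriticalPair μ s c g gz) (y : Lp ℝ (ENNReal.ofReal s) μ)
    {k : ℕ → Lp ℝ (ENNReal.ofReal s) μ} (hk : Tendsto k atTop (𝓝 0)) :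
    Tendsto (fun j => eLpNorm (fun x => (g x (y x + k j x) - g x (y x) - gz x (y x) * k j x) / k j x)
      (ENNReal.ofReal s') μ) atTop (𝓝 0) := by
  have hs1 : 0 ≤ s - 1 := hs.sub_one_pos.le
  have hc := h.nonneg
  have hym := (Lp.stronglyMeasurable y).measurable
  refine tendsto_eLpNorm_superposition hs
    (ρ := fun x t => (g x (y x + t) - g x (y x) - gz x (y x) * t) / t)
    (c := 2 * c) (y := y) (by positivity) ?_ ?_ (fun j => ?_) hk
  · filter_upwards [h.growth_deriv, h.abs_sub_le (by linarith)] with x hx hx1 t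
    rcases eq_or_ne t 0 with rfl | ht
    · simp only [div_zero, abs_zero]
      positivity
    have ht' : 0 < |t| := abs_pos.2 ht
    rw [abs_div, div_le_iff₀ ht']
    have h2 : |y x| ^ (s - 1) ≤ (|y x| + |t|) ^ (s - 1) :=
      Real.rpow_le_rpow (abs_nonneg _) (by linarith) hs1
    have h3 := _root_.abs_sub (g x (y x + t) - g x (y x)) (gz x (y x) * t)
    have h4 := hx1 (y x) t
    have h5 := hx (y x)
    rw [abs_mul] at h3
    have h6 : |gz x (y x)| * |t| ≤ c * (1 + (|y x| + |t|) ^ (s - 1)) * |t| := by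
      gcongr
      exact h5.trans (by gcongr)
    linarith
  · filter_upwards [h.hasDerivAt] with x hx
    have h1 := hasDerivAt_iff_isLittleO_nhds_zero.1 (hx (y x))
    refine (h1.tendsto_div_nhds_zero).congr fun t => ?_
    rw [smul_eq_mul, mul_comm t]
  · have hkm := (Lp.stronglyMeasurable (k j)).measurable
    exact (((h.meas _ (hym.add hkm)).sub (h.meas _ hym)).sub
      ((h.meas_deriv _ hym).mul hkm.aemeasurable)).div hkm.aemeasurable

/-- The superposition functional `z ↦ ∫ g(x, z(x)) dx` is continuously differentiable on `L^s`. -/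
theorem SubcriticalPair.exists_fderiv [Fact (1 ≤ ENNReal.ofReal s')] (hs : s.HolderConjugate s')
    (h : SubcriticalPair μ s c g gz) :
    ∃ D : Lp ℝ (ENNReal.ofReal s) μ → Lp ℝ (ENNReal.ofReal s) μ →L[ℝ] ℝ,
      (∀ z k, D z k = ∫ x, gz x (z x) * k x ∂μ) ∧
      (∀ z, HasFDerivAt (fun z : Lp ℝ (ENNReal.ofReal s) μ => ∫ x, g x (z x) ∂μ) (D z) z) ∧
      Continuous D ∧
      ∀ z, ‖D z‖ ≤ ((2 * c) ^ s' * (μ.real univ + ‖z‖ ^ s)) ^ (1 / s') := by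
  have : ENNReal.HolderConjugate (ENNReal.ofReal s') (ENNReal.ofReal s) := hs.symm.ennrealOfReal
  -- The Hölder pairing sends L^{s'} into the dual of L^s with norm at most one, so continuity and
  -- bounds of the derivative reduce to those of the superposition operator `N` with values in
  -- L^{s'}.
  let P := (ContinuousLinearMap.mul ℝ ℝ).lpPairing μ (ENNReal.ofReal s') (ENNReal.ofReal s)
  have hP : ∀ u v, P u v = ∫ x, u x * v x ∂μ := fun u v => by
    simp [P, ContinuousLinearMap.lpPairing_eq_integral]
  have hPn : ∀ u, ‖P u‖ ≤ ‖u‖ := by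
    intro u
    refine ContinuousLinearMap.opNorm_le_bound _ (norm_nonneg _) fun v => ?_
    have h1 := (ContinuousLinearMap.mul ℝ ℝ).norm_holder_apply_apply_le (r := 1) u v
    rw [L1.norm_eq_integral_norm] at h1
    have h2 : P u v = ∫ x, (ContinuousLinearMap.mul ℝ ℝ).holder 1 u v x ∂μ := by
      rw [hP]
      refine integral_congr_ae ?_
      filter_upwards [(ContinuousLinearMap.mul ℝ ℝ).coeFn_holder (r := 1) u v] with x hx
      rw [hx, ContinuousLinearMap.mul_apply']
    rw [h2]
    refine (norm_integral_le_integral_norm _).trans (h1.trans ?_)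
    refine mul_le_mul_of_nonneg_right ?_ (norm_nonneg _)
    exact mul_le_of_le_one_left (norm_nonneg _) (ContinuousLinearMap.opNorm_mul_le ℝ ℝ)
  let N : Lp ℝ (ENNReal.ofReal s) μ → Lp ℝ (ENNReal.ofReal s') μ :=
    fun z => (h.memLp_deriv hs z).1.toLp _
  have hN : ∀ z, N z =ᵐ[μ] fun x => gz x (z x) := fun z => MemLp.coeFn_toLp _
  have hD : ∀ z k, P (N z) k = ∫ x, gz x (z x) * k x ∂μ := by
    intro z k
    rw [hP]
    refine integral_congr_ae ?_
    filter_upwards [hN z] with x hx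
    rw [hx]
  have hNc : Continuous N := by
    refine continuous_iff_continuousAt.2 fun z => tendsto_of_seq_tendsto fun k hk => ?_
    rw [tendsto_iff_dist_tendsto_zero]
    have h1 : Tendsto (fun j => k j - z) atTop (𝓝 0) := by
      simpa using hk.sub_const z
    have h2 := (ENNReal.tendsto_toReal ENNReal.zero_ne_top).comp (h.tendsto_deriv hs z h1)
    refine h2.congr fun j => ?_
    rw [dist_eq_norm, Lp.norm_def, Function.comp_apply]
    congr 1
    refine eLpNorm_congr_ae ?_
    filter_upwards [hN z, hN (k j), Lp.coeFn_sub (N (k j)) (N z), Lp.coeFn_sub (k j) z]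
      with x hx1 hx2 hx3 hx4
    rw [Function.comp_apply, hx3, hx4, Pi.sub_apply, Pi.sub_apply, hx1, hx2, add_sub_cancel]
  refine ⟨fun z => P (N z), hD, fun z => ?_, P.continuous.comp hNc, fun z => ?_⟩
  · rw [hasFDerivAt_iff_isLittleO_nhds_zero]
    -- The remainder is `R k` times `k`, so Hölder's inequality bounds its integral by the L^{s'}
    -- norm of `R k`, which tends to zero, times the norm of `k`.
    let R : Lp ℝ (ENNReal.ofReal s) μ → X → ℝ := fun k x =>
      (g x (z x + k x) - g x (z x) - gz x (z x) * k x) / k x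
    have hR : Tendsto (fun k => (eLpNorm (R k) (ENNReal.ofReal s') μ).toReal) (𝓝 0) (𝓝 0) := by
      refine (ENNReal.tendsto_toReal ENNReal.zero_ne_top).comp
        (tendsto_of_seq_tendsto fun k hk => ?_)
      exact h.tendsto_slope hs z hk
    have hRfin : ∀ᶠ k in 𝓝 (0 : Lp ℝ (ENNReal.ofReal s) μ),
        eLpNorm (R k) (ENNReal.ofReal s') μ < ⊤ := by
      have : Tendsto (fun k => eLpNorm (R k) (ENNReal.ofReal s') μ) (𝓝 0) (𝓝 0) :=
        tendsto_of_seq_tendsto fun k hk => h.tendsto_slope hs z hk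
      exact this.eventually_lt_const ENNReal.zero_lt_top
    rw [Asymptotics.isLittleO_iff]
    intro ε hε
    filter_upwards [hR.eventually_le_const hε, hRfin] with k hk1 hk2
    have hzm := (Lp.stronglyMeasurable z).measurable
    have hkm := (Lp.stronglyMeasurable k).measurable
    have hRm : MemLp (R k) (ENNReal.ofReal s') μ := by
      refine ⟨AEMeasurable.aestronglyMeasurable ?_, hk2⟩
      exact (((h.meas _ (hzm.add hkm)).sub (h.meas _ hzm)).sub
        ((h.meas_deriv _ hzm).mul hkm.aemeasurable)).div hkm.aemeasurable
    have hprod : Integrable (fun x => gz x (z x) * k x) μ :=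
      (h.memLp_deriv hs z).1.integrable_mul (Lp.memLp k)
    have hdiff : Integrable (fun x => g x ((z + k : Lp ℝ (ENNReal.ofReal s) μ) x) - g x (z x)) μ :=
      (h.integrable hs _).sub (h.integrable hs _)
    have heq : (∫ x, g x ((z + k : Lp ℝ (ENNReal.ofReal s) μ) x) ∂μ) - (∫ x, g x (z x) ∂μ) -
        P (N z) k = P (hRm.toLp _) k := by
      rw [hD, hP, ← integral_sub (h.integrable hs _) (h.integrable hs _),
        ← integral_sub hdiff hprod]
      refine integral_congr_ae ?_
      filter_upwards [Lp.coeFn_add z k, hRm.coeFn_toLp] with x hx1 hx2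
      rw [hx1, hx2, Pi.add_apply]
      simp only [R]
      rcases eq_or_ne (k x) 0 with h0 | h0
      · simp [h0]
      · rw [div_mul_cancel₀ _ h0]
    rw [heq]
    refine ((P _).le_opNorm k).trans ?_
    gcongr
    refine (hPn _).trans ?_
    rwa [Lp.norm_toLp]
  · refine (hPn _).trans ?_
    rw [Lp.norm_toLp]
    exact (h.memLp_deriv hs z).2

end

/-! ### Superlinear functions of one variable -/

section Pointwise

variable {γ γ' : ℝ → ℝ} {s c p a R : ℝ}

/-- The condition says exactly that `x ↦ γ (x * t) * x ^ (-p)` has nonnegative derivative for `x ≥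
1`. -/
theorem rpow_mul_le_of_superlinear (hγ : ∀ t, HasDerivAt γ (γ' t) t)
    (hsup : ∀ t, R ≤ |t| → p * γ t ≤ t * γ' t) {t l : ℝ} (ht : R ≤ |t|) (hl : 1 ≤ l) :
    l ^ p * γ t ≤ γ (l * t) := by
  have hder : ∀ x : ℝ, 0 < x → HasDerivAt (fun x : ℝ => γ (x * t) * x ^ (-p))
      (γ' (x * t) * t * x ^ (-p) + γ (x * t) * (-p * x ^ (-p - 1))) x := by
    intro x hx
    have h1 : HasDerivAt (fun x : ℝ => γ (x * t)) (γ' (x * t) * t) x :=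
      (hγ (x * t)).comp x (by simpa using (hasDerivAt_id x).mul_const t)
    exact h1.mul (Real.hasDerivAt_rpow_const (Or.inl hx.ne'))
  have hmono : MonotoneOn (fun x : ℝ => γ (x * t) * x ^ (-p)) (Ici 1) := by
    refine monotoneOn_of_hasDerivWithinAt_nonneg (convex_Ici 1)
      (f' := fun x => γ' (x * t) * t * x ^ (-p) + γ (x * t) * (-p * x ^ (-p - 1)))
      (fun x hx => (hder x (zero_lt_one.trans_le hx)).continuousAt.continuousWithinAt)
      (fun x hx => ?_) (fun x hx => ?_)
    · rw [interior_Ici] at hx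
      exact (hder x (zero_lt_one.trans hx)).hasDerivWithinAt
    · rw [interior_Ici] at hx
      have hx0 : 0 < x := zero_lt_one.trans hx
      have h1 : x ^ (-p) = x ^ (-p - 1) * x := by
        rw [← Real.rpow_add_one hx0.ne']
        congr 1
        ring
      have h2 : R ≤ |x * t| := by
        rw [abs_mul, abs_of_pos hx0]
        nlinarith [abs_nonneg t, mem_Ioi.1 hx]
      have h3 := hsup _ h2
      have h4 : 0 < x ^ (-p - 1) := by positivity
      rw [h1]
      nlinarith [mul_le_mul_of_nonneg_left h3 h4.le]
  have h1 := hmono (mem_Ici.2 le_rfl) (mem_Ici.2 hl) hl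
  have hl0 : 0 < l := by linarith
  simp only [one_mul, Real.one_rpow, mul_one] at h1
  rw [Real.rpow_neg hl0.le, ← div_eq_mul_inv, le_div_iff₀ (by positivity)] at h1
  linarith

theorem abs_sub_le_of_growth (hγ : ∀ t, HasDerivAt γ (γ' t) t) (hs : 1 ≤ s) (hc : 0 ≤ c)
    (hgr : ∀ t, |γ' t| ≤ c * (1 + |t| ^ (s - 1))) {M x y : ℝ} (hM : 1 ≤ M) (hx : |x| ≤ M)
    (hy : |y| ≤ M) : |γ y - γ x| ≤ 2 * c * M ^ (s - 1) * |y - x| := by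
  refine (convex_closedBall (0 : ℝ) M).norm_image_sub_le_of_norm_hasDerivWithin_le
    (f := γ) (f' := γ') (fun τ _ => (hγ τ).hasDerivWithinAt) (fun τ hτ => ?_) (by simpa using hx)
    (by simpa using hy)
  rw [mem_closedBall_zero_iff, Real.norm_eq_abs] at hτ
  rw [Real.norm_eq_abs]
  have h1 := Real.rpow_le_rpow (abs_nonneg τ) hτ (by linarith : 0 ≤ s - 1)
  have h2 := Real.one_le_rpow hM (by linarith : 0 ≤ s - 1)
  have h3 := hgr τ
  nlinarith

/-- For large `|w|` the shifts are negligible and the passage from `w + v` to `(1 + δ) * w + v'`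
multiplies the argument by at least `1 + θ * δ`. Homogeneity of degree `p` from below and
Bernoulli's inequality then give the factor `1 + p * θ * δ`. -/
theorem superlinear_comparison_of_le_abs (hp : 2 < p) (hR : 0 < R)
    (hγ : ∀ t, HasDerivAt γ (γ' t) t)
    (hsup : ∀ t, R ≤ |t| → 0 < p * γ t ∧ p * γ t ≤ t * γ' t) {δ w v v' : ℝ} (hδ : 0 < δ)
    (hw : 2 * p / (p - 2) * (R + |v| + |v'| + |v - v'| / δ) ≤ |w|) :
    (1 + (p + 2) / 2 * δ) * γ (w + v) ≤ γ ((1 + δ) * w + v') := by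
  set K : ℝ := 2 * p / (p - 2) with hK
  have hp2 : 0 < p - 2 := by linarith
  have hK2 : 2 ≤ K := by
    rw [hK, le_div_iff₀ hp2]
    linarith
  have hD0 : 0 ≤ |v - v'| / δ := by positivity
  have hv0 := abs_nonneg v
  have hv'0 := abs_nonneg v'
  have hDδ : |v - v'| = δ * (|v - v'| / δ) := by field_simp
  -- The midpoint between `2 / p` and one: it leaves room for the shifts and still has `p * θ > 2`.
  -- The constant `K` is `1 / (1 - θ)`.
  set θ : ℝ := (p + 2) / (2 * p) with hθ
  have hθ0 : 0 < θ := by positivity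
  have hθ1 : (1 - θ) * K = 1 := by
    rw [hθ, hK]
    field_simp
    ring
  have hθlt : θ < 1 := by
    rw [hθ, div_lt_one (by linarith)]
    linarith
  have hpθ : p * θ = (p + 2) / 2 := by rw [hθ]; field_simp
  have hwv : R + |v| ≤ |w| := by nlinarith
  have hz : R ≤ |w + v| := by
    have h1 := abs_sub_abs_le_abs_sub w (-v)
    rw [abs_neg, sub_neg_eq_add] at h1
    linarith
  have hz0 : w + v ≠ 0 := by
    intro h0
    rw [h0, abs_zero] at hz
    linarith
  have hdom : |v - v'| + θ * δ * |v| ≤ (1 - θ) * δ * |w| := by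
    have h1 : (1 - θ) * δ * (K * (R + |v| + |v'| + |v - v'| / δ)) ≤ (1 - θ) * δ * |w| :=
      mul_le_mul_of_nonneg_left hw (by nlinarith)
    have h2 : (1 - θ) * δ * (K * (R + |v| + |v'| + |v - v'| / δ)) =
        ((1 - θ) * K) * (δ * R + δ * |v| + δ * |v'| + δ * (|v - v'| / δ)) := by ring
    rw [h2, hθ1, one_mul, ← hDδ] at h1
    have h3 : θ * (δ * |v|) ≤ 1 * (δ * |v|) := by gcongr
    have h4 : 0 ≤ δ * R := by positivity
    have h5 : 0 ≤ δ * |v'| := by positivity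
    linarith
  have he : |v' - v - θ * δ * v| ≤ (1 - θ) * δ * |w| := by
    have h1 := _root_.abs_sub (v' - v) (θ * δ * v)
    rw [abs_sub_comm v', abs_mul, abs_of_pos (mul_pos hθ0 hδ)] at h1
    exact h1.trans hdom
  have hθδ : 0 < θ * δ := mul_pos hθ0 hδ
  obtain ⟨he1, he2⟩ := abs_le.1 he
  obtain ⟨hv1, hv2⟩ := abs_le.1 (le_refl |v|)
  have hratio : 1 + θ * δ ≤ ((1 + δ) * w + v') / (w + v) := by
    rcases le_total 0 w with hw0 | hw0
    · rw [abs_of_nonneg hw0] at hwv he1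
      rw [le_div_iff₀ (by linarith)]
      linarith
    · rw [abs_of_nonpos hw0] at hwv he2
      rw [le_div_iff_of_neg (by linarith)]
      linarith
  have hγpos : 0 < γ (w + v) := by
    have := (hsup _ hz).1
    exact (mul_pos_iff_of_pos_left (by linarith)).1 this
  have h1 := rpow_mul_le_of_superlinear hγ (fun t ht => (hsup t ht).2) hz
    (le_trans (by linarith) hratio)
  rw [div_mul_cancel₀ _ hz0] at h1
  have h2 : 1 + (p + 2) / 2 * δ ≤ (((1 + δ) * w + v') / (w + v)) ^ p := by
    have h3 : 1 + p * (θ * δ) ≤ (1 + θ * δ) ^ p :=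
      one_add_mul_self_le_rpow_one_add (by linarith) (by linarith)
    have h4 : (1 + θ * δ) ^ p ≤ (((1 + δ) * w + v') / (w + v)) ^ p :=
      Real.rpow_le_rpow (by positivity) hratio (by linarith)
    rw [← mul_assoc, hpθ] at h3
    linarith
  exact (mul_le_mul_of_nonneg_right h2 hγpos.le).trans h1

/-- Below the threshold of the previous lemma `|w|` is at most a multiple of `E₁`, and the two
arguments differ by at most a multiple of `δ * E₁`, so the growth bounds make the error of order `δ
* E₁ ^ s`. The quotient `|v - v'| / δ` in `E₁` is bounded as long as the data move by `O(δ)`. -/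
theorem exists_superlinear_comparison (hs : 2 < s) (hc : 0 ≤ c) (hp : 2 < p) (hR : 0 < R) :
    ∃ C : ℝ, 0 < C ∧ ∀ γ γ' : ℝ → ℝ, (∀ t, HasDerivAt γ (γ' t) t) →
      (∀ t, |γ t| ≤ c * (1 + |t| ^ s)) → (∀ t, |γ' t| ≤ c * (1 + |t| ^ (s - 1))) →
      (∀ t, R ≤ |t| → 0 < p * γ t ∧ p * γ t ≤ t * γ' t) →
      ∀ δ, 0 < δ → δ ≤ 1 → ∀ w v v' : ℝ,
        (1 + (p + 2) / 2 * δ) * γ (w + v) - γ ((1 + δ) * w + v') ≤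
          C * δ * (1 + |v| + |v'| + |v - v'| / δ) ^ s := by
  set K : ℝ := 2 * p / (p - 2) with hK
  have hp2 : 0 < p - 2 := by linarith
  have hK2 : 2 ≤ K := by
    rw [hK, le_div_iff₀ hp2]
    linarith
  set K₁ : ℝ := K * (1 + R) with hK₁
  have hK₁0 : 0 < K₁ := by positivity
  set M : ℝ := 2 * K₁ + 1 with hM
  refine ⟨((p + 2) / 2 + 1) * (2 * c) * M ^ s + 1, by positivity, ?_⟩
  intro γ γ' hγ hgr hgr' hsup δ hδ hδ1 w v v'
  set E₁ : ℝ := 1 + |v| + |v'| + |v - v'| / δ with hE₁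
  have hD0 : 0 ≤ |v - v'| / δ := by positivity
  have hv0 := abs_nonneg v
  have hv'0 := abs_nonneg v'
  have hE₁1 : 1 ≤ E₁ := by linarith
  have hDδ : |v - v'| = δ * (|v - v'| / δ) := by field_simp
  have hCpos : 0 ≤ (((p + 2) / 2 + 1) * (2 * c) * M ^ s + 1) * δ * E₁ ^ s := by positivity
  rcases le_or_gt (K * (R + |v| + |v'| + |v - v'| / δ)) |w| with hw | hw
  · refine le_trans ?_ hCpos
    have h1 := superlinear_comparison_of_le_abs hp hR hγ hsup hδ hw
    linarith
  · have hwE : |w| ≤ K₁ * E₁ := by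
      have h1 : R + |v| + |v'| + |v - v'| / δ ≤ (1 + R) * E₁ := by nlinarith
      calc |w| ≤ K * (R + |v| + |v'| + |v - v'| / δ) := hw.le
        _ ≤ K * ((1 + R) * E₁) := by gcongr
        _ = K₁ * E₁ := by rw [hK₁]; ring
    have hz : |w + v| ≤ M * E₁ := by
      have h1 := abs_add_le w v
      have h2 : 0 ≤ K₁ * E₁ := by positivity
      rw [hM, add_mul, one_mul, mul_assoc]
      linarith
    have hz' : |(1 + δ) * w + v'| ≤ M * E₁ := by
      have h1 := abs_add_le ((1 + δ) * w) v'
      rw [abs_mul, abs_of_pos (by linarith : 0 < 1 + δ)] at h1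
      have h2 : (1 + δ) * |w| ≤ (1 + 1) * |w| := by gcongr
      have h3 : M * E₁ = 2 * (K₁ * E₁) + E₁ := by rw [hM]; ring
      linarith
    have hzz : |(w + v) - ((1 + δ) * w + v')| ≤ δ * (M * E₁) := by
      have h1 : (w + v) - ((1 + δ) * w + v') = -(δ * w) + (v - v') := by ring
      have h2 := abs_add_le (-(δ * w)) (v - v')
      rw [abs_neg, abs_mul, abs_of_pos hδ] at h2
      rw [h1]
      have h3 : |v - v'| ≤ δ * E₁ := by
        rw [hDδ]
        gcongr
        linarith
      have h4 : δ * |w| ≤ δ * (K₁ * E₁) := by gcongr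
      have h5 : 0 ≤ δ * (K₁ * E₁) := by positivity
      have h6 : δ * (M * E₁) = 2 * (δ * (K₁ * E₁)) + δ * E₁ := by rw [hM]; ring
      linarith
    have hME : 1 ≤ M * E₁ := one_le_mul_of_one_le_of_one_le (by linarith) hE₁1
    have h1 := abs_sub_le_of_growth hγ (by linarith) hc hgr' hME hz' hz
    have h2 : |γ (w + v) - γ ((1 + δ) * w + v')| ≤ 2 * c * (M * E₁) ^ s * δ := by
      refine h1.trans ?_
      calc 2 * c * (M * E₁) ^ (s - 1) * |w + v - ((1 + δ) * w + v')|
          ≤ 2 * c * (M * E₁) ^ (s - 1) * (δ * (M * E₁)) := by gcongr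
        _ = 2 * c * ((M * E₁) ^ (s - 1) * (M * E₁)) * δ := by ring
        _ = _ := by
          rw [← Real.rpow_add_one (by positivity)]
          congr 3
          ring
    have h3 : γ (w + v) ≤ 2 * c * (M * E₁) ^ s := by
      refine (le_abs_self _).trans ((hgr _).trans ?_)
      have h4 := Real.rpow_le_rpow (abs_nonneg _) hz (by linarith : 0 ≤ s)
      have h5 := Real.one_le_rpow hME (by linarith : 0 ≤ s)
      have h6 : c * (1 + |w + v| ^ s) ≤ c * ((M * E₁) ^ s + (M * E₁) ^ s) := by gcongr
      linarith
    have h6 : (M * E₁) ^ s = M ^ s * E₁ ^ s := Real.mul_rpow (by positivity) (by positivity)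
    have h7 := le_abs_self (γ (w + v) - γ ((1 + δ) * w + v'))
    have h8 : (p + 2) / 2 * δ * γ (w + v) ≤ (p + 2) / 2 * δ * (2 * c * (M * E₁) ^ s) := by
      gcongr
    have h9 : 0 ≤ δ * E₁ ^ s := by positivity
    rw [h6] at h8 h2
    have h10 : (((p + 2) / 2 + 1) * (2 * c) * M ^ s + 1) * δ * E₁ ^ s =
        (p + 2) / 2 * δ * (2 * c * (M ^ s * E₁ ^ s)) + 2 * c * (M ^ s * E₁ ^ s) * δ +
          δ * E₁ ^ s := by ring
    linarith

/-- At `z = v` the hypothesis forces `γ v = -κ / 2 * v ^ 2`; while `|w + v| ≤ ζ` it then gives the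
lower bound `κ * w * v + (κ - b) / 2 * w ^ 2` without any correction. Beyond that range `|w| ≥ ζ -
ζ'`, and `|w| ^ s` dominates everything. -/
theorem exists_lower_bound_near_datum {κ ζ ζ' b : ℝ} (hs : 2 < s) (hc : 0 ≤ c) (hκ : 0 < κ)
    (hζ : ζ' < ζ) (hζ0 : 0 ≤ ζ') (hb : b ≤ κ) :
    ∃ C : ℝ, 0 < C ∧ ∀ (γ : ℝ → ℝ) (v : ℝ), |v| ≤ ζ' → (∀ t, |γ t| ≤ c * (1 + |t| ^ s)) →
      (∀ z, |z| ≤ ζ → |γ z + κ / 2 * z ^ 2| ≤ b / 2 * |z - v| ^ 2) →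
      ∀ w, κ * (w * v) - C * |w| ^ s ≤ γ v - γ (w + v) := by
  set d := ζ - ζ' with hd
  have hd0 : 0 < d := by linarith
  set A : ℝ := c * ((1 / d) ^ s + (1 + ζ' / d) ^ s) with hA
  set B : ℝ := (κ * ζ' * d + κ / 2 * ζ' ^ 2) * (1 / d) ^ s with hB
  have hA0 : 0 ≤ A := by positivity
  have hB0 : 0 ≤ B := by positivity
  refine ⟨A + B + 1, by positivity, ?_⟩
  intro γ v hv hgr hnear w
  have hγv : γ v = -(κ / 2 * v ^ 2) := by
    have h1 := hnear v (hv.trans hζ.le)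
    rw [sub_self, abs_zero] at h1
    have h2 : |γ v + κ / 2 * v ^ 2| ≤ 0 := by simpa using h1
    linarith [abs_nonpos_iff.1 h2]
  have hws : 0 ≤ |w| ^ s := by positivity
  rcases le_or_gt |w + v| ζ with h | h
  · have h1 := (abs_le.1 (hnear _ h)).2
    rw [add_sub_cancel_right, sq_abs] at h1
    have h2 : 0 ≤ (A + B + 1) * |w| ^ s := by positivity
    rw [hγv]
    nlinarith [sq_nonneg w]
  · have hwd : d ≤ |w| := by
      have := abs_add_le w v
      linarith
    have hw1 : 1 ≤ |w| / d := by rwa [one_le_div hd0]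
    have hτ : |w| / d ≤ (|w| / d) ^ s := by
      calc |w| / d = (|w| / d) ^ (1 : ℝ) := (Real.rpow_one _).symm
        _ ≤ _ := Real.rpow_le_rpow_of_exponent_le hw1 (by linarith)
    have hτs : (|w| / d) ^ s = (1 / d) ^ s * |w| ^ s := by
      rw [← Real.mul_rpow (by positivity) (abs_nonneg _)]
      congr 1
      ring
    have h1 : |w + v| ^ s ≤ (1 + ζ' / d) ^ s * |w| ^ s := by
      rw [← Real.mul_rpow (by positivity) (abs_nonneg _)]
      refine Real.rpow_le_rpow (abs_nonneg _) ?_ (by linarith)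
      have h2 : ζ' * 1 ≤ ζ' * (|w| / d) := by gcongr
      have h3 : (1 + ζ' / d) * |w| = |w| + ζ' * (|w| / d) := by ring
      linarith [abs_add_le w v]
    have h2 : γ (w + v) ≤ A * |w| ^ s := by
      refine (le_abs_self _).trans ((hgr _).trans ?_)
      have h3 : 1 ≤ (1 / d) ^ s * |w| ^ s := by
        rw [← hτs]
        exact hw1.trans hτ
      calc c * (1 + |w + v| ^ s)
          ≤ c * ((1 / d) ^ s * |w| ^ s + (1 + ζ' / d) ^ s * |w| ^ s) := by gcongr
        _ = A * |w| ^ s := by rw [hA]; ring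
    have h3 : κ * (w * v) ≤ κ * ζ' * d * (|w| / d) ^ s := by
      calc κ * (w * v) ≤ κ * (|w| * |v|) := by
            rw [← abs_mul]
            exact mul_le_mul_of_nonneg_left (le_abs_self _) hκ.le
        _ ≤ κ * (|w| * ζ') := by gcongr
        _ = κ * ζ' * d * (|w| / d) := by field_simp
        _ ≤ _ := by gcongr
    have h4 : κ / 2 * v ^ 2 ≤ κ / 2 * ζ' ^ 2 * (|w| / d) ^ s := by
      have h5 : v ^ 2 ≤ ζ' ^ 2 := by
        rw [← sq_abs v]
        gcongr
      have h6 : 1 ≤ (|w| / d) ^ s := hw1.trans hτ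
      calc κ / 2 * v ^ 2 ≤ κ / 2 * ζ' ^ 2 * 1 := by rw [mul_one]; gcongr
        _ ≤ _ := by gcongr
    rw [hτs] at h3 h4
    have h5 : κ * ζ' * d * ((1 / d) ^ s * |w| ^ s) + κ / 2 * ζ' ^ 2 * ((1 / d) ^ s * |w| ^ s) =
        B * |w| ^ s := by rw [hB]; ring
    rw [hγv]
    nlinarith

theorem exists_quadratic_lower_bound (hs : 0 ≤ s) (hc : 0 ≤ c) (hp : 2 < p) (ha : 0 < a)
    (hR : 0 < R) {A : ℝ} (hA : 0 ≤ A) :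
    ∃ C : ℝ, 0 < C ∧ ∀ γ γ' : ℝ → ℝ, (∀ t, HasDerivAt γ (γ' t) t) →
      (∀ t, |γ t| ≤ c * (1 + |t| ^ s)) →
      (∀ t, R ≤ |t| → a < p * γ t ∧ p * γ t ≤ t * γ' t) →
      ∀ z, A * z ^ 2 - C ≤ γ z := by
  have hp2 : 0 < p - 2 := by linarith
  -- From `|z| = R` on, `γ` grows at least like `a / p * τ ^ p` with `τ = |z| / R`; `T` is the value
  -- of `τ` beyond which this exceeds `A * z ^ 2`.
  set B : ℝ := A * R ^ 2 * p / a with hB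
  set T : ℝ := B ^ (1 / (p - 2)) with hT
  have hT0 : 0 ≤ T := by positivity
  refine ⟨A * R ^ 2 * T ^ 2 + A * R ^ 2 + c * (1 + R ^ s) + 1, by positivity, ?_⟩
  intro γ γ' hγ hgr hsup z
  have hC1 : 0 ≤ A * R ^ 2 * T ^ 2 := by positivity
  have hC2 : 0 ≤ A * R ^ 2 := by positivity
  have hC3 : 0 ≤ c * (1 + R ^ s) := by positivity
  rcases le_or_gt R |z| with hz | hz
  · set τ := |z| / R with hτ
    have hτ1 : 1 ≤ τ := by rwa [hτ, one_le_div hR]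
    have hτ0 : 0 < τ := by linarith
    have hz2 : z ^ 2 = R ^ 2 * τ ^ 2 := by
      rw [hτ, div_pow, sq_abs]
      field_simp
    have hzR : τ * (z / τ) = z := by field_simp
    have habs : |z / τ| = R := by
      rw [abs_div, abs_of_pos hτ0, hτ, div_div_cancel₀ (by linarith)]
    have h1 := rpow_mul_le_of_superlinear hγ (fun t ht => (hsup t ht).2) habs.ge hτ1
    rw [hzR] at h1
    have h2 := (hsup _ habs.ge).1
    have h3 : τ ^ p * (a / p) ≤ γ z := by
      refine le_trans ?_ h1
      gcongr
      rw [div_le_iff₀ (by linarith)]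
      linarith
    rcases le_or_gt T τ with hTτ | hTτ
    · have h4 : B ≤ τ ^ (p - 2) := by
        have h5 := Real.rpow_le_rpow hT0 hTτ hp2.le
        rwa [hT, ← Real.rpow_mul (by positivity), one_div_mul_cancel hp2.ne', Real.rpow_one] at h5
      have h6 : τ ^ p = τ ^ (p - 2) * τ ^ 2 := by
        rw [← Real.rpow_two, ← Real.rpow_add hτ0]
        congr 1
        ring
      have h7 : A * z ^ 2 ≤ τ ^ p * (a / p) := by
        rw [h6, hz2]
        have h8 : A * R ^ 2 = B * (a / p) := by rw [hB]; field_simp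
        calc A * (R ^ 2 * τ ^ 2) = B * (τ ^ 2 * (a / p)) := by rw [← mul_assoc, h8]; ring
          _ ≤ τ ^ (p - 2) * (τ ^ 2 * (a / p)) := by gcongr
          _ = _ := by ring
      linarith
    · have h4 : A * z ^ 2 ≤ A * R ^ 2 * T ^ 2 := by
        rw [hz2, ← mul_assoc]
        gcongr
      have h5 : 0 ≤ τ ^ p * (a / p) := by positivity
      linarith
  · have h1 := (abs_le.1 (hgr z)).1
    have h2 : |z| ^ s ≤ R ^ s := Real.rpow_le_rpow (abs_nonneg _) hz.le hs
    have h3 : c * (1 + |z| ^ s) ≤ c * (1 + R ^ s) := by gcongr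
    have h4 : A * z ^ 2 ≤ A * R ^ 2 := by
      rw [← sq_abs]
      gcongr
    linarith

end Pointwise

/-! ### Composition with Carathéodory functions -/

namespace FracLap

variable {n m : ℕ} {Ω : BoundedLipschitzDomain n}

/-- For simple functions the composition is a finite sum of measurable pieces; continuity in the
last two variables passes this to the limit. -/
theorem IsCaratheodory.aemeasurable_comp {g : E n → ℝ → E m → ℝ} (hg : IsCaratheodory Ω g)
    {z : E n → ℝ} {u : E n → E m} (hz : Measurable z) (hu : Measurable u) :
    AEMeasurable (fun x => g x (z x) (u x)) Ω.vol := by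
  have hq : StronglyMeasurable fun x => (z x, u x) := (hz.prodMk hu).stronglyMeasurable
  have hsimple : ∀ φ : SimpleFunc (E n) (ℝ × E m),
      AEMeasurable (fun x => g x (φ x).1 (φ x).2) Ω.vol := by
    intro φ
    have h1 : (fun x => g x (φ x).1 (φ x).2) =
        fun x => ∑ c ∈ φ.range, (φ ⁻¹' {c}).indicator (fun x => g x c.1 c.2) x := by
      funext x
      rw [Finset.sum_eq_single (φ x)]
      · rw [indicator_of_mem (by simp)]
      · intro c _ hc
        exact indicator_of_notMem (fun h => hc h.symm) _
      · intro h
        exact absurd (SimpleFunc.mem_range_self φ x) h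
    rw [h1]
    exact Finset.aemeasurable_fun_sum _ fun c _ =>
      (hg.1 c.1 c.2).indicator (φ.measurableSet_fiber c)
  refine aemeasurable_of_tendsto_metrizable_ae atTop (fun k => hsimple (hq.approx k)) ?_
  filter_upwards [hg.2] with x hx
  exact (hx.tendsto (z x, u x)).comp (hq.tendsto_approx x)

end FracLap

/-! ### Integral functionals on `L^s` of a finite measure space -/

section

variable {X : Type*} [MeasurableSpace X] {μ : Measure X} {s : ℝ}

theorem integrable_abs_rpow_Lp (hs : 0 < s) (z : Lp ℝ (ENNReal.ofReal s) μ) :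
    Integrable (fun x => |z x| ^ s) μ := by
  have h := (Lp.memLp z).integrable_norm_rpow (by simpa using hs) ENNReal.ofReal_ne_top
  simpa [ENNReal.toReal_ofReal hs.le] using h

theorem integral_abs_rpow_Lp [Fact (1 ≤ ENNReal.ofReal s)] (hs : 0 < s)
    (z : Lp ℝ (ENNReal.ofReal s) μ) :
    ∫ x, |z x| ^ s ∂μ = ‖z‖ ^ s := by
  rw [integral_eq_lintegral_of_nonneg_ae (Eventually.of_forall fun x => by positivity)
    (integrable_abs_rpow_Lp hs z).aestronglyMeasurable, lintegral_ofReal_rpow_Lp hs,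
    ENNReal.toReal_ofReal (by positivity)]

theorem integrable_abs_mul_abs_L2 (z k : Lp ℝ 2 μ) :
    Integrable (fun x => |z x| * |k x|) μ := by
  have := (Lp.memLp k).abs.integrable_mul (Lp.memLp z).abs
  simpa [mul_comm] using! this

theorem integral_abs_mul_abs_L2_le (z k : Lp ℝ 2 μ) :
    ∫ x, |z x| * |k x| ∂μ ≤ ‖z‖ * ‖k‖ := by
  have h : ∫ x, |z x| * |k x| ∂μ = inner ℝ |z| |k| := by
    rw [L2.inner_def]
    refine integral_congr_ae ?_
    filter_upwards [Lp.coeFn_abs z, Lp.coeFn_abs k] with x h1 h2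
    rw [h1, h2]
    simp [mul_comm]
  rw [h, ← norm_abs_eq_norm z, ← norm_abs_eq_norm k]
  exact real_inner_le_norm _ _

variable [IsFiniteMeasure μ] [Fact (1 ≤ ENNReal.ofReal s)]

theorem exists_integral_abs_mul_abs_le (hs : 2 ≤ s) :
    ∃ K : ℝ, 0 < K ∧ ∀ z k : Lp ℝ (ENNReal.ofReal s) μ,
      Integrable (fun x => |z x| * |k x|) μ ∧ ∫ x, |z x| * |k x| ∂μ ≤ K * (‖z‖ * ‖k‖) := by
  have h2s : (2 : ℝ≥0∞) ≤ ENNReal.ofReal s := by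
    rw [← ENNReal.ofReal_ofNat 2]; exact ENNReal.ofReal_le_ofReal hs
  set N : ℝ≥0∞ :=
    μ univ ^ (1 / (2 : ℝ≥0∞).toReal - 1 / (ENNReal.ofReal s).toReal) with hN
  have hNt : N ≠ ⊤ := by
    refine ENNReal.rpow_ne_top_of_nonneg ?_ (measure_ne_top _ _)
    rw [ENNReal.toReal_ofReal (by linarith), ENNReal.toReal_ofNat, sub_nonneg]
    gcongr
  have hm : ∀ z : Lp ℝ (ENNReal.ofReal s) μ, MemLp z 2 μ :=
    fun z => (Lp.memLp z).mono_exponent h2s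
  have hn : ∀ z : Lp ℝ (ENNReal.ofReal s) μ, ‖(hm z).toLp z‖ ≤ N.toReal * ‖z‖ := by
    intro z
    rw [Lp.norm_toLp, Lp.norm_def, mul_comm, ← ENNReal.toReal_mul]
    exact ENNReal.toReal_mono (ENNReal.mul_ne_top (Lp.eLpNorm_ne_top _) hNt)
      (eLpNorm_le_eLpNorm_mul_rpow_measure_univ h2s (Lp.aestronglyMeasurable z))
  refine ⟨N.toReal ^ 2 + 1, by positivity, fun z k => ?_⟩
  have hae : (fun x => |(hm z).toLp z x| * |(hm k).toLp k x|) =ᵐ[μ] fun x => |z x| * |k x| := by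
    filter_upwards [(hm z).coeFn_toLp, (hm k).coeFn_toLp] with x h1 h2
    rw [h1, h2]
  refine ⟨(integrable_abs_mul_abs_L2 _ _).congr hae, ?_⟩
  rw [← integral_congr_ae hae]
  refine (integral_abs_mul_abs_L2_le _ _).trans ?_
  calc ‖(hm z).toLp z‖ * ‖(hm k).toLp k‖ ≤ (N.toReal * ‖z‖) * (N.toReal * ‖k‖) := by
        gcongr
        · exact hn z
        · exact hn k
    _ = N.toReal ^ 2 * (‖z‖ * ‖k‖) := by ring
    _ ≤ _ := by gcongr; linarith

variable {c : ℝ} {g gz : X → ℝ → ℝ}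

theorem SubcriticalPair.abs_integral_le (hs : 0 < s) (h : SubcriticalPair μ s c g gz)
    (z : Lp ℝ (ENNReal.ofReal s) μ) :
    |∫ x, g x (z x) ∂μ| ≤ c * (μ.real univ + ‖z‖ ^ s) := by
  have hi : Integrable (fun x => c * (1 + |z x| ^ s)) μ :=
    ((integrable_const 1).add (integrable_abs_rpow_Lp hs z)).const_mul c
  rw [← Real.norm_eq_abs]
  refine (norm_integral_le_of_norm_le hi ?_).trans_eq ?_
  · filter_upwards [h.growth] with x hx
    exact hx _
  · rw [integral_const_mul, integral_add (integrable_const 1) (integrable_abs_rpow_Lp hs z),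
      integral_abs_rpow_Lp hs]
    simp

theorem exists_abs_integral_sub_le (hs : 2 < s) :
    ∃ K : ℝ, 0 < K ∧ ∀ (g₁ g₁' g₂ g₂' : X → ℝ → ℝ) (c d₁ : ℝ), 0 ≤ d₁ →
      SubcriticalPair μ s c g₁ g₁' → SubcriticalPair μ s c g₂ g₂' →
      (∀ᵐ x ∂μ, ∀ t, |g₁ x t - g₂ x t| ≤ d₁ * (1 + |t| ^ 2) ∧
        |g₁' x t - g₂' x t| ≤ d₁ * (1 + |t|)) →
      ∀ z : Lp ℝ (ENNReal.ofReal s) μ,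
        |(∫ x, g₁ x (z x) ∂μ) - ∫ x, g₂ x (z x) ∂μ| ≤ K * d₁ * (1 + ‖z‖ ^ 2) ∧
        ∀ k : Lp ℝ (ENNReal.ofReal s) μ,
          |(∫ x, g₁' x (z x) * k x ∂μ) - ∫ x, g₂' x (z x) * k x ∂μ| ≤
            K * d₁ * (1 + ‖z‖) * ‖k‖ := by
  obtain ⟨K, hK, hKz⟩ := exists_integral_abs_mul_abs_le (μ := μ) hs.le
  have hs' : s.HolderConjugate s.conjExponent := .conjExponent (by linarith)
  -- The constant function one turns the integral of `|k|` into an integral of a product, so that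
  -- one Hölder constant covers both parts of `(1 + |z|) * |k|`.
  set o : Lp ℝ (ENNReal.ofReal s) μ := Lp.const _ μ 1 with ho
  have hoc : ∀ᵐ x ∂μ, o x = 1 := Lp.coeFn_const (ENNReal.ofReal s) μ (1 : ℝ)
  refine ⟨K * (1 + ‖o‖) + μ.real univ, by positivity, ?_⟩
  intro g₁ g₁' g₂ g₂' c d₁ hd₁ h₁ h₂ hd z
  have hμ : 0 ≤ μ.real univ := measureReal_nonneg
  constructor
  · obtain ⟨hi, hle⟩ := hKz z z
    have hi' : Integrable (fun x => d₁ * (1 + |z x| * |z x|)) μ :=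
      ((integrable_const 1).add hi).const_mul d₁
    rw [← integral_sub (h₁.integrable hs' z) (h₂.integrable hs' z), ← Real.norm_eq_abs]
    refine (norm_integral_le_of_norm_le hi' ?_).trans ?_
    · filter_upwards [hd] with x hx
      have := (hx (z x)).1
      rwa [pow_two] at this
    · rw [integral_const_mul, integral_add (integrable_const 1) hi]
      simp only [integral_const, smul_eq_mul, mul_one]
      have h1 : μ.real univ + ∫ x, |z x| * |z x| ∂μ ≤
          (K * (1 + ‖o‖) + μ.real univ) * (1 + ‖z‖ ^ 2) := by
        have h2 : 0 ≤ K * ‖o‖ * (1 + ‖z‖ ^ 2) := by positivity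
        have h3 : 0 ≤ μ.real univ * ‖z‖ ^ 2 := by positivity
        nlinarith
      calc _ ≤ d₁ * ((K * (1 + ‖o‖) + μ.real univ) * (1 + ‖z‖ ^ 2)) :=
            mul_le_mul_of_nonneg_left h1 hd₁
        _ = _ := by ring
  · intro k
    obtain ⟨hi, hle⟩ := hKz z k
    obtain ⟨hio, hleo⟩ := hKz o k
    have hi' : Integrable (fun x => d₁ * (|o x| * |k x| + |z x| * |k x|)) μ :=
      (hio.add hi).const_mul d₁
    have hmul : ∀ {f f' : X → ℝ → ℝ}, SubcriticalPair μ s c f f' →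
        Integrable (fun x => f' x (z x) * k x) μ := by
      intro f f' hf
      have : ENNReal.HolderConjugate (ENNReal.ofReal s.conjExponent) (ENNReal.ofReal s) :=
        hs'.symm.ennrealOfReal
      exact (hf.memLp_deriv hs' z).1.integrable_mul (Lp.memLp k)
    rw [← integral_sub (hmul h₁) (hmul h₂), ← Real.norm_eq_abs]
    refine (norm_integral_le_of_norm_le hi' ?_).trans ?_
    · filter_upwards [hd, hoc] with x hx hx1
      rw [hx1, abs_one, one_mul, ← sub_mul, norm_mul, Real.norm_eq_abs, Real.norm_eq_abs]
      have := mul_le_mul_of_nonneg_right (hx (z x)).2 (abs_nonneg (k x))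
      linarith
    · rw [integral_const_mul, integral_add hio hi]
      have h1 : (∫ x, |o x| * |k x| ∂μ) + ∫ x, |z x| * |k x| ∂μ ≤
          (K * (1 + ‖o‖) + μ.real univ) * (1 + ‖z‖) * ‖k‖ := by
        have h2 : 0 ≤ K * ‖o‖ * (‖z‖ * ‖k‖) := by positivity
        have h3 : 0 ≤ μ.real univ * (1 + ‖z‖) * ‖k‖ := by positivity
        have h4 : 0 ≤ K * ‖k‖ := by positivity
        nlinarith
      calc _ ≤ d₁ * ((K * (1 + ‖o‖) + μ.real univ) * (1 + ‖z‖) * ‖k‖) :=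
            mul_le_mul_of_nonneg_left h1 hd₁
        _ = _ := by ring

/-- Integrated form of `exists_superlinear_comparison`. -/
theorem exists_integral_superlinear_comparison {p R : ℝ} (hs : 2 < s) (hc : 0 ≤ c) (hp : 2 < p)
    (hR : 0 < R) (M : ℝ) :
    ∃ C : ℝ, 0 < C ∧ ∀ g gz : X → ℝ → ℝ, SubcriticalPair μ s c g gz →
      (∀ᵐ x ∂μ, ∀ t, R ≤ |t| → 0 < p * g x t ∧ p * g x t ≤ t * gz x t) →
      ∀ δ, 0 < δ → δ ≤ 1 → ∀ z y y' : Lp ℝ (ENNReal.ofReal s) μ, ‖y‖ ≤ M → ‖y - y'‖ ≤ M * δ →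
        (1 + (p + 2) / 2 * δ) * (∫ x, g x ((z + y : Lp ℝ (ENNReal.ofReal s) μ) x) ∂μ) -
          (∫ x, g x (((1 + δ) • z + y' : Lp ℝ (ENNReal.ofReal s) μ) x) ∂μ) ≤ C * δ := by
  obtain ⟨C, hC, hCγ⟩ := exists_superlinear_comparison hs hc hp hR
  have hs0 : 0 < s := by linarith
  have hs' : s.HolderConjugate s.conjExponent := .conjExponent (by linarith)
  set o : Lp ℝ (ENNReal.ofReal s) μ := Lp.const _ μ 1 with ho
  have hoc : ∀ᵐ x ∂μ, o x = 1 := Lp.coeFn_const (ENNReal.ofReal s) μ (1 : ℝ)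
  refine ⟨C * (‖o‖ + 4 * |M|) ^ s + 1, by positivity, ?_⟩
  intro g gz hg hsup δ hδ hδ1 z y y' hy hyy
  have hM : 0 ≤ M := (norm_nonneg _).trans hy
  -- The pointwise error is controlled by the power `s` of this function. Its norm is bounded
  -- independently of `δ`, precisely because `‖y - y'‖ ≤ M * δ`.
  set e : Lp ℝ (ENNReal.ofReal s) μ := o + |y| + |y'| + δ⁻¹ • |y - y'| with he
  have hey : ‖e‖ ≤ ‖o‖ + 4 * |M| := by
    have h1 : ‖e‖ ≤ ‖o‖ + ‖y‖ + ‖y'‖ + δ⁻¹ * ‖y - y'‖ := by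
      refine (norm_add_le _ _).trans (add_le_add ((norm_add_le _ _).trans
        (add_le_add ((norm_add_le _ _).trans ?_) ?_)) ?_)
      · rw [norm_abs_eq_norm]
      · rw [norm_abs_eq_norm]
      · rw [norm_smul, norm_abs_eq_norm, Real.norm_eq_abs, abs_of_pos (by positivity)]
    have h2 : δ⁻¹ * ‖y - y'‖ ≤ M := by
      rw [inv_mul_le_iff₀ hδ]; linarith
    have h3 : ‖y'‖ ≤ ‖y‖ + ‖y - y'‖ := by
      have := norm_sub_le y (y - y')
      rwa [sub_sub_cancel] at this
    have h4 : M * δ ≤ M := mul_le_of_le_one_right hM hδ1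
    rw [abs_of_nonneg hM]
    linarith
  have hae : ∀ᵐ x ∂μ, e x = 1 + |y x| + |y' x| + |y x - y' x| / δ := by
    filter_upwards [hoc, Lp.coeFn_add (o + |y| + |y'|) (δ⁻¹ • |y - y'|),
      Lp.coeFn_add (o + |y|) |y'|, Lp.coeFn_add o |y|, Lp.coeFn_smul δ⁻¹ |y - y'|,
      Lp.coeFn_abs y, Lp.coeFn_abs y', Lp.coeFn_abs (y - y'), Lp.coeFn_sub y y']
      with x h1 h2 h3 h4 h5 h6 h7 h8 h9
    rw [he, h2, Pi.add_apply, h3, Pi.add_apply, h4, Pi.add_apply, h1, h5, Pi.smul_apply, h6, h7,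
      h8, h9, Pi.sub_apply, smul_eq_mul, inv_mul_eq_div]
  have hi1 := (hg.integrable hs' (z + y)).const_mul (1 + (p + 2) / 2 * δ)
  have hi2 := hg.integrable hs' ((1 + δ) • z + y')
  have hi3 := (integrable_abs_rpow_Lp hs0 e).const_mul (C * δ)
  rw [← integral_const_mul, ← integral_sub hi1 hi2]
  have h1 := integral_mono_ae (hi1.sub hi2) hi3 (by
    filter_upwards [hg.hasDerivAt, hg.growth, hg.growth_deriv, hsup, hae, Lp.coeFn_add z y,
      Lp.coeFn_add ((1 + δ) • z) y', Lp.coeFn_smul (1 + δ) z] with x h1 h2 h3 h4 h5 h6 h7 h8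
    have h9 := hCγ (g x) (gz x) h1 h2 h3 h4 δ hδ hδ1 (z x) (y x) (y' x)
    have h10 : |e x| = 1 + |y x| + |y' x| + |y x - y' x| / δ := by
      rw [h5, abs_of_nonneg (by positivity)]
    simp only [Pi.sub_apply]
    rw [h10, h6, h7, Pi.add_apply, Pi.add_apply, h8, Pi.smul_apply, smul_eq_mul]
    exact h9)
  refine h1.trans ?_
  rw [integral_const_mul, integral_abs_rpow_Lp hs0]
  have h2 : ‖e‖ ^ s ≤ (‖o‖ + 4 * |M|) ^ s := Real.rpow_le_rpow (norm_nonneg _) hey hs0.le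
  have h3 := mul_le_mul_of_nonneg_left h2 (by positivity : 0 ≤ C * δ)
  nlinarith

/-- Integrated form of `exists_lower_bound_near_datum`. -/
theorem exists_integral_lower_bound_near_datum {κ ζ ζ' b : ℝ} (hs : 2 < s) (hc : 0 ≤ c)
    (hκ : 0 < κ) (hζ : ζ' < ζ) (hζ0 : 0 ≤ ζ') (hb : b ≤ κ) :
    ∃ C : ℝ, 0 < C ∧ ∀ (g gz : X → ℝ → ℝ) (y : Lp ℝ (ENNReal.ofReal s) μ),
      SubcriticalPair μ s c g gz → (∀ᵐ x ∂μ, |y x| ≤ ζ') →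
      (∀ᵐ x ∂μ, ∀ t, |t| ≤ ζ → |g x t + κ / 2 * t ^ 2| ≤ b / 2 * |t - y x| ^ 2) →
      ∀ z : Lp ℝ (ENNReal.ofReal s) μ, κ * (∫ x, z x * y x ∂μ) - C * ‖z‖ ^ s ≤
        (∫ x, g x (y x) ∂μ) - ∫ x, g x ((z + y : Lp ℝ (ENNReal.ofReal s) μ) x) ∂μ := by
  obtain ⟨C, hC, hCγ⟩ := exists_lower_bound_near_datum hs hc hκ hζ hζ0 hb
  have hs0 : 0 < s := by linarith
  have hs' : s.HolderConjugate s.conjExponent := .conjExponent (by linarith)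
  refine ⟨C, hC, fun g gz y hg hy hnear z => ?_⟩
  obtain ⟨K, -, hK⟩ := exists_integral_abs_mul_abs_le (μ := μ) hs.le
  have hi0 : Integrable (fun x => z x * y x) μ := by
    refine (hK z y).1.mono' ((Lp.aestronglyMeasurable z).mul (Lp.aestronglyMeasurable y)) ?_
    exact Eventually.of_forall fun x => (norm_mul _ _).le
  have hi1 := (hi0.const_mul κ).sub ((integrable_abs_rpow_Lp hs0 z).const_mul C)
  have hi2 := (hg.integrable hs' y).sub (hg.integrable hs' (z + y))
  have h1 := integral_mono_ae hi1 hi2 (by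
    filter_upwards [hg.growth, hy, hnear, Lp.coeFn_add z y] with x h1 h2 h3 h4
    have h5 := hCγ (g x) (y x) h2 h1 h3 (z x)
    simp only [Pi.sub_apply]
    rw [h4, Pi.add_apply]
    exact h5)
  have h2 := integral_sub (hi0.const_mul κ) ((integrable_abs_rpow_Lp hs0 z).const_mul C)
  have h3 := integral_sub (hg.integrable hs' y) (hg.integrable hs' (z + y))
  rw [integral_const_mul, integral_const_mul, integral_abs_rpow_Lp hs0] at h2
  simp only [Pi.sub_apply] at h1
  rw [h2, h3] at h1
  exact h1

/-- Integrated form of `exists_quadratic_lower_bound`. -/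
theorem exists_integral_quadratic_lower_bound {p a R A : ℝ} (hs : 2 < s) (hc : 0 ≤ c) (hp : 2 < p)
    (ha : 0 < a) (hR : 0 < R) (hA : 0 ≤ A) :
    ∃ C : ℝ, 0 < C ∧ ∀ g gz : X → ℝ → ℝ, SubcriticalPair μ s c g gz →
      (∀ᵐ x ∂μ, ∀ t, R ≤ |t| → a < p * g x t ∧ p * g x t ≤ t * gz x t) →
      ∀ z : Lp ℝ (ENNReal.ofReal s) μ, A * (∫ x, z x ^ 2 ∂μ) - C ≤ ∫ x, g x (z x) ∂μ := by
  obtain ⟨C, hC, hCγ⟩ := exists_quadratic_lower_bound (by linarith : 0 ≤ s) hc hp ha hR hA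
  have hs' : s.HolderConjugate s.conjExponent := .conjExponent (by linarith)
  refine ⟨C * μ.real univ + 1, by positivity, fun g gz hg hsup z => ?_⟩
  obtain ⟨K, -, hK⟩ := exists_integral_abs_mul_abs_le (μ := μ) hs.le
  have hi0 : Integrable (fun x => z x ^ 2) μ := by
    refine (hK z z).1.congr (Eventually.of_forall fun x => ?_)
    simp [pow_two]
  have h1 := integral_mono_ae ((hi0.const_mul A).sub (integrable_const C)) (hg.integrable hs' z) (by
    filter_upwards [hg.hasDerivAt, hg.growth, hsup] with x h1 h2 h3
    exact hCγ (g x) (gz x) h1 h2 h3 (z x))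
  simp only [Pi.sub_apply] at h1
  rw [integral_sub (hi0.const_mul A) (integrable_const C), integral_const_mul, integral_const,
    smul_eq_mul] at h1
  linarith

end

/-! ### Stability of mountain pass critical points -/

section Stability

variable {H : Type*} [NormedAddCommGroup H] [InnerProductSpace ℝ H]

/-- Functionals `F k` that converge to `F₀`, uniformly on bounded sets, and satisfy uniform versions
of the assumptions of the mountain pass theorem. -/
structure MountainPassFamily (F₀ : H → ℝ) (F : ℕ → H → ℝ) (dF : ℕ → H → H →L[ℝ] ℝ)
    (q κ C s : ℝ) : Prop where
  q_pos : 0 < q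
  κ_pos : 0 < κ
  C_pos : 0 < C
  two_lt : 2 < s
  zero : ∀ k, F k 0 = 0
  limit_continuous : Continuous F₀
  hasFDerivAt : ∀ k w, HasFDerivAt (F k) (dF k w) w
  continuous_deriv : ∀ k, Continuous (dF k)
  uniform : ∀ M, ∀ ε > 0, ∀ᶠ k in atTop, ∀ w, ‖w‖ ≤ M → |F k w - F₀ w| ≤ ε
  lower_bound : ∀ w, κ * ‖w‖ ^ 2 - C * ‖w‖ ^ s ≤ F₀ w
  dilation : ∀ᶠ δ in 𝓝[>] (0 : ℝ), ∀ᶠ k in atTop, ∀ w,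
    F₀ ((1 + δ) • w) ≤ (1 + q * δ) * F k w + C * δ
  superlinear : ∀ k w, dF k w w ≤ q * F k w - κ * ‖w‖ ^ 2 + C
  compact : ∀ k, ∀ w : ℕ → H, ∀ M, (∀ j, ‖w j‖ ≤ M) →
    Tendsto (fun j => dF k (w j)) atTop (𝓝 0) →
    ∃ x, ∃ φ : ℕ → ℕ, StrictMono φ ∧ Tendsto (w ∘ φ) atTop (𝓝 x)
  compact_limit : ∀ k : ℕ → ℕ, Tendsto k atTop atTop → ∀ w : ℕ → H, ∀ M, (∀ j, ‖w j‖ ≤ M) →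
    Tendsto (fun j => dF (k j) (w j)) atTop (𝓝 0) →
    ∃ x, ∃ φ : ℕ → ℕ, StrictMono φ ∧ Tendsto (w ∘ φ) atTop (𝓝 x)
  closed : ∀ k : ℕ → ℕ, Tendsto k atTop atTop → ∀ w : ℕ → H, ∀ x, Tendsto w atTop (𝓝 x) →
    (∀ᶠ j in atTop, dF (k j) (w j) = 0) → HasFDerivAt F₀ (0 : H →L[ℝ] ℝ) x

theorem le_of_mul_sq_le_add_mul {κ a b x : ℝ} (hκ : 0 < κ) (ha : 0 ≤ a) (hb : 0 ≤ b)
    (h : κ * x ^ 2 ≤ a + b * x) : x ≤ 1 + (a + b) / κ := by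
  rcases le_total x 1 with hx | hx
  · have : 0 ≤ (a + b) / κ := by positivity
    linarith
  · have h1 : κ * x * x ≤ (a + b) * x := by nlinarith
    have h2 : κ * x ≤ a + b := le_of_mul_le_mul_right h1 (by linarith)
    have h3 : x ≤ (a + b) / κ := by rw [le_div_iff₀ hκ]; linarith
    linarith

namespace MountainPassFamily

variable {F₀ : H → ℝ} {F : ℕ → H → ℝ} {dF : ℕ → H → H →L[ℝ] ℝ} {q κ C s : ℝ} {ω₁ : H}

theorem continuous (h : MountainPassFamily F₀ F dF q κ C s) (k : ℕ) : Continuous (F k) :=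
  continuous_iff_continuousAt.2 fun w => (h.hasFDerivAt k w).continuousAt

/-- The property `superlinear` gives `κ * ‖w‖ ^ 2 ≤ q * A + C + A' * ‖w‖`. The resulting bound does
not depend on `k`, so it serves both single Palais-Smale sequences and sequences of critical points
with varying `k`. -/
theorem norm_le (h : MountainPassFamily F₀ F dF q κ C s) {k : ℕ} {w : H} {A A' : ℝ}
    (hA : F k w ≤ A) (hA0 : 0 ≤ A) (hA' : ‖dF k w‖ ≤ A') :
    ‖w‖ ≤ 1 + (q * A + C + A') / κ := by
  have hA'0 : 0 ≤ A' := (norm_nonneg _).trans hA'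
  have hq := h.q_pos
  have hC := h.C_pos
  refine le_of_mul_sq_le_add_mul h.κ_pos (by positivity) hA'0 ?_
  have h1 := h.superlinear k w
  have h2 : -(A' * ‖w‖) ≤ dF k w w := by
    have h3 := (dF k w).le_opNorm w
    have h4 : ‖dF k w‖ * ‖w‖ ≤ A' * ‖w‖ := by gcongr
    rw [Real.norm_eq_abs] at h3
    linarith [neg_abs_le (dF k w w)]
  have h5 : q * F k w ≤ q * A := by gcongr
  linarith

/-- The mountain range around the origin. -/
theorem exists_sphere (h : MountainPassFamily F₀ F dF q κ C s) :
    ∃ ρ β : ℝ, 0 < ρ ∧ 0 < β ∧ (∀ w, ‖w‖ ≤ ρ → 0 ≤ F₀ w) ∧ ∀ w, ‖w‖ = ρ → β ≤ F₀ w := by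
  have hκ := h.κ_pos
  have hC := h.C_pos
  have hs := h.two_lt
  have hlow : ∀ ρ : ℝ, ρ = (κ / (2 * C)) ^ (1 / (s - 2)) → ∀ w : H, ‖w‖ ≤ ρ →
      κ / 2 * ‖w‖ ^ 2 ≤ F₀ w := by
    intro ρ hρ w hw
    have h1 : ‖w‖ ^ (s - 2) ≤ κ / (2 * C) := by
      have h2 := Real.rpow_le_rpow (norm_nonneg w) hw (by linarith : 0 ≤ s - 2)
      rwa [hρ, ← Real.rpow_mul (by positivity), one_div_mul_cancel (by linarith),
        Real.rpow_one] at h2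
    have h2 : ‖w‖ ^ s = ‖w‖ ^ (s - 2) * ‖w‖ ^ 2 := by
      rcases (norm_nonneg w).eq_or_lt with h0 | h0
      · rw [← h0, Real.zero_rpow (by linarith)]; simp
      · rw [← Real.rpow_natCast, ← Real.rpow_add h0]; norm_num
    have h3 : C * (‖w‖ ^ (s - 2) * ‖w‖ ^ 2) ≤ C * (κ / (2 * C) * ‖w‖ ^ 2) := by gcongr
    have h4 : C * (κ / (2 * C) * ‖w‖ ^ 2) = κ / 2 * ‖w‖ ^ 2 := by field_simp
    have h5 := h.lower_bound w
    rw [h2] at h5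
    linarith
  -- Chosen so that `C * ρ ^ (s - 2) = κ / 2`: inside this radius the negative term takes at most
  -- half of the quadratic one.
  set ρ : ℝ := (κ / (2 * C)) ^ (1 / (s - 2)) with hρ
  have hρ0 : 0 < ρ := by positivity
  refine ⟨ρ, κ / 2 * ρ ^ 2, hρ0, by positivity, fun w hw => ?_, fun w hw => ?_⟩
  · exact le_trans (by positivity) (hlow ρ rfl w hw)
  · have := hlow ρ rfl w hw.le
    rwa [hw] at this

/-- Since `F₀` is nonnegative on the whole ball, `ω₁` lies outside it and every path crosses the
sphere. Uniform convergence on the ball costs half of the height `β`. -/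
theorem exists_pos_le_level (h : MountainPassFamily F₀ F dF q κ C s) (hω : F₀ ω₁ < 0) :
    ∃ β : ℝ, 0 < β ∧ ∀ᶠ k in atTop, F k ω₁ < 0 ∧ β ≤ FracLap.mountainPassLevel (F k) 0 ω₁ := by
  obtain ⟨ρ, β, hρ, hβ, hball, hsphere⟩ := h.exists_sphere
  refine ⟨β / 2, by positivity, ?_⟩
  filter_upwards [h.uniform ρ (β / 2) (by positivity),
    h.uniform ‖ω₁‖ (-F₀ ω₁ / 2) (by linarith)] with k hk1 hk2
  constructor
  · have := (abs_le.1 (hk2 ω₁ le_rfl)).2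
    linarith
  · have : Nonempty (Path (0 : H) ω₁) := PathConnectedSpace.joined 0 ω₁
    refine le_ciInf fun g => ?_
    have h1 : ρ ∈ Icc ‖g 0‖ ‖g 1‖ := by
      rw [g.source, g.target, norm_zero]
      refine ⟨hρ.le, ?_⟩
      by_contra! hlt
      linarith [hball ω₁ hlt.le]
    obtain ⟨t, ht⟩ := intermediate_value_univ 0 1 g.continuous.norm h1
    refine le_trans ?_ (le_ciSup (bddAbove_range_comp_unitInterval (h.continuous k)
      g.continuous) t)
    have h2 := (abs_le.1 (hk1 (g t) ht.le)).1
    have h3 := hsphere (g t) ht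
    linarith

/-- One almost optimal path for `F₀` serves as a competitor for all large `k`; its image is bounded,
so uniform convergence on bounded sets applies. -/
theorem eventually_level_le (h : MountainPassFamily F₀ F dF q κ C s) {ε : ℝ} (hε : 0 < ε) :
    ∀ᶠ k in atTop, FracLap.mountainPassLevel (F k) 0 ω₁ ≤
      FracLap.mountainPassLevel F₀ 0 ω₁ + ε := by
  obtain ⟨g, hg⟩ := exists_path_lt_of_mountainPassLevel_lt h.limit_continuous
    (a := 0) (b := ω₁) (M := FracLap.mountainPassLevel F₀ 0 ω₁ + ε / 2) (by linarith)
  obtain ⟨M, hM⟩ := bddAbove_range_comp_unitInterval continuous_norm g.continuous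
  filter_upwards [h.uniform M (ε / 2) (by positivity)] with k hk
  refine mountainPassLevel_le (h.continuous k) g fun t => ?_
  have h1 := (abs_le.1 (hk (g t) (hM (mem_range_self t)))).2
  linarith [hg t]

/-- Almost optimal paths of `F k` have no common bound, so uniform convergence on bounded sets is of
no use here. The estimate `dilation` holds for all `w` and lets the dilated path compete for `F₀` at
a cost that vanishes with `δ`. -/
theorem eventually_le_level (h : MountainPassFamily F₀ F dF q κ C s) (hω : F₀ ω₁ < 0) {ε : ℝ}
    (hε : 0 < ε) :
    ∀ᶠ k in atTop, FracLap.mountainPassLevel F₀ 0 ω₁ ≤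
      FracLap.mountainPassLevel (F k) 0 ω₁ + ε := by
  set c₀ := FracLap.mountainPassLevel F₀ 0 ω₁ with hc₀
  obtain ⟨β, hβ, hβk⟩ := h.exists_pos_le_level hω
  have hq := h.q_pos
  have hC := h.C_pos
  have h1 : ∀ᶠ δ in 𝓝[>] (0 : ℝ), δ * (q * (|c₀| + 1 + ε) + C) < ε / 2 := by
    refine Filter.Eventually.filter_mono nhdsWithin_le_nhds ?_
    have : Tendsto (fun δ : ℝ => δ * (q * (|c₀| + 1 + ε) + C)) (𝓝 0) (𝓝 0) := by
      have h2 : Continuous fun δ : ℝ => δ * (q * (|c₀| + 1 + ε) + C) := by fun_prop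
      simpa using h2.tendsto 0
    exact this.eventually_lt_const (by positivity)
  have h2 : ∀ᶠ δ in 𝓝[>] (0 : ℝ), ∀ τ, |τ| ≤ δ → F₀ ((1 + τ) • ω₁) < 0 := by
    have h3 : Tendsto (fun τ : ℝ => F₀ ((1 + τ) • ω₁)) (𝓝 0) (𝓝 (F₀ ω₁)) := by
      have h4 : Continuous fun τ : ℝ => F₀ ((1 + τ) • ω₁) :=
        h.limit_continuous.comp (by fun_prop)
      simpa using h4.tendsto 0
    obtain ⟨r, hr, hrτ⟩ := Metric.eventually_nhds_iff.1 (h3.eventually_lt_const hω)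
    filter_upwards [nhdsWithin_le_nhds (Iio_mem_nhds hr)] with δ hδ τ hτ
    refine hrτ ?_
    rw [Real.dist_eq, sub_zero]
    exact lt_of_le_of_lt hτ hδ
  obtain ⟨δ, ⟨h1, h2, h3⟩, hδ⟩ :=
    ((h1.and (h2.and h.dilation)).and self_mem_nhdsWithin).exists
  have hδ0 : (0 : ℝ) < δ := hδ
  filter_upwards [h3, hβk, h.eventually_level_le (ω₁ := ω₁) one_pos] with k hk hkβ hk1
  set c := FracLap.mountainPassLevel (F k) 0 ω₁ with hc
  obtain ⟨g, hg⟩ := exists_path_lt_of_mountainPassLevel_lt (h.continuous k)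
    (a := 0) (b := ω₁) (M := c + ε / 2) (by linarith)
  -- The dilated path ends at `(1 + δ) • ω₁`, so a segment leads back to `ω₁`. For small `δ` the
  -- functional `F₀` is negative on it, whereas the level of `F k` is positive.
  let g₁ : Path ((1 + δ) • (0 : H)) ((1 + δ) • ω₁) := g.map (continuous_const_smul (1 + δ))
  let g₂ : Path ((1 + δ) • ω₁) ω₁ :=
    { toFun := fun t => (1 + (1 - (t : ℝ)) * δ) • ω₁
      continuous_toFun := by fun_prop
      source' := by simp
      target' := by simp }
  let g₃ : Path (0 : H) ω₁ := (g₁.trans g₂).cast (smul_zero _).symm rfl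
  refine mountainPassLevel_le h.limit_continuous g₃ fun t => ?_
  have ht : g₃ t ∈ range g₁ ∪ range g₂ := by
    rw [← Path.trans_range]
    exact mem_range_self t
  rcases ht with ⟨τ, hτ⟩ | ⟨τ, hτ⟩
  · rw [← hτ]
    have h4 := hk (g τ)
    have h5 := mul_le_mul_of_nonneg_left (hg τ).le (by positivity : 0 ≤ 1 + q * δ)
    have h6 : q * δ * (c + ε / 2) ≤ q * δ * (|c₀| + 1 + ε) := by
      gcongr
      · linarith [le_abs_self c₀]
      · linarith
    change F₀ ((1 + δ) • g τ) ≤ c + ε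
    linarith
  · rw [← hτ]
    have h4 : F₀ ((1 + (1 - (τ : ℝ)) * δ) • ω₁) < 0 := by
      refine h2 _ ?_
      have h5 := τ.2.1
      have h6 := τ.2.2
      rw [abs_of_nonneg (mul_nonneg (by linarith) hδ0.le)]
      exact mul_le_of_le_one_left hδ0.le (by linarith)
    change F₀ ((1 + (1 - (τ : ℝ)) * δ) • ω₁) ≤ c + ε
    linarith [hkβ.2]

theorem tendsto_level (h : MountainPassFamily F₀ F dF q κ C s) (hω : F₀ ω₁ < 0) :
    Tendsto (fun k => FracLap.mountainPassLevel (F k) 0 ω₁) atTop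
      (𝓝 (FracLap.mountainPassLevel F₀ 0 ω₁)) := by
  rw [Metric.tendsto_nhds]
  intro ε hε
  filter_upwards [h.eventually_level_le (ω₁ := ω₁) (half_pos hε),
    h.eventually_le_level hω (half_pos hε)] with k h1 h2
  rw [Real.dist_eq, abs_lt]
  constructor <;> linarith

theorem deriv_eq_zero (h : MountainPassFamily F₀ F dF q κ C s) {k : ℕ} {w : H}
    (hw : w ∈ FracLap.mountainPassSet (F k) 0 ω₁) : dF k w = 0 :=
  (h.hasFDerivAt k w).unique hw.2

theorem eventually_nonempty [CompleteSpace H] (h : MountainPassFamily F₀ F dF q κ C s)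
    (hω : F₀ ω₁ < 0) :
    ∀ᶠ k in atTop, (FracLap.mountainPassSet (F k) 0 ω₁).Nonempty ∧
      0 ∉ FracLap.mountainPassSet (F k) 0 ω₁ ∧
      ∀ w ∈ FracLap.mountainPassSet (F k) 0 ω₁, F k w ≠ 0 := by
  obtain ⟨β, hβ, hβk⟩ := h.exists_pos_le_level hω
  filter_upwards [hβk] with k hk
  have hne : ∀ w ∈ FracLap.mountainPassSet (F k) 0 ω₁, F k w ≠ 0 := by
    intro w hw h0
    have := hw.1
    linarith [hk.2]
  refine ⟨mountainPassSet_nonempty (h.hasFDerivAt k) (h.continuous_deriv k) ?_ ?_ ?_,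
    fun h0 => hne 0 h0 (h.zero k), hne⟩
  · rw [h.zero]; linarith [hk.2]
  · linarith [hk.1, hk.2]
  · intro w hw1 hw2
    obtain ⟨A, hA⟩ := hw1.bddAbove_range
    obtain ⟨A', hA'⟩ := hw2.norm.bddAbove_range
    refine h.compact k w _ (fun j => h.norm_le (k := k) (A := max A 0) (A' := A') ?_ (le_max_right _ _) ?_)
      hw2
    · exact (hA (mem_range_self j)).trans (le_max_left _ _)
    · exact hA' (mem_range_self j)

theorem exists_norm_le (h : MountainPassFamily F₀ F dF q κ C s) {w : ℕ → H}
    (hw : ∀ᶠ k in atTop, w k ∈ FracLap.mountainPassSet (F k) 0 ω₁) : ∃ M, ∀ k, ‖w k‖ ≤ M := by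
  have h1 : ∀ᶠ k in atTop, ‖w k‖ ≤
      1 + (q * max (FracLap.mountainPassLevel F₀ 0 ω₁ + 1) 0 + C + 0) / κ := by
    filter_upwards [hw, h.eventually_level_le (ω₁ := ω₁) one_pos] with k hk hk1
    refine h.norm_le (k := k) ?_ (le_max_right _ _) ?_
    · rw [hk.1]; exact hk1.trans (le_max_left _ _)
    · rw [h.deriv_eq_zero hk, norm_zero]
  obtain ⟨N, hN⟩ := eventually_atTop.1 h1
  refine ⟨max (∑ i ∈ Finset.range N, ‖w i‖)
    (1 + (q * max (FracLap.mountainPassLevel F₀ 0 ω₁ + 1) 0 + C + 0) / κ), fun k => ?_⟩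
  rcases lt_or_ge k N with hk | hk
  · exact le_max_of_le_left (Finset.single_le_sum (f := fun i => ‖w i‖)
      (fun _ _ => norm_nonneg _) (Finset.mem_range.2 hk))
  · exact le_max_of_le_right (hN k hk)

theorem isCompact_closure_range [CompleteSpace H] (h : MountainPassFamily F₀ F dF q κ C s)
    {w : ℕ → H} (hw : ∀ᶠ k in atTop, w k ∈ FracLap.mountainPassSet (F k) 0 ω₁) :
    IsCompact (closure (range w)) := by
  obtain ⟨M, hM⟩ := h.exists_norm_le hw
  rw [isCompact_iff_isSeqCompact]
  intro x hx
  have h1 : ∀ j : ℕ, ∃ i, dist (x j) (w i) < 1 / ((j : ℝ) + 1) := by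
    intro j
    obtain ⟨_, ⟨i, rfl⟩, hi⟩ := Metric.mem_closure_iff.1 (hx j) (1 / ((j : ℝ) + 1))
      Nat.one_div_pos_of_nat
    exact ⟨i, hi⟩
  choose k hk using h1
  obtain ⟨y, φ, hφ, hy⟩ : ∃ y, ∃ φ : ℕ → ℕ, StrictMono φ ∧
      Tendsto (fun j => w (k (φ j))) atTop (𝓝 y) := by
    -- If the indices return infinitely often to a bounded range, one value of the sequence repeats.
    -- Otherwise they tend to infinity and compactness for varying data applies, since the
    -- derivatives eventually vanish.
    by_cases hb : ∃ N, ∃ᶠ j in atTop, k j ∈ Iic N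
    · obtain ⟨N, hN⟩ := hb
      obtain ⟨i, -, φ, hφ, hi⟩ := (finite_Iic N).isCompact.tendsto_subseq' hN
      exact ⟨w i, φ, hφ, ((continuous_of_discreteTopology (f := w)).tendsto i).comp hi⟩
    · push Not at hb
      have hkt : Tendsto k atTop atTop := tendsto_atTop.2 fun N => by
        filter_upwards [hb N] with j hj
        exact (not_le.1 hj).le
      refine h.compact_limit k hkt (fun j => w (k j)) M (fun j => hM _) ?_
      refine tendsto_const_nhds.congr' ?_
      filter_upwards [hkt.eventually hw] with j hj
      rw [h.deriv_eq_zero hj]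
  have h2 : Tendsto (fun j => x (φ j)) atTop (𝓝 y) := by
    refine (tendsto_iff_of_dist ?_).2 hy
    have h3 := (tendsto_one_div_add_atTop_nhds_zero_nat (𝕜 := ℝ)).comp hφ.tendsto_atTop
    exact squeeze_zero (fun _ => dist_nonneg) (fun j => (hk (φ j)).le) h3
  exact ⟨y, isClosed_closure.mem_of_tendsto h2 (Eventually.of_forall fun j => hx _), φ, hφ, h2⟩

/-- Critical points of `F k` at the mountain pass level are bounded, so their values converge to `F₀
x` along the subsequence; they also converge to the level of `F₀` by `tendsto_level`. Criticality of
the limit is the property `closed`. -/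
theorem upperLimit_subset (h : MountainPassFamily F₀ F dF q κ C s) (hω : F₀ ω₁ < 0) :
    FracLap.upperLimit (fun k => FracLap.mountainPassSet (F k) 0 ω₁) ⊆
      FracLap.mountainPassSet F₀ 0 ω₁ := by
  rintro x ⟨w, hw, hx⟩
  obtain ⟨M, hM⟩ := h.exists_norm_le hw
  obtain ⟨φ, hφ, hφx⟩ := hx.tendsto_subseq
  have hw' := hφ.tendsto_atTop.eventually hw
  refine ⟨?_, h.closed φ hφ.tendsto_atTop (w ∘ φ) x hφx ?_⟩
  · have h1 : Tendsto (fun j => F (φ j) (w (φ j)) - F₀ (w (φ j))) atTop (𝓝 0) := by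
      rw [Metric.tendsto_nhds]
      intro ε hε
      filter_upwards [hφ.tendsto_atTop.eventually (h.uniform M (ε / 2) (by positivity))] with j hj
      rw [Real.dist_eq, sub_zero]
      linarith [hj _ (hM (φ j))]
    have h2 : Tendsto (fun j => F (φ j) (w (φ j))) atTop (𝓝 (F₀ x)) := by
      have := h1.add ((h.limit_continuous.tendsto x).comp hφx)
      simpa using! this
    have h3 : Tendsto (fun j => F (φ j) (w (φ j))) atTop
        (𝓝 (FracLap.mountainPassLevel F₀ 0 ω₁)) := by
      refine ((h.tendsto_level hω).comp hφ.tendsto_atTop).congr' ?_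
      filter_upwards [hw'] with j hj
      exact hj.1.symm
    exact tendsto_nhds_unique h2 h3
  · filter_upwards [hw'] with j hj
    exact h.deriv_eq_zero hj

end MountainPassFamily

end Stability

/-! ### Functionals of action with a superlinear potential -/

section Action

variable {P Z V H : Type*} [NormedAddCommGroup P] [NormedAddCommGroup Z] [NormedSpace ℝ Z]
  [NormedAddCommGroup V] [NormedSpace ℝ V] [NormedAddCommGroup H] [InnerProductSpace ℝ H]

/-- Potentials `Φ u`, with derivatives `D u`, that depend in a Lipschitz way on the parameter `u` and
satisfy an integrated form of the Ambrosetti-Rabinowitz condition. -/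
structure SuperlinearFamily (Q : Set P) (Φ : P → Z → ℝ) (D : P → Z → Z →L[ℝ] ℝ) (q : ℝ) :
    Prop where
  two_lt : 2 < q
  hasFDerivAt : ∀ u ∈ Q, ∀ z, HasFDerivAt (Φ u) (D u z) z
  continuous_deriv : ∀ u ∈ Q, Continuous (D u)
  bound : ∀ M, ∃ C, ∀ u ∈ Q, ∀ z, ‖z‖ ≤ M → |Φ u z| ≤ C ∧ ‖D u z‖ ≤ C
  lipschitz : ∃ C, 0 ≤ C ∧ ∀ u ∈ Q, ∀ u' ∈ Q, ∀ z,
    |Φ u z - Φ u' z| ≤ C * (1 + ‖z‖ ^ 2) * ‖u - u'‖ ∧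
    ‖D u z - D u' z‖ ≤ C * (1 + ‖z‖) * ‖u - u'‖
  comparison : ∀ M, ∃ C, 0 < C ∧ ∀ u ∈ Q, ∀ δ, 0 < δ → δ ≤ 1 → ∀ z y y', ‖y‖ ≤ M →
    ‖y - y'‖ ≤ M * δ → (1 + q * δ) * Φ u (z + y) - Φ u ((1 + δ) • z + y') ≤ C * δ

/-- The functional `w ↦ a (‖w‖² / 2 + B v w) - φ(T w + S v) + φ(S v)`. -/
noncomputable def action (a : ℝ) (B : V →L[ℝ] H →L[ℝ] ℝ) (T : H →L[ℝ] Z) (S : V →L[ℝ] Z)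
    (φ : Z → ℝ) (v : V) (w : H) : ℝ :=
  a * (‖w‖ ^ 2 / 2 + B v w) - φ (T w + S v) + φ (S v)

/-- The derivative of `action`. -/
noncomputable def actionDeriv (a : ℝ) (B : V →L[ℝ] H →L[ℝ] ℝ) (T : H →L[ℝ] Z) (S : V →L[ℝ] Z)
    (φ' : Z → Z →L[ℝ] ℝ) (v : V) (w : H) : H →L[ℝ] ℝ :=
  a • (innerSL ℝ w + B v) - (φ' (T w + S v)).comp T

theorem hasFDerivAt_action (a : ℝ) (B : V →L[ℝ] H →L[ℝ] ℝ) (T : H →L[ℝ] Z) (S : V →L[ℝ] Z)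
    {φ : Z → ℝ} {φ' : Z → Z →L[ℝ] ℝ} (hφ : ∀ z, HasFDerivAt φ (φ' z) z) (v : V) (w : H) :
    HasFDerivAt (action a B T S φ v) (actionDeriv a B T S φ' v w) w := by
  have h1 : HasFDerivAt (fun w : H => ‖w‖ ^ 2 / 2) (innerSL ℝ w) w := by
    have := ((hasStrictFDerivAt_norm_sq w).hasFDerivAt).mul_const (1 / 2 : ℝ)
    simp only [mul_one_div] at this
    refine this.congr_fderiv ?_
    ext k
    simp
  have h2 : HasFDerivAt (fun w => φ (T w + S v)) ((φ' (T w + S v)).comp T) w :=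
    (hφ (T w + S v)).comp w (T.hasFDerivAt.add_const (S v))
  exact (((h1.add (B v).hasFDerivAt).const_mul a).sub h2).add_const _

theorem continuous_actionDeriv (a : ℝ) (B : V →L[ℝ] H →L[ℝ] ℝ) (T : H →L[ℝ] Z) (S : V →L[ℝ] Z)
    {φ' : Z → Z →L[ℝ] ℝ} (hφ : Continuous φ') (v : V) :
    Continuous (actionDeriv a B T S φ' v) := by
  have h2 : Continuous fun w => φ' (T w + S v) := hφ.comp (by fun_prop)
  unfold actionDeriv
  exact (((innerSL ℝ).continuous.add continuous_const).const_smul a).sub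
    (h2.clm_comp continuous_const)

namespace SuperlinearFamily

variable {Q : Set P} {Φ : P → Z → ℝ} {D : P → Z → Z →L[ℝ] ℝ} {q : ℝ}

theorem exists_abs_sub_le (h : SuperlinearFamily Q Φ D q) (M : ℝ) :
    ∃ C, 0 ≤ C ∧ ∀ u ∈ Q, ∀ u' ∈ Q, ∀ z z', ‖z‖ ≤ M → ‖z'‖ ≤ M →
      |Φ u z - Φ u' z'| ≤ C * (‖z - z'‖ + ‖u - u'‖) := by
  obtain ⟨C, hC⟩ := h.bound M
  obtain ⟨L, hL, hLu⟩ := h.lipschitz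
  refine ⟨max (|C|) (L * (1 + M ^ 2)), by positivity, fun u hu u' hu' z z' hz hz' => ?_⟩
  have h1 : |Φ u z - Φ u z'| ≤ |C| * ‖z - z'‖ := by
    have := (convex_closedBall (0 : Z) M).norm_image_sub_le_of_norm_hasFDerivWithin_le
      (f := Φ u) (f' := D u) (C := |C|) (x := z') (y := z)
      (fun y _ => (h.hasFDerivAt u hu y).hasFDerivWithinAt)
      (fun y hy => ((hC u hu y (mem_closedBall_zero_iff.1 hy)).2).trans (le_abs_self C))
      (mem_closedBall_zero_iff.2 hz') (mem_closedBall_zero_iff.2 hz)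
    rwa [Real.norm_eq_abs] at this
  have h2 : |Φ u z' - Φ u' z'| ≤ L * (1 + M ^ 2) * ‖u - u'‖ := by
    refine (hLu u hu u' hu' z').1.trans ?_
    gcongr
  have h3 := abs_add_le (Φ u z - Φ u z') (Φ u z' - Φ u' z')
  rw [sub_add_sub_cancel] at h3
  have h4 : |C| * ‖z - z'‖ ≤ max (|C|) (L * (1 + M ^ 2)) * ‖z - z'‖ := by
    gcongr; exact le_max_left _ _
  have h5 : L * (1 + M ^ 2) * ‖u - u'‖ ≤ max (|C|) (L * (1 + M ^ 2)) * ‖u - u'‖ := by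
    gcongr; exact le_max_right _ _
  linarith

theorem exists_abs_action_sub_le (h : SuperlinearFamily Q Φ D q) (a : ℝ)
    (B : V →L[ℝ] H →L[ℝ] ℝ) (T : H →L[ℝ] Z) (S : V →L[ℝ] Z) (M : ℝ) :
    ∃ C, 0 ≤ C ∧ ∀ u ∈ Q, ∀ u' ∈ Q, ∀ v v' w, ‖v‖ ≤ M → ‖v'‖ ≤ M → ‖w‖ ≤ M →
      |action a B T S (Φ u) v w - action a B T S (Φ u') v' w| ≤ C * (‖v - v'‖ + ‖u - u'‖) := by
  obtain ⟨C, hC, hCu⟩ := h.exists_abs_sub_le ((‖T‖ + ‖S‖) * M)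
  refine ⟨|a| * ‖B‖ * |M| + 2 * C * (‖S‖ + 1), by positivity, ?_⟩
  intro u hu u' hu' v v' w hv hv' hw
  have hM : 0 ≤ M := (norm_nonneg _).trans hv
  have hS : ∀ v : V, ‖v‖ ≤ M → ‖S v‖ ≤ ‖S‖ * M := fun v hv => S.le_opNorm_of_le hv
  have hS' : ‖S v‖ ≤ (‖T‖ + ‖S‖) * M := (hS v hv).trans (by gcongr; simp)
  have hS'' : ‖S v'‖ ≤ (‖T‖ + ‖S‖) * M := (hS v' hv').trans (by gcongr; simp)
  have hT : ∀ v : V, ‖v‖ ≤ M → ‖T w + S v‖ ≤ (‖T‖ + ‖S‖) * M := fun v hv => by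
    rw [add_mul]
    exact (norm_add_le _ _).trans (add_le_add (T.le_opNorm_of_le hw) (hS v hv))
  have h1 := hCu u hu u' hu' _ _ (hT v hv) (hT v' hv')
  have h2 := hCu u hu u' hu' _ _ hS' hS''
  rw [add_sub_add_left_eq_sub, ← map_sub] at h1
  rw [← map_sub] at h2
  have h3 : C * (‖S (v - v')‖ + ‖u - u'‖) ≤ C * (‖S‖ + 1) * (‖v - v'‖ + ‖u - u'‖) := by
    have h4 := S.le_opNorm (v - v')
    have h5 : ‖S (v - v')‖ + ‖u - u'‖ ≤ (‖S‖ + 1) * (‖v - v'‖ + ‖u - u'‖) := by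
      have : 0 ≤ ‖S‖ * ‖u - u'‖ := by positivity
      linarith [norm_nonneg (v - v')]
    rw [mul_assoc]
    gcongr
  have h4 : |a * B (v - v') w| ≤ |a| * ‖B‖ * |M| * (‖v - v'‖ + ‖u - u'‖) := by
    have h5 := B.le_opNorm₂ (v - v') w
    rw [abs_mul]
    rw [Real.norm_eq_abs] at h5
    calc |a| * |B (v - v') w| ≤ |a| * (‖B‖ * ‖v - v'‖ * ‖w‖) := by gcongr
      _ ≤ |a| * (‖B‖ * (‖v - v'‖ + ‖u - u'‖) * |M|) := by
          gcongr
          · linarith [norm_nonneg (u - u')]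
          · exact hw.trans (le_abs_self M)
      _ = _ := by ring
  have h5 : action a B T S (Φ u) v w - action a B T S (Φ u') v' w =
      a * B (v - v') w - (Φ u (T w + S v) - Φ u' (T w + S v')) + (Φ u (S v) - Φ u' (S v')) := by
    simp only [action, map_sub, sub_apply]
    ring
  rw [h5]
  have h6 := abs_add_le (a * B (v - v') w - (Φ u (T w + S v) - Φ u' (T w + S v')))
    (Φ u (S v) - Φ u' (S v'))
  have h7 := abs_sub (a * B (v - v') w) (Φ u (T w + S v) - Φ u' (T w + S v'))
  linarith

/-- Since `q > 2`, the quadratic part gains a multiple of `δ * ‖w‖ ^ 2`. This pays for the linear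
term, by Young's inequality, and for the change of parameter, whose cost is quadratic in `w`; hence
the estimate holds for all `w`, bounded or not. -/
theorem exists_action_dilation_le (h : SuperlinearFamily Q Φ D q) {a : ℝ} (ha : 0 < a)
    (B : V →L[ℝ] H →L[ℝ] ℝ) (T : H →L[ℝ] Z) (S : V →L[ℝ] Z) (M : ℝ) :
    ∃ κ C η δ₀ : ℝ, 0 < κ ∧ 0 < C ∧ 0 < η ∧ 0 < δ₀ ∧ ∀ δ, 0 < δ → δ ≤ δ₀ →
      ∀ u ∈ Q, ∀ u' ∈ Q, ∀ v v', ‖v‖ ≤ M → ‖v - v'‖ ≤ δ → ‖u - u'‖ ≤ η * δ → ∀ w : H,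
        action a B T S (Φ u') v' ((1 + δ) • w) ≤
          (1 + q * δ) * action a B T S (Φ u) v w - κ * δ * ‖w‖ ^ 2 + C * δ := by
  have hq := h.two_lt
  set d : ℝ := a * (q - 2) with hd
  have hd0 : 0 < d := mul_pos ha (by linarith)
  set N : ℝ := ‖S‖ * (|M| + 1) with hN
  have hN0 : 0 ≤ N := by positivity
  obtain ⟨C₃, hC₃, hcomp⟩ := h.comparison N
  obtain ⟨L, hL, hLu⟩ := h.lipschitz
  obtain ⟨C₅, hC₅, hC₅u⟩ := h.exists_abs_sub_le N
  obtain ⟨C₆, hC₆⟩ := h.bound N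
  -- Small enough that the change of parameter costs at most `d / 16` times `δ * ‖w‖ ^ 2`.
  set η : ℝ := d / (16 * (8 * L * ‖T‖ ^ 2 + 1)) with hη
  have hη0 : 0 < η := by positivity
  set K : ℝ := a * ‖B‖ * (2 + (q - 1) * |M|) with hK
  have hq1 : 0 ≤ q - 1 := by linarith
  have hK0 : 0 ≤ K := by positivity
  set C : ℝ := 4 * K ^ 2 / d + C₃ + η * (L * (1 + 2 * N ^ 2)) + C₅ * (‖S‖ + η) + q * |C₆| with hC
  -- The quadratic gain is `d / 4`; the linear term and the change of parameter use `d / 16` each.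
  -- The bound `δ ≤ (q - 2) / 2` absorbs the square of `δ` in `(1 + δ) ^ 2`.
  refine ⟨d / 8, C, η, min 1 ((q - 2) / 2), by positivity, by positivity, hη0,
    lt_min one_pos (by linarith), ?_⟩
  intro δ hδ hδ₀ u hu u' hu' v v' hv hvv huu w
  have hδ1 : δ ≤ 1 := hδ₀.trans (min_le_left _ _)
  have hδq : δ ≤ (q - 2) / 2 := hδ₀.trans (min_le_right _ _)
  have hvM : ‖v‖ ≤ |M| := hv.trans (le_abs_self M)
  have hv' : ‖v'‖ ≤ |M| + 1 := by
    have := norm_sub_le v (v - v')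
    rw [sub_sub_cancel] at this
    linarith
  have hSv : ‖S v‖ ≤ N := S.le_opNorm_of_le (by linarith)
  have hSv' : ‖S v'‖ ≤ N := S.le_opNorm_of_le hv'
  have hSS : ‖S v - S v'‖ ≤ ‖S‖ * δ := by
    rw [← map_sub]; exact S.le_opNorm_of_le hvv
  have hw := norm_nonneg w
  -- the quadratic part
  have e1 : a / 2 * ‖w‖ ^ 2 * ((1 + δ) ^ 2 - 1 - q * δ) ≤ -(d / 4) * δ * ‖w‖ ^ 2 := by
    have h1 : (1 + δ) ^ 2 - 1 - q * δ ≤ -((q - 2) / 2 * δ) := by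
      have : δ * δ ≤ (q - 2) / 2 * δ := by gcongr
      linarith [this]
    have h2 := mul_le_mul_of_nonneg_left h1 (by positivity : 0 ≤ a / 2 * ‖w‖ ^ 2)
    refine h2.trans_eq ?_
    rw [hd]; ring
  -- the linear part
  have e2 : a * (B v' ((1 + δ) • w) - (1 + q * δ) * B v w) ≤ K * δ * ‖w‖ := by
    have h1 : B v' ((1 + δ) • w) - (1 + q * δ) * B v w =
        -((1 + δ) * B (v - v') w) - (q - 1) * δ * B v w := by
      simp only [map_smul, smul_eq_mul, map_sub, sub_apply]; ring
    have h2 : -(B (v - v') w) ≤ ‖B‖ * δ * ‖w‖ := by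
      have h3 := B.le_opNorm₂ (v - v') w
      rw [Real.norm_eq_abs] at h3
      have h4 : ‖B‖ * ‖v - v'‖ * ‖w‖ ≤ ‖B‖ * δ * ‖w‖ := by gcongr
      linarith [neg_abs_le (B (v - v') w)]
    have h3 : -(B v w) ≤ ‖B‖ * |M| * ‖w‖ := by
      have h3 := B.le_opNorm₂ v w
      rw [Real.norm_eq_abs] at h3
      have h4 : ‖B‖ * ‖v‖ * ‖w‖ ≤ ‖B‖ * |M| * ‖w‖ := by gcongr
      linarith [neg_abs_le (B v w)]
    have h4 : (1 + δ) * -(B (v - v') w) ≤ 2 * (‖B‖ * δ * ‖w‖) := by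
      refine (mul_le_mul_of_nonneg_left h2 (by positivity)).trans ?_
      gcongr
      linarith
    have h5 := mul_le_mul_of_nonneg_left h3 (by positivity : 0 ≤ (q - 1) * δ)
    have h6 : B v' ((1 + δ) • w) - (1 + q * δ) * B v w ≤
        2 * (‖B‖ * δ * ‖w‖) + (q - 1) * δ * (‖B‖ * |M| * ‖w‖) := by
      rw [h1]; linarith
    refine (mul_le_mul_of_nonneg_left h6 ha.le).trans_eq ?_
    rw [hK]; ring
  have e2' : K * δ * ‖w‖ ≤ δ * (d / 16 * ‖w‖ ^ 2 + 4 * K ^ 2 / d) := by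
    have h1 : K * ‖w‖ ≤ d / 16 * ‖w‖ ^ 2 + 4 * K ^ 2 / d := by
      have h2 : d / 16 * ‖w‖ ^ 2 + 4 * K ^ 2 / d - K * ‖w‖ =
          (d * ‖w‖ - 8 * K) ^ 2 / (16 * d) := by
        field_simp; ring
      have h3 : 0 ≤ (d * ‖w‖ - 8 * K) ^ 2 / (16 * d) := by positivity
      linarith
    have := mul_le_mul_of_nonneg_left h1 hδ.le
    linarith
  -- the potentials
  have e3 := hcomp u hu δ hδ hδ1 (T w) (S v) (S v') hSv (hSS.trans (by
    rw [hN]; gcongr; exact le_mul_of_one_le_right (norm_nonneg _) (by linarith [abs_nonneg M])))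
  set z' : Z := (1 + δ) • T w + S v' with hz'
  have e4 : |Φ u z' - Φ u' z'| ≤ δ * (d / 16 * ‖w‖ ^ 2 + η * (L * (1 + 2 * N ^ 2))) := by
    have h1 : ‖z'‖ ≤ 2 * (‖T‖ * ‖w‖) + N := by
      refine (norm_add_le _ _).trans (add_le_add ?_ hSv')
      rw [norm_smul, Real.norm_eq_abs, abs_of_pos (by positivity)]
      exact mul_le_mul (by linarith) (T.le_opNorm w) (norm_nonneg _) zero_le_two
    have h2 : ‖z'‖ ^ 2 ≤ 8 * ‖T‖ ^ 2 * ‖w‖ ^ 2 + 2 * N ^ 2 := by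
      have h3 : ‖z'‖ ^ 2 ≤ (2 * (‖T‖ * ‖w‖) + N) ^ 2 := by gcongr
      have h4 := sq_nonneg (2 * (‖T‖ * ‖w‖) - N)
      linarith
    have h3 : 8 * L * ‖T‖ ^ 2 * η ≤ d / 16 := by
      have h4 : (8 * L * ‖T‖ ^ 2 + 1) * η = d / 16 := by
        rw [hη]; field_simp
      linarith
    calc |Φ u z' - Φ u' z'| ≤ L * (1 + ‖z'‖ ^ 2) * ‖u - u'‖ := (hLu u hu u' hu' z').1
      _ ≤ L * (1 + (8 * ‖T‖ ^ 2 * ‖w‖ ^ 2 + 2 * N ^ 2)) * (η * δ) := by gcongr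
      _ = δ * (8 * L * ‖T‖ ^ 2 * η * ‖w‖ ^ 2 + η * (L * (1 + 2 * N ^ 2))) := by ring
      _ ≤ _ := by gcongr
  have e5 : Φ u' (S v') - Φ u (S v) ≤ δ * (C₅ * (‖S‖ + η)) := by
    have h1 := hC₅u u hu u' hu' _ _ hSv hSv'
    have h2 : C₅ * (‖S v - S v'‖ + ‖u - u'‖) ≤ C₅ * (‖S‖ * δ + η * δ) := by gcongr
    have h3 := neg_abs_le (Φ u (S v) - Φ u' (S v'))
    linarith
  have e6 : -(q * δ * Φ u (S v)) ≤ δ * (q * |C₆|) := by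
    have h1 := (hC₆ u hu _ hSv).1
    have h2 : -(Φ u (S v)) ≤ |C₆| := by
      linarith [neg_abs_le (Φ u (S v)), le_abs_self C₆]
    have h3 := mul_le_mul_of_nonneg_left h2 (by positivity : 0 ≤ q * δ)
    linarith
  have e7 : action a B T S (Φ u') v' ((1 + δ) • w) - (1 + q * δ) * action a B T S (Φ u) v w =
      a / 2 * ‖w‖ ^ 2 * ((1 + δ) ^ 2 - 1 - q * δ) +
      a * (B v' ((1 + δ) • w) - (1 + q * δ) * B v w) +
      ((1 + q * δ) * Φ u (T w + S v) - Φ u z') + (Φ u z' - Φ u' z') +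
      (Φ u' (S v') - Φ u (S v)) + -(q * δ * Φ u (S v)) := by
    have h1 : T ((1 + δ) • w) + S v' = z' := by rw [hz', map_smul]
    have h2 : ‖(1 + δ) • w‖ = (1 + δ) * ‖w‖ := by
      rw [norm_smul, Real.norm_eq_abs, abs_of_pos (by positivity)]
    simp only [action, h1, h2]
    ring
  have e8 := le_abs_self (Φ u z' - Φ u' z')
  have e9 : C * δ = δ * (4 * K ^ 2 / d) + C₃ * δ + δ * (η * (L * (1 + 2 * N ^ 2))) +
      δ * (C₅ * (‖S‖ + η)) + δ * (q * |C₆|) := by rw [hC]; ring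
  linarith

/-- The dilation inequality with equal data is an equality at `δ = 0` apart from terms of order `δ`;
dividing by `δ` and letting it tend to zero from the right gives the derivative along `w`. -/
theorem actionDeriv_apply_self_le (h : SuperlinearFamily Q Φ D q) {a : ℝ}
    {B : V →L[ℝ] H →L[ℝ] ℝ} {T : H →L[ℝ] Z} {S : V →L[ℝ] Z} {κ C δ₀ : ℝ} (hδ₀ : 0 < δ₀) {u : P}
    (hu : u ∈ Q) {v : V} {w : H}
    (hd : ∀ δ, 0 < δ → δ ≤ δ₀ → action a B T S (Φ u) v ((1 + δ) • w) ≤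
      (1 + q * δ) * action a B T S (Φ u) v w - κ * δ * ‖w‖ ^ 2 + C * δ) :
    actionDeriv a B T S (D u) v w w ≤ q * action a B T S (Φ u) v w - κ * ‖w‖ ^ 2 + C := by
  have h1 : HasDerivAt (fun δ : ℝ => action a B T S (Φ u) v ((1 + δ) • w))
      (actionDeriv a B T S (D u) v w w) 0 := by
    have h2 : HasDerivAt (fun δ : ℝ => (1 + δ) • w) w 0 := by
      simpa using ((hasDerivAt_id (0 : ℝ)).const_add 1).smul_const w
    have h3 := hasFDerivAt_action a B T S (h.hasFDerivAt u hu) v ((1 + (0 : ℝ)) • w)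
    have h4 := h3.comp_hasDerivAt (0 : ℝ) h2
    simpa using! h4
  have h2 := h1.tendsto_slope.mono_left (nhdsWithin_mono (0 : ℝ)
    (fun x (hx : x ∈ Ioi 0) => ne_of_gt hx))
  refine le_of_tendsto h2 ?_
  filter_upwards [self_mem_nhdsWithin, nhdsWithin_le_nhds (Iic_mem_nhds hδ₀)] with δ hδ hδ1
  have hδ0 : (0 : ℝ) < δ := hδ
  rw [slope_def_field, sub_zero, div_le_iff₀ hδ0, add_zero, one_smul]
  linarith [hd δ hδ0 hδ1]

theorem tendsto_deriv (h : SuperlinearFamily Q Φ D q) {u : ℕ → P} {u₀ : P} {z : ℕ → Z} {z₀ : Z}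
    (hu : ∀ j, u j ∈ Q) (hu₀ : u₀ ∈ Q) (hlim : Tendsto u atTop (𝓝 u₀))
    (hz : Tendsto z atTop (𝓝 z₀)) :
    Tendsto (fun j => D (u j) (z j)) atTop (𝓝 (D u₀ z₀)) := by
  obtain ⟨L, hL, hLu⟩ := h.lipschitz
  have h1 : Tendsto (fun j => D u₀ (z j)) atTop (𝓝 (D u₀ z₀)) :=
    ((h.continuous_deriv u₀ hu₀).tendsto z₀).comp hz
  have h2 : Tendsto (fun j => D (u j) (z j) - D u₀ (z j)) atTop (𝓝 0) := by
    refine squeeze_zero_norm (fun j => (hLu _ (hu j) _ hu₀ (z j)).2) ?_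
    have h3 := (((hz.norm.const_add 1).const_mul L)).mul (tendsto_iff_norm_sub_tendsto_zero.1 hlim)
    simpa using h3
  simpa using h2.add h1

theorem tendsto_actionDeriv (h : SuperlinearFamily Q Φ D q) (a : ℝ)
    (B : V →L[ℝ] H →L[ℝ] ℝ) (T : H →L[ℝ] Z) (S : V →L[ℝ] Z) {u : ℕ → P} {u₀ : P} {v : ℕ → V}
    {v₀ : V} {w : ℕ → H} {w₀ : H} (hu : ∀ j, u j ∈ Q) (hu₀ : u₀ ∈ Q)
    (hul : Tendsto u atTop (𝓝 u₀)) (hvl : Tendsto v atTop (𝓝 v₀))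
    (hwl : Tendsto w atTop (𝓝 w₀)) :
    Tendsto (fun j => actionDeriv a B T S (D (u j)) (v j) (w j)) atTop
      (𝓝 (actionDeriv a B T S (D u₀) v₀ w₀)) := by
  have h1 : Tendsto (fun j => T (w j) + S (v j)) atTop (𝓝 (T w₀ + S v₀)) :=
    ((T.continuous.tendsto _).comp hwl).add ((S.continuous.tendsto _).comp hvl)
  have h2 := h.tendsto_deriv hu hu₀ hul h1
  have h3 : Tendsto (fun j => (D (u j) (T (w j) + S (v j))).comp T) atTop
      (𝓝 ((D u₀ (T w₀ + S v₀)).comp T)) := by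
    have h4 : Continuous fun L : Z →L[ℝ] ℝ => L.comp T := continuous_id.clm_comp continuous_const
    exact (h4.tendsto _).comp h2
  exact (((((innerSL ℝ).continuous.tendsto _).comp hwl).add
    ((B.continuous.tendsto _).comp hvl)).const_smul a).sub h3

/-- A weakly convergent subsequence converges in norm, because the derivative is the identity plus
terms that vanish when tested with the difference from the weak limit: the potential by compactness
of `T`, the linear term by strong convergence of the data. The parameters need not converge. -/
theorem exists_convergent_subseq [CompleteSpace H] [TopologicalSpace.SeparableSpace H]
    (h : SuperlinearFamily Q Φ D q) {a : ℝ} (ha : 0 < a)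
    (B : V →L[ℝ] H →L[ℝ] ℝ) {T : H →L[ℝ] Z} (S : V →L[ℝ] Z)
    (hT : ∀ (k : ℕ → H) (M : ℝ), (∀ j, ‖k j‖ ≤ M) →
      (∀ L : H →L[ℝ] ℝ, Tendsto (fun j => L (k j)) atTop (𝓝 0)) →
      Tendsto (fun j => T (k j)) atTop (𝓝 0))
    {u : ℕ → P} {v : ℕ → V} {v₀ : V} {w : ℕ → H} {M : ℝ} (hu : ∀ j, u j ∈ Q)
    (hvl : Tendsto v atTop (𝓝 v₀)) (hw : ∀ j, ‖w j‖ ≤ M)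
    (hd : Tendsto (fun j => actionDeriv a B T S (D (u j)) (v j) (w j)) atTop (𝓝 0)) :
    ∃ x, ∃ φ : ℕ → ℕ, StrictMono φ ∧ Tendsto (w ∘ φ) atTop (𝓝 x) := by
  obtain ⟨x, φ, hφ, hx⟩ := exists_weakly_convergent_subseq hw
  refine ⟨x, φ, hφ, ?_⟩
  set k : ℕ → H := fun j => w (φ j) - x with hk
  have hkM : ∀ j, ‖k j‖ ≤ M + ‖x‖ := fun j =>
    (norm_sub_le _ _).trans (by linarith [hw (φ j)])
  have hk0 : ∀ L : H →L[ℝ] ℝ, Tendsto (fun j => L (k j)) atTop (𝓝 0) := by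
    intro L
    have := (hx L).sub_const (L x)
    simpa [hk] using this
  have hTk := hT k _ hkM hk0
  have hvφ := hvl.comp hφ.tendsto_atTop
  obtain ⟨A, hA⟩ := hvl.norm.bddAbove_range
  obtain ⟨C, hC⟩ := h.bound (‖T‖ * M + ‖S‖ * A)
  have t1 : Tendsto (fun j => actionDeriv a B T S (D (u (φ j))) (v (φ j)) (w (φ j)) (k j)) atTop
      (𝓝 0) := by
    refine squeeze_zero_norm (a := fun j =>
      ‖actionDeriv a B T S (D (u (φ j))) (v (φ j)) (w (φ j))‖ * (M + ‖x‖)) (fun j => ?_) ?_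
    · exact (ContinuousLinearMap.le_opNorm _ _).trans
        (mul_le_mul_of_nonneg_left (hkM j) (norm_nonneg _))
    · have := ((hd.comp hφ.tendsto_atTop).norm).mul_const (M + ‖x‖)
      simpa using! this
  have t2 : Tendsto (fun j => B (v (φ j)) (k j)) atTop (𝓝 0) := by
    have h1 : Tendsto (fun j => B (v (φ j) - v₀) (k j)) atTop (𝓝 0) := by
      refine squeeze_zero_norm (a := fun j => ‖B‖ * ‖v (φ j) - v₀‖ * (M + ‖x‖)) (fun j => ?_) ?_
      · exact (B.le_opNorm₂ _ _).trans (mul_le_mul_of_nonneg_left (hkM j) (by positivity))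
      · have := ((tendsto_iff_norm_sub_tendsto_zero.1 hvφ).const_mul ‖B‖).mul_const (M + ‖x‖)
        simpa using! this
    have h2 := h1.add (hk0 (B v₀))
    simpa using h2
  have t3 : Tendsto (fun j => D (u (φ j)) (T (w (φ j)) + S (v (φ j))) (T (k j))) atTop (𝓝 0) := by
    refine squeeze_zero_norm (a := fun j => C * ‖T (k j)‖) (fun j => ?_) ?_
    · refine (ContinuousLinearMap.le_opNorm _ _).trans
        (mul_le_mul_of_nonneg_right ?_ (norm_nonneg _))
      refine (hC _ (hu (φ j)) _ ?_).2
      exact (norm_add_le _ _).trans (add_le_add (T.le_opNorm_of_le (hw (φ j)))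
        (S.le_opNorm_of_le (hA (mem_range_self (φ j)))))
    · simpa using hTk.norm.const_mul C
  have t4 := hk0 (innerSL ℝ x)
  -- The formula of `actionDeriv`, evaluated at `k j` and solved for the quadratic term.
  have h1 : ∀ j, ‖k j‖ ^ 2 = a⁻¹ * (actionDeriv a B T S (D (u (φ j))) (v (φ j)) (w (φ j)) (k j) -
      a * B (v (φ j)) (k j) + D (u (φ j)) (T (w (φ j)) + S (v (φ j))) (T (k j))) -
      innerSL ℝ x (k j) := by
    intro j
    have h2 : ‖k j‖ ^ 2 = inner ℝ (w (φ j)) (k j) - inner ℝ x (k j) := by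
      rw [← real_inner_self_eq_norm_sq, ← inner_sub_left]
    rw [h2]
    simp only [actionDeriv, sub_apply, smul_apply,
      add_apply, innerSL_apply_apply, ContinuousLinearMap.comp_apply,
      smul_eq_mul]
    field_simp
    ring
  have h2 : Tendsto (fun j => ‖k j‖ ^ 2) atTop (𝓝 0) := by
    simp only [h1]
    have := (((t1.sub (t2.const_mul a)).add t3).const_mul a⁻¹).sub t4
    simpa using this
  have h3 : Tendsto (fun j => ‖k j‖) atTop (𝓝 0) := by
    have := (Real.continuous_sqrt.tendsto 0).comp h2
    rw [Real.sqrt_zero] at this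
    refine this.congr fun j => ?_
    simp [Real.sqrt_sq (norm_nonneg _)]
  exact tendsto_iff_norm_sub_tendsto_zero.2 h3

theorem exists_mountainPassFamily [CompleteSpace H] [TopologicalSpace.SeparableSpace H]
    (h : SuperlinearFamily Q Φ D q) {a : ℝ} (ha : 0 < a)
    (B : V →L[ℝ] H →L[ℝ] ℝ) {T : H →L[ℝ] Z} (S : V →L[ℝ] Z)
    (hT : ∀ (k : ℕ → H) (M : ℝ), (∀ j, ‖k j‖ ≤ M) →
      (∀ L : H →L[ℝ] ℝ, Tendsto (fun j => L (k j)) atTop (𝓝 0)) →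
      Tendsto (fun j => T (k j)) atTop (𝓝 0))
    {u : ℕ → P} {u₀ : P} {v : ℕ → V} {v₀ : V} (hu : ∀ j, u j ∈ Q) (hu₀ : u₀ ∈ Q)
    (hul : Tendsto u atTop (𝓝 u₀)) (hvl : Tendsto v atTop (𝓝 v₀)) {κ₀ C₀ s : ℝ} (hs : 2 < s)
    (hκ₀ : 0 < κ₀)
    (hlow : ∀ w, κ₀ * ‖w‖ ^ 2 - C₀ * ‖w‖ ^ s ≤ action a B T S (Φ u₀) v₀ w) :
    ∃ κ C, MountainPassFamily (action a B T S (Φ u₀) v₀)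
      (fun k => action a B T S (Φ (u k)) (v k))
      (fun k => actionDeriv a B T S (D (u k)) (v k)) q κ C s := by
  obtain ⟨A, hA⟩ := hvl.norm.bddAbove_range
  have hvA : ∀ k, ‖v k‖ ≤ A := fun k => hA (mem_range_self k)
  have hv₀A : ‖v₀‖ ≤ A := le_of_tendsto hvl.norm (Eventually.of_forall hvA)
  obtain ⟨κ, C, η, δ₀, hκ, hC, hη, hδ₀, hdil⟩ := h.exists_action_dilation_le ha B T S A
  have hvn := tendsto_iff_norm_sub_tendsto_zero.1 hvl
  have hun := tendsto_iff_norm_sub_tendsto_zero.1 hul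
  refine ⟨min κ κ₀, max C C₀, by linarith [h.two_lt], lt_min hκ hκ₀, lt_max_of_lt_left hC, hs,
    ?_, ?_, fun k => hasFDerivAt_action a B T S (h.hasFDerivAt _ (hu k)) _,
    fun k => continuous_actionDeriv a B T S (h.continuous_deriv _ (hu k)) _, ?_, ?_, ?_, ?_, ?_,
    ?_, ?_⟩
  · intro k; simp [action]
  · exact continuous_iff_continuousAt.2 fun w =>
      (hasFDerivAt_action a B T S (h.hasFDerivAt _ hu₀) _ w).continuousAt
  · intro M ε hε
    obtain ⟨K, hK, hKu⟩ := h.exists_abs_action_sub_le a B T S (max M A)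
    have h1 : Tendsto (fun k => K * (‖v k - v₀‖ + ‖u k - u₀‖)) atTop (𝓝 0) := by
      simpa using (hvn.add hun).const_mul K
    filter_upwards [h1.eventually_lt_const hε] with k hk w hw
    exact (hKu _ (hu k) _ hu₀ _ _ _ ((hvA k).trans (le_max_right _ _))
      (hv₀A.trans (le_max_right _ _)) (hw.trans (le_max_left _ _))).trans hk.le
  · intro w
    have h1 : min κ κ₀ * ‖w‖ ^ 2 ≤ κ₀ * ‖w‖ ^ 2 := by gcongr; exact min_le_right _ _
    have h2 : C₀ * ‖w‖ ^ s ≤ max C C₀ * ‖w‖ ^ s := by gcongr; exact le_max_right _ _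
    linarith [hlow w]
  · filter_upwards [self_mem_nhdsWithin, nhdsWithin_le_nhds (Iic_mem_nhds hδ₀)] with δ hδ hδ1
    have hδ0 : (0 : ℝ) < δ := hδ
    filter_upwards [hvn.eventually_lt_const hδ0,
      hun.eventually_lt_const (by positivity : 0 < η * δ)] with k hk1 hk2 w
    have h1 := hdil δ hδ0 hδ1 (u k) (hu k) u₀ hu₀ (v k) v₀ (hvA k) hk1.le hk2.le w
    have h2 : C * δ ≤ max C C₀ * δ := by gcongr; exact le_max_left _ _
    have h3 : 0 ≤ κ * δ * ‖w‖ ^ 2 := by positivity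
    linarith
  · intro k w
    -- Here the dilation estimate is used with both data equal to those of index `k`; its constants
    -- depend only on the common bound `A`, which makes the result uniform in `k`.
    have h1 := h.actionDeriv_apply_self_le (a := a) (B := B) (T := T) (S := S) (κ := κ) (C := C)
      hδ₀ (hu k) (v := v k) (w := w) fun δ hδ hδ1 =>
        hdil δ hδ hδ1 (u k) (hu k) (u k) (hu k) (v k) (v k) (hvA k) (by simpa using hδ.le)
          (by rw [sub_self, norm_zero]; positivity) w
    have h2 : min κ κ₀ * ‖w‖ ^ 2 ≤ κ * ‖w‖ ^ 2 := by gcongr; exact min_le_left _ _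
    linarith [le_max_left C C₀]
  · intro k w M hw hd
    exact h.exists_convergent_subseq ha B S hT (fun _ => hu k) tendsto_const_nhds hw hd
  · intro k hk w M hw hd
    exact h.exists_convergent_subseq ha B S hT (fun j => hu (k j)) (hvl.comp hk) hw hd
  · intro k hk w x hx hd
    have h1 := h.tendsto_actionDeriv a B T S (fun j => hu (k j)) hu₀ (hul.comp hk) (hvl.comp hk) hx
    have h2 : actionDeriv a B T S (D u₀) v₀ x = 0 :=
      tendsto_nhds_unique h1 (tendsto_const_nhds.congr' (hd.mono fun j hj => hj.symm))
    rw [← h2]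
    exact hasFDerivAt_action a B T S (h.hasFDerivAt _ hu₀) _ x

end SuperlinearFamily

end Action

/-! ### The shifted action functional -/

theorem exists_bilinear_bound {V H : Type*} [NormedAddCommGroup V] [NormedSpace ℝ V]
    [NormedAddCommGroup H] [NormedSpace ℝ H] (B : V →L[ℝ] H →L[ℝ] ℝ) :
    ∃ b, 0 ≤ b ∧ ∀ v w, |B v w| ≤ b * ‖v‖ * ‖w‖ :=
  ⟨‖B‖, norm_nonneg B, fun v w => B.le_opNorm₂ v w⟩

namespace FracLap

variable {n m : ℕ} {Ω : BoundedLipschitzDomain n} {α : ℝ}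

theorem normConst_pos (hα₀ : 0 < α) (hα₂ : α < 2) : 0 < normConst n α := by
  have h1 : 0 < Real.Gamma (((n : ℝ) + α) / 2) := Real.Gamma_pos_of_pos (by positivity)
  have h2 : 0 < Real.Gamma (1 - α / 2) := Real.Gamma_pos_of_pos (by linarith)
  unfold normConst
  positivity

theorem ae_norm_le_norm {V X : Type*} [NormedAddCommGroup V] [MeasurableSpace X] {μ : Measure X}
    (u : Lp V ∞ μ) : ∀ᵐ x ∂μ, ‖u x‖ ≤ ‖u‖ := by
  rw [Lp.norm_def, toReal_eLpNorm (Lp.aestronglyMeasurable u)]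
  exact ae_le_lpNorm_exponent_top (Lp.memLp u)

instance : IsFiniteMeasure Ω.vol := ⟨by
  rw [Measure.restrict_apply_univ]; exact Ω.isBounded.measure_lt_top⟩

theorem vol_ne_zero (Ω : BoundedLipschitzDomain n) : Ω.vol ≠ 0 := by
  rw [Ne, Measure.restrict_eq_zero]
  exact (Ω.isOpen.measure_pos volume Ω.isConnected.nonempty).ne'

/-- The form of `Y` and `X₀` as a bounded bilinear map. -/
theorem exists_form_clm [NeZero n] (Ω : BoundedLipschitzDomain n) (α : ℝ) :
    ∃ B : Y Ω α →L[ℝ] X0 Ω α →L[ℝ] ℝ, ∀ v w, B v w = gagliardoForm Ω α v (X0.toY w) := by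
  let f : Y Ω α →L[ℝ] Lp ℝ 2 (volume.restrict Ω.Q) :=
    LinearMap.mkContinuous Y.quot 1 fun v => by
      rw [one_mul, Y.norm_def]
      exact le_add_of_nonneg_left (norm_nonneg _)
  let g : X0 Ω α →L[ℝ] Lp ℝ 2 (volume.restrict Ω.Q) :=
    LinearMap.mkContinuous (Y.quot ∘ₗ X0.toY) 1 fun w => by
      rw [one_mul]
      exact (X0.norm_def w).ge
  refine ⟨(innerSL ℝ).bilinearComp f g, fun v w => ?_⟩
  rw [← Y.inner_quot]
  rfl

theorem shiftedAction_eq_action [NeZero n] {Z : Type*} [NormedAddCommGroup Z] [NormedSpace ℝ Z]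
    {G : E n → ℝ → E m → ℝ} {u : Lp (E m) ∞ Ω.vol}
    {B : Y Ω α →L[ℝ] X0 Ω α →L[ℝ] ℝ} (hB : ∀ v w, B v w = gagliardoForm Ω α v (X0.toY w))
    {T : X0 Ω α →L[ℝ] Z} {S : Y Ω α →L[ℝ] Z} {φ : Z → ℝ} {v : Y Ω α}
    (hφ₁ : ∀ w, φ (T w + S v) = ∫ x in Ω.carrier, G x (w x + v x) (u x))
    (hφ₂ : φ (S v) = ∫ x in Ω.carrier, G x (v x) (u x)) :
    shiftedAction Ω α G u v = action (normConst n α) B T S φ v := by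
  funext w
  rw [shiftedAction, action, hφ₁, hφ₂, hB, gagliardoForm]
  congr 4
  rw [← real_inner_self_eq_norm_sq, X0.inner_eq, gagliardoForm, ← integral_div]
  refine integral_congr_ae (Eventually.of_forall fun p => ?_)
  simp only [sq_abs]
  rw [pow_two, div_div, mul_comm (2 : ℝ)]

section Nonlinearity

variable {U : Set (E m)} {l₂ : ℝ} {G Gz : E n → ℝ → E m → ℝ} {s c : ℝ}

theorem ae_mem_of_mem_parameters {u : Lp (E m) ∞ Ω.vol} (hu : u ∈ parameters Ω U l₂) :
    ∀ᵐ x ∂Ω.vol, u x ∈ U ∩ Metric.closedBall 0 l₂ := by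
  filter_upwards [hu.1, ae_norm_le_norm u] with x h1 h2
  exact ⟨h1, mem_closedBall_zero_iff.2 (h2.trans hu.2)⟩

theorem nonempty_of_mem_parameters {u : Lp (E m) ∞ Ω.vol} (hu : u ∈ parameters Ω U l₂) :
    U.Nonempty := by
  have : (ae Ω.vol).NeBot := ae_neBot.2 (vol_ne_zero Ω)
  obtain ⟨x, hx⟩ := hu.1.exists
  exact ⟨_, hx⟩

theorem subcriticalPair (hGz : IsPartialDeriv Ω G Gz)
    (hC1 : IsCaratheodory Ω G ∧ IsCaratheodory Ω Gz) (hc : 0 ≤ c)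
    (hgr : ∀ᵐ x ∂Ω.vol, ∀ z : ℝ, ∀ u ∈ U ∩ Metric.closedBall 0 l₂,
      |G x z u| ≤ c * (1 + |z| ^ s) ∧ |Gz x z u| ≤ c * (1 + |z| ^ (s - 1)))
    {u : Lp (E m) ∞ Ω.vol} (hu : u ∈ parameters Ω U l₂) :
    SubcriticalPair Ω.vol s c (fun x t => G x t (u x)) (fun x t => Gz x t (u x)) where
  nonneg := hc
  meas z hz := hC1.1.aemeasurable_comp hz (Lp.stronglyMeasurable u).measurable
  meas_deriv z hz := hC1.2.aemeasurable_comp hz (Lp.stronglyMeasurable u).measurable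
  hasDerivAt := by
    filter_upwards [hGz] with x hx t
    exact hx t (u x)
  continuous_deriv := by
    filter_upwards [hC1.2.2] with x hx
    exact hx.comp (by fun_prop : Continuous fun t : ℝ => (t, u x))
  growth := by
    filter_upwards [hgr, ae_mem_of_mem_parameters hu] with x h1 h2 t
    exact (h1 t _ h2).1
  growth_deriv := by
    filter_upwards [hgr, ae_mem_of_mem_parameters hu] with x h1 h2 t
    exact (h1 t _ h2).2

theorem exists_superlinearFamily [Fact (1 ≤ ENNReal.ofReal s)] (hs : 2 < s)
    (hGz : IsPartialDeriv Ω G Gz)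
    (hC1 : IsCaratheodory Ω G ∧ IsCaratheodory Ω Gz) (hc : 0 ≤ c)
    (hgr : ∀ᵐ x ∂Ω.vol, ∀ z : ℝ, ∀ u ∈ U ∩ Metric.closedBall 0 l₂,
      |G x z u| ≤ c * (1 + |z| ^ s) ∧ |Gz x z u| ≤ c * (1 + |z| ^ (s - 1)))
    (hC3 : Superlinear Ω U G Gz) (hC5 : LipschitzInParameter Ω U G Gz) (hU : U.Nonempty) :
    ∃ D q, SuperlinearFamily (parameters Ω U l₂)
      (fun u (z : Lp ℝ (ENNReal.ofReal s) Ω.vol) => ∫ x, G x (z x) (u x) ∂Ω.vol) D q := by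
  have hs0 : 0 < s := by linarith
  have hs' : s.HolderConjugate s.conjExponent := .conjExponent (by linarith)
  have : Fact (1 ≤ ENNReal.ofReal s.conjExponent) :=
    ⟨ENNReal.one_le_ofReal.2 hs'.symm.lt.le⟩
  have hpair : ∀ u ∈ parameters Ω U l₂,
      SubcriticalPair Ω.vol s c (fun x t => G x t (u x)) (fun x t => Gz x t (u x)) :=
    fun u hu => subcriticalPair hGz hC1 hc hgr hu
  choose! D hDint hDder hDcont hDbound using
    fun (u : Lp (E m) ∞ Ω.vol) (hu : u ∈ parameters Ω U l₂) => (hpair u hu).exists_fderiv hs'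
  obtain ⟨p, a, R, hp, ha, hR, hsup⟩ := hC3
  -- The midpoint between 2 and `p`: larger than 2 for the gain in the quadratic part, smaller than
  -- `p` to leave room for the shift of the data.
  refine ⟨D, (p + 2) / 2, by linarith, hDder, hDcont, ?_, ?_, ?_⟩
  · intro M
    refine ⟨max (c * (Ω.vol.real univ + M ^ s))
      (((2 * c) ^ s.conjExponent * (Ω.vol.real univ + M ^ s)) ^ (1 / s.conjExponent)), ?_⟩
    intro u hu z hz
    have h0 : 0 < s.conjExponent := hs'.symm.pos
    constructor
    · refine ((hpair u hu).abs_integral_le hs0 z).trans (le_max_of_le_left ?_)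
      gcongr
    · refine (hDbound u hu z).trans (le_max_of_le_right ?_)
      gcongr
  · obtain ⟨u₀, hu₀⟩ := hU
    -- The radius is large enough for the ball around `u₀` to contain the essential ranges of all
    -- parameters, so a single Lipschitz constant serves.
    obtain ⟨c₅, hc₅, hG⟩ := hC5 u₀ hu₀ (‖u₀‖ + |l₂| + 1) (by positivity)
    obtain ⟨K, hK, hKz⟩ := exists_abs_integral_sub_le (μ := Ω.vol) hs
    refine ⟨K * c₅, by positivity, fun u hu u' hu' z => ?_⟩
    have hε : ∀ y ∈ Metric.closedBall (0 : E m) l₂, ‖y - u₀‖ < ‖u₀‖ + |l₂| + 1 := fun y hy => by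
      have h1 := norm_sub_le y u₀
      have h2 := mem_closedBall_zero_iff.1 hy
      linarith [le_abs_self l₂]
    have h := hKz _ _ _ _ c (c₅ * ‖u - u'‖) (by positivity) (hpair u hu) (hpair u' hu') (by
      filter_upwards [hG, ae_mem_of_mem_parameters hu, ae_mem_of_mem_parameters hu',
        ae_norm_le_norm (u - u'), Lp.coeFn_sub u u'] with x h1 h2 h3 h4 h5 t
      rw [h5, Pi.sub_apply] at h4
      have h6 := h1 t (u x) h2.1 (u' x) h3.1 (hε _ h2.2) (hε _ h3.2)
      constructor
      · refine h6.1.trans ?_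
        calc c₅ * (1 + |t| ^ 2) * ‖u x - u' x‖ ≤ c₅ * (1 + |t| ^ 2) * ‖u - u'‖ := by gcongr
          _ = _ := by ring
      · refine h6.2.trans ?_
        calc c₅ * (1 + |t|) * ‖u x - u' x‖ ≤ c₅ * (1 + |t|) * ‖u - u'‖ := by gcongr
          _ = _ := by ring) z
    constructor
    · refine h.1.trans_eq (by ring)
    · refine ContinuousLinearMap.opNorm_le_bound _ (by positivity) fun k => ?_
      rw [_root_.sub_apply, hDint u hu, hDint u' hu', Real.norm_eq_abs]
      refine (h.2 k).trans_eq (by ring)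
  · intro M
    obtain ⟨C, hC, hCg⟩ := exists_integral_superlinear_comparison (μ := Ω.vol) hs hc hp hR M
    refine ⟨C, hC, fun u hu δ hδ hδ1 z y y' hy hyy => ?_⟩
    refine hCg _ _ (hpair u hu) ?_ δ hδ hδ1 z y y' hy hyy
    filter_upwards [hsup, hu.1] with x h1 h2 t ht
    have := h1 _ h2 t ht
    exact ⟨ha.trans this.1, this.2⟩

/-- The lower bound of the functional for the limit datum. -/
theorem exists_lower_bound_action [NeZero n] [Fact (1 ≤ ENNReal.ofReal s)] (hs : 2 < s)
    (hκ : 0 < normConst n α) (hGz : IsPartialDeriv Ω G Gz)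
    (hC1 : IsCaratheodory Ω G ∧ IsCaratheodory Ω Gz) (hc : 0 ≤ c)
    (hgr : ∀ᵐ x ∂Ω.vol, ∀ z : ℝ, ∀ u ∈ U ∩ Metric.closedBall 0 l₂,
      |G x z u| ≤ c * (1 + |z| ^ s) ∧ |Gz x z u| ≤ c * (1 + |z| ^ (s - 1)))
    {v₀ : Y Ω α} (hC4 : NearDatum Ω α U G v₀) (hv₀ : ∀ w : X0 Ω α, Y.form v₀ (X0.toY w) = 0)
    {B : Y Ω α →L[ℝ] X0 Ω α →L[ℝ] ℝ} (hB : ∀ v w, B v w = gagliardoForm Ω α v (X0.toY w))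
    {S : Y Ω α →L[ℝ] Lp ℝ (ENNReal.ofReal s) Ω.vol} (hS : ∀ z, S z =ᵐ[Ω.vol] z)
    {T : X0 Ω α →L[ℝ] Lp ℝ (ENNReal.ofReal s) Ω.vol} (hT : ∀ w, T w = S (X0.toY w))
    {u : Lp (E m) ∞ Ω.vol} (hu : u ∈ parameters Ω U l₂) :
    ∃ C, ∀ w, normConst n α / 2 * ‖w‖ ^ 2 - C * ‖w‖ ^ s ≤
      action (normConst n α) B T S (fun z => ∫ x, G x (z x) (u x) ∂Ω.vol) v₀ w := by
  obtain ⟨ζ, b, hζ, hb, hbκ, hess, hnear⟩ := hC4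
  -- The strict inequality for the essential supremum leaves the gap `ζ - ζ'`, which is what makes
  -- `|w|` bounded below once `w + v₀` leaves the range of (C4).
  set ζ' : ℝ := (essSup (fun x => ENNReal.ofReal |v₀ x|) Ω.vol).toReal with hζ'
  have hess' : essSup (fun x => ENNReal.ofReal |v₀ x|) Ω.vol ≠ ⊤ := hess.ne_top
  have hζζ : ζ' < ζ := by
    rwa [← ENNReal.toReal_ofReal hζ.le, ENNReal.toReal_lt_toReal hess' ENNReal.ofReal_ne_top]
  obtain ⟨C, hC, hCg⟩ := exists_integral_lower_bound_near_datum (μ := Ω.vol) hs hc hκ hζζ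
    ENNReal.toReal_nonneg (by linarith : b ≤ normConst n α)
  obtain ⟨K, hK, hKT⟩ := T.bound
  refine ⟨C * K ^ s, fun w => ?_⟩
  have h1 := hCg _ _ (S v₀) (subcriticalPair hGz hC1 hc hgr hu) (by
    filter_upwards [hS v₀, ENNReal.ae_le_essSup (μ := Ω.vol) fun x => ENNReal.ofReal |v₀ x|]
      with x h1 h2
    rw [h1]
    exact (ENNReal.ofReal_le_iff_le_toReal hess').1 h2) (by
    filter_upwards [hS v₀, hnear, hu.1] with x h1 h2 h3 t ht
    rw [h1]
    exact h2 t ht _ h3) (T w)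
  have h2 : ∫ x, T w x * S v₀ x ∂Ω.vol = ∫ x, v₀ x * w x := by
    have h3 : ∫ x in Ω.carrier, v₀ x * w x = ∫ x, v₀ x * w x := by
      refine setIntegral_eq_integral_of_ae_compl_eq_zero ?_
      filter_upwards [w.ae_zero_compl] with x hx hxΩ
      rw [hx hxΩ, mul_zero]
    rw [← h3]
    refine integral_congr_ae ?_
    filter_upwards [hS v₀, hS (X0.toY w)] with x h1 h2
    rw [h1, hT, h2, mul_comm]
  -- Orthogonality of `v₀` to `X0` in the full inner product of `Y`: the linear term of the
  -- functional cancels the L² term produced by the potential.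
  have h3 : normConst n α * B v₀ w + normConst n α * (∫ x, T w x * S v₀ x ∂Ω.vol) = 0 := by
    have h4 := hv₀ w
    rw [Y.form] at h4
    rw [hB, h2, ← mul_add, add_comm, h4, mul_zero]
  have h4 : C * ‖T w‖ ^ s ≤ C * K ^ s * ‖w‖ ^ s := by
    rw [mul_assoc, ← Real.mul_rpow hK.le (norm_nonneg _)]
    gcongr
    exact hKT w
  unfold action
  linarith

/-- An endpoint beyond the mountain range, for all bounded data at once. -/
theorem exists_action_neg [NeZero n] [Fact (1 ≤ ENNReal.ofReal s)] (hs : 2 < s)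
    (hα₀ : 0 < α) (hα₂ : α < 2) (hGz : IsPartialDeriv Ω G Gz)
    (hC1 : IsCaratheodory Ω G ∧ IsCaratheodory Ω Gz) (hc : 0 ≤ c)
    (hgr : ∀ᵐ x ∂Ω.vol, ∀ z : ℝ, ∀ u ∈ U ∩ Metric.closedBall 0 l₂,
      |G x z u| ≤ c * (1 + |z| ^ s) ∧ |Gz x z u| ≤ c * (1 + |z| ^ (s - 1)))
    (hC3 : Superlinear Ω U G Gz)
    (B : Y Ω α →L[ℝ] X0 Ω α →L[ℝ] ℝ)
    {S : Y Ω α →L[ℝ] Lp ℝ (ENNReal.ofReal s) Ω.vol} (hS : ∀ z, S z =ᵐ[Ω.vol] z)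
    {T : X0 Ω α →L[ℝ] Lp ℝ (ENNReal.ofReal s) Ω.vol} (hT : ∀ w, T w = S (X0.toY w)) {M : ℝ}
    (hM : 0 ≤ M) :
    ∃ ω₁ : X0 Ω α, ∀ u ∈ parameters Ω U l₂, ∀ v : Y Ω α, ‖v‖ ≤ M →
      action (normConst n α) B T S (fun z => ∫ x, G x (z x) (u x) ∂Ω.vol) v ω₁ < 0 := by
  have hκ := normConst_pos (n := n) hα₀ hα₂
  have hs0 : 0 < s := by linarith
  obtain ⟨w, hw⟩ := X0.exists_ne_zero (Ω := Ω) hα₀ hα₂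
  obtain ⟨p, a, R, hp, ha, hR, hsup⟩ := hC3
  obtain ⟨K, hK, hKz⟩ := exists_integral_abs_mul_abs_le (μ := Ω.vol) hs.le
  have hsq : ∀ z : Lp ℝ (ENNReal.ofReal s) Ω.vol, Integrable (fun x => z x ^ 2) Ω.vol ∧
      ∫ x, z x ^ 2 ∂Ω.vol ≤ K * ‖z‖ ^ 2 := by
    intro z
    have h1 : (fun x => |z x| * |z x|) = fun x => z x ^ 2 := by
      funext x; rw [abs_mul_abs_self, pow_two]
    have := hKz z z
    rwa [h1, ← pow_two] at this
  set I : ℝ := ∫ x, T w x ^ 2 ∂Ω.vol with hI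
  have hI0 : 0 < I := by
    refine lt_of_le_of_ne (integral_nonneg fun x => sq_nonneg _) fun h0 => hw ?_
    rw [hI, eq_comm, integral_eq_zero_iff_of_nonneg (fun x => sq_nonneg _) (hsq _).1] at h0
    have h1 : ∀ᵐ x ∂Ω.vol, w x = 0 := by
      filter_upwards [h0, hS (X0.toY w)] with x h1 h2
      rw [← h2, ← hT]
      simpa using h1
    have h2 : (Y.toL2 (X0.toY w) : E n → ℝ) =ᵐ[volume] 0 := by
      filter_upwards [w.ae_zero_compl, (ae_restrict_iff' Ω.isOpen.measurableSet).1 h1] with x h2 h3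
      by_cases hx : x ∈ Ω.carrier
      · exact h3 hx
      · exact h2 hx
    have h3 : Y.toL2 (X0.toY w) = 0 := (Lp.eq_zero_iff_ae_eq_zero).2 h2
    exact X0.toY_injective (Y.toL2_injective (by rw [h3, map_zero, map_zero]))
  set κ := normConst n α with hκ'
  -- Then `A * I = κ * ‖w‖ ^ 2 + 2`, so at `t • w` the potential outweighs the quadratic energy by
  -- `t ^ 2`, up to constants.
  set A : ℝ := (κ * ‖w‖ ^ 2 + 2) / I with hA
  have hA0 : 0 < A := by positivity
  obtain ⟨C, hC, hCg⟩ := exists_integral_quadratic_lower_bound (μ := Ω.vol) hs hc hp ha hR hA0.le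
  obtain ⟨b, hb, hBb⟩ := exists_bilinear_bound B
  set N : ℝ := ‖S‖ * M with hN
  have hN0 : 0 ≤ N := by positivity
  set β : ℝ := κ * (b * M * ‖w‖) with hβ
  set γ : ℝ := A * (K * N ^ 2) + C + c * (Ω.vol.real univ + N ^ s) with hγ
  have hβ0 : 0 ≤ β := by positivity
  have hγ0 : 0 ≤ γ := by positivity
  -- The remaining terms are at most `t * β + γ`, with `β` from the linear term and `γ` from the
  -- constants; this `t` makes `t ^ 2` larger.
  set t : ℝ := β + γ + 1 with ht
  have ht0 : 0 < t := by positivity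
  refine ⟨t • w, fun u hu v hv => ?_⟩
  have hpair := subcriticalPair hGz hC1 hc hgr hu
  have hSv : ‖S v‖ ≤ N := S.le_opNorm_of_le hv
  have e1 : ∫ x, G x (S v x) (u x) ∂Ω.vol ≤ c * (Ω.vol.real univ + N ^ s) := by
    refine (le_abs_self _).trans ((hpair.abs_integral_le hs0 (S v)).trans ?_)
    gcongr
  have e2 := hCg _ _ hpair (by
    filter_upwards [hsup, hu.1] with x h1 h2 τ hτ
    exact h1 _ h2 τ hτ) (T (t • w) + S v)
  have e3 : t ^ 2 / 2 * I - K * N ^ 2 ≤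
      ∫ x, (T (t • w) + S v : Lp ℝ (ENNReal.ofReal s) Ω.vol) x ^ 2 ∂Ω.vol := by
    have h1 : ∫ x, (t ^ 2 / 2 * T w x ^ 2 - S v x ^ 2) ∂Ω.vol ≤
        ∫ x, (T (t • w) + S v : Lp ℝ (ENNReal.ofReal s) Ω.vol) x ^ 2 ∂Ω.vol := by
      refine integral_mono_ae (((hsq _).1.const_mul _).sub (hsq _).1) (hsq _).1 ?_
      rw [map_smul]
      filter_upwards [Lp.coeFn_add (t • T w) (S v), Lp.coeFn_smul t (T w)] with x h1 h2
      rw [h1, Pi.add_apply, h2, Pi.smul_apply, smul_eq_mul]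
      -- With `X = t * T w x` and `Y = S v x`, the identity behind this is `(X + Y)² - X² / 2 + Y² =
      -- (X + 2 * Y)² / 2`.
      have := sq_nonneg (t * T w x + 2 * S v x)
      linarith
    rw [integral_sub ((hsq _).1.const_mul _) (hsq _).1, integral_const_mul] at h1
    have h2 : K * ‖S v‖ ^ 2 ≤ K * N ^ 2 := by gcongr
    linarith [(hsq (S v)).2]
  have e4 : κ * B v (t • w) ≤ t * β := by
    have h3 := hBb v w
    have h4 : b * ‖v‖ * ‖w‖ ≤ b * M * ‖w‖ := by gcongr
    rw [map_smul, smul_eq_mul]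
    have h5 := mul_le_mul_of_nonneg_left ((le_abs_self _).trans (h3.trans h4))
      (by positivity : 0 ≤ t * κ)
    linarith
  have e5 : ‖t • w‖ ^ 2 = t ^ 2 * ‖w‖ ^ 2 := by
    rw [norm_smul, mul_pow, Real.norm_eq_abs, sq_abs]
  have e6 := mul_le_mul_of_nonneg_left e3 hA0.le
  have e7 : A * (t ^ 2 / 2 * I - K * N ^ 2) =
      t ^ 2 / 2 * (κ * ‖w‖ ^ 2) + t ^ 2 - A * (K * N ^ 2) := by
    have : A * I = κ * ‖w‖ ^ 2 + 2 := by rw [hA]; field_simp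
    calc _ = t ^ 2 / 2 * (A * I) - A * (K * N ^ 2) := by ring
      _ = _ := by rw [this]; ring
  have e8 : t * β + γ < t ^ 2 := by
    have h1 : t ^ 2 = t * β + t * γ + t := by
      nth_rewrite 1 [pow_two]; nth_rewrite 2 [ht]; ring
    have h2 : γ ≤ t * γ := le_mul_of_one_le_left hγ0 (by linarith)
    linarith
  unfold action
  rw [e5]
  linarith

end Nonlinearity

end FracLap

theorem mainTheorem1 {n m : ℕ} [NeZero n] (hn : 2 ≤ n) (hm : 1 ≤ m)
    (α : ℝ) (hα₁ : 1 < α) (hα₂ : α < 2)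
    (Ω : FracLap.BoundedLipschitzDomain n) (U : Set (FracLap.E m))
    (G Gz : FracLap.E n → ℝ → FracLap.E m → ℝ)
    (v₀ : FracLap.Y Ω α) (l₁ l₂ : ℝ) (hl₁ : 0 < l₁) (hl₂ : 0 < l₂)
    (hGz : FracLap.IsPartialDeriv Ω G Gz)
    (hC1 : FracLap.IsCaratheodory Ω G ∧ FracLap.IsCaratheodory Ω Gz)
    (hC2 : FracLap.SubcriticalGrowth Ω α U G Gz)
    (hC3 : FracLap.Superlinear Ω U G Gz)
    (hC4 : FracLap.NearDatum Ω α U G v₀)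
    (hC5 : FracLap.LipschitzInParameter Ω U G Gz)
    (v : ℕ → FracLap.Y Ω α) (hv : ∀ k, v k ∈ FracLap.boundaryData Ω α v₀ l₁)
    (hv₀ : v₀ ∈ FracLap.boundaryData Ω α v₀ l₁)
    (hvlim : Filter.Tendsto v Filter.atTop (nhds v₀))
    (u : ℕ → MeasureTheory.Lp (FracLap.E m) ⊤ Ω.vol)
    (u₀ : MeasureTheory.Lp (FracLap.E m) ⊤ Ω.vol)
    (hu : ∀ k, u k ∈ FracLap.parameters Ω U l₂) (hu₀ : u₀ ∈ FracLap.parameters Ω U l₂)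
    (hulim : Filter.Tendsto u Filter.atTop (nhds u₀)) :
    -- an endpoint `ω₁` beyond the mountain range exists, even one for all data at once
    (∃ ω₁ : FracLap.X0 Ω α, ∀ u' ∈ FracLap.parameters Ω U l₂,
      ∀ v' ∈ FracLap.boundaryData Ω α v₀ l₁, FracLap.shiftedAction Ω α G u' v' ω₁ < 0) ∧
    -- and for every such endpoint the result holds
    ∀ ω₁ : FracLap.X0 Ω α, FracLap.shiftedAction Ω α G u₀ v₀ ω₁ < 0 →
      (∀ᶠ k in Filter.atTop,
        (FracLap.mountainPassSet (FracLap.shiftedAction Ω α G (u k) (v k)) 0 ω₁).Nonempty ∧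
        0 ∉ FracLap.mountainPassSet (FracLap.shiftedAction Ω α G (u k) (v k)) 0 ω₁ ∧
        ∀ w ∈ FracLap.mountainPassSet (FracLap.shiftedAction Ω α G (u k) (v k)) 0 ω₁,
          FracLap.shiftedAction Ω α G (u k) (v k) w ≠ 0) ∧
      (∀ w : ℕ → FracLap.X0 Ω α,
        (∀ᶠ k in Filter.atTop,
          w k ∈ FracLap.mountainPassSet (FracLap.shiftedAction Ω α G (u k) (v k)) 0 ω₁) →
        IsCompact (closure (Set.range w))) ∧
      FracLap.upperLimit
          (fun k => FracLap.mountainPassSet (FracLap.shiftedAction Ω α G (u k) (v k)) 0 ω₁) ⊆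
        FracLap.mountainPassSet (FracLap.shiftedAction Ω α G u₀ v₀) 0 ω₁ := by

  have hα₀ : 0 < α := by linarith
  have hαn : α < n := by
    have : (2 : ℝ) ≤ n := by exact_mod_cast hn
    linarith
  have hκ := FracLap.normConst_pos (n := n) hα₀ hα₂
  obtain ⟨s, hs2, hs, hgrowth⟩ := hC2
  -- All parameters take almost all their values in this one bounded subset of `U`, so a single
  -- growth constant serves throughout.
  obtain ⟨c, hc, hgr⟩ := hgrowth (U ∩ Metric.closedBall 0 l₂) inter_subset_left
    (Metric.isBounded_closedBall.subset inter_subset_right)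
  have : Fact (1 ≤ ENNReal.ofReal s) := ⟨ENNReal.one_le_ofReal.2 (by linarith)⟩
  have := FracLap.X0.completeSpace (Ω := Ω) hα₀
  have := FracLap.X0.separableSpace (Ω := Ω) (α := α)
  obtain ⟨S, hS⟩ := FracLap.exists_restrict_clm (Ω := Ω) hα₀ hαn (by linarith) hs
  obtain ⟨J, hJ⟩ := FracLap.exists_toY_clm (Ω := Ω) hα₀
  obtain ⟨B, hB⟩ := FracLap.exists_form_clm Ω α
  set T : FracLap.X0 Ω α →L[ℝ] Lp ℝ (ENNReal.ofReal s) Ω.vol := S.comp J with hTdef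
  have hT : ∀ w, T w = S (FracLap.X0.toY w) := fun w => congrArg S (hJ w)
  set Φ : Lp (FracLap.E m) ⊤ Ω.vol → Lp ℝ (ENNReal.ofReal s) Ω.vol → ℝ :=
    fun u z => ∫ x, G x (z x) (u x) ∂Ω.vol with hΦ
  have haction : ∀ (u : Lp (FracLap.E m) ⊤ Ω.vol) (v : FracLap.Y Ω α),
      FracLap.shiftedAction Ω α G u v = action (FracLap.normConst n α) B T S (Φ u) v := by
    intro u v
    refine FracLap.shiftedAction_eq_action hB (fun w => ?_) ?_
    · refine integral_congr_ae ?_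
      filter_upwards [hS (FracLap.X0.toY w), hS v, Lp.coeFn_add (T w) (S v)] with x h1 h2 h3
      rw [h3, Pi.add_apply, hT, h1, h2]
    · refine integral_congr_ae ?_
      filter_upwards [hS v] with x h1
      rw [h1]
  simp only [haction]
  obtain ⟨D, q, hD⟩ := FracLap.exists_superlinearFamily (l₂ := l₂) hs2 hGz hC1 hc.le hgr hC3 hC5
    (FracLap.nonempty_of_mem_parameters hu₀)
  constructor
  -- The admissible data lie in the ball of radius `‖v₀‖ + l₁` of `Y`, and the endpoint depends on
  -- the data only through this radius.
  · obtain ⟨ω₁, hω₁⟩ := FracLap.exists_action_neg (l₂ := l₂) hs2 hα₀ hα₂ hGz hC1 hc.le hgr hC3 B hS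
      hT (by positivity : 0 ≤ ‖v₀‖ + l₁)
    refine ⟨ω₁, fun u' hu' v' hv' => hω₁ u' hu' v' ?_⟩
    linarith [hv'.1, norm_le_norm_add_norm_sub' v' v₀]
  · intro ω₁ hω₁
    obtain ⟨C₀, hC₀⟩ := FracLap.exists_lower_bound_action (l₂ := l₂) hs2 hκ hGz hC1 hc.le hgr hC4
      hv₀.2 hB hS hT hu₀
    obtain ⟨κ, C, hF⟩ := hD.exists_mountainPassFamily hκ B S (fun k M hM hk => by
      simp only [hT]
      exact FracLap.X0.tendsto_restrict hα₀ hαn hs2 hs hS hM hk) hu hu₀ hulim hvlim hs2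
      (half_pos hκ) hC₀
    exact ⟨hF.eventually_nonempty hω₁, fun w hw => hF.isCompact_closure_range hw,
      hF.upperLimit_subset hω₁⟩
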